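/- Fix the following terminology. Let $k\ge 2$ and let $P:\{-1,1\}^k\to\{0,1\}$ be a predicate, with $\mathbb{E}[P]=2^{-k}\,|P^{-1}(1)|$. A constraint on the variables $x_1,\dots,x_n$ is a pair $(c,S)$ with $c\in\{-1,1\}^k$ and $S\in[n]^k$; it is satisfied by $x\in\{-1,1\}^n$ if $P(c_1x_{S_1},\dots,c_kx_{S_k})=1$. An instance $\mathcal I$ of $\mathrm{CSP}(P)$ is a finite multiset of constraints, and $\mathrm{Opt}(\mathcal I)$ is the maximum over $x\in\{-1,1\}^n$ of the fraction of constraints of $\mathcal I$ that $x$ satisfies (it is $0$ for the empty instance). Let $\mathcal F_P(n,p)$ be the random instance that contains each of the $2^kn^k$ possible constraints independently with probability $p$, and let $\overline m=2^kn^kp$ be its expected number of constraints. **Theorem.** There is a universal constant $C$ such that for every $k\ge 2$ and every $P:\{-1,1\}^k\to\{0,1\}$ there is a deterministic algorithm $\mathcal A$ that takes as input an instance $\mathcal I$ of $\mathrm{CSP}(P)$ on $n$ variables (given as a list of its $m$ constraints) and a rational number $\gamma>0$, and answers either "$\mathrm{Opt}(\mathcal I)\le \mathbb{E}[P]+\gamma$"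 or "fail", such that: 1. $\mathcal A$ runs in time polynomial in $n$, $m$ and the bit length of $\gamma$, for fixed $k$ and $P$ (on a random access machine with logarithmic cost); 2. $\mathcal A$ never errs: for every $\mathcal I$ and $\gamma$, if it answers "$\mathrm{Opt}(\mathcal I)\le \mathbb{E}[P]+\gamma$", then this inequality holds; 3. with high probability $\mathcal A$ does not fail: there is $\varepsilon:\mathbb N\to\mathbb R$ (depending on $k$ and $P$ only) with $\varepsilon(n)\to 0$ as $n\to\infty$ such that for all $n$, all $p\in[0,1]$ and all rational $\gamma>0$ with $$\overline m=2^kn^kp\ \ge\ \frac{2^{Ck}\,n^{k/2}\,\log^5 n}{\gamma^2},$$ with probability at least $1-\varepsilon(n)$ over $\mathcal I\sim\mathcal F_P(n,p)$ the algorithm $\mathcal A$, given $\gamma$ and $\mathcal I$ with its constraints listed in any order, answers "$\mathrm{Opt}(\mathcal I)\le \mathbb{E}[P]+\gamma$". -/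

import Mathlib

open Filter Topology MeasureTheory ProbabilityTheory

namespace RandomCSP

/-! ### Constraint satisfaction problems over `{-1, 1}` -/

/-- A constraint of arity `k` on the variables `x_0, …, x_{n-1}`: a negation pattern in `{-1, 1}^k`
together with a scope in `[n]^k`. Here `ℤˣ = {1, -1}`. -/
abbrev Constraint (k n : ℕ) : Type := (Fin k → ℤˣ) × (Fin k → Fin n)

/-- An instance is a multiset of constraints. -/
abbrev Instance (k n : ℕ) : Type := Multiset (Constraint k n)

variable {k n : ℕ}

/-- The constraint `(c, S)` holds at `x` if `P (c ∘ x_S) = 1` (entrywise product). -/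
def Constraint.holds (P : (Fin k → ℤˣ) → Bool) (x : Fin n → ℤˣ) (C : Constraint k n) : Bool :=
  P fun i => C.1 i * x (C.2 i)

/-- `Val_I(x)`: the fraction of the constraints of `I` (with multiplicity) that `x` satisfies;
it is `0` if `I` is empty. -/
noncomputable def val (P : (Fin k → ℤˣ) → Bool) (I : Instance k n) (x : Fin n → ℤˣ) : ℝ :=
  (I.countP fun C => C.holds P x = true : ℕ) / (Multiset.card I : ℕ)

/-- `Opt(I)`: the maximum of `Val_I(x)` over the (finitely many) assignments `x`. -/
noncomputable def opt (P : (Fin k → ℤˣ) → Bool) (I : Instance k n) : ℝ :=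
  ⨆ x : Fin n → ℤˣ, val P I x

/-- `E[P]`: the fraction of `{-1, 1}^k` that satisfies `P`. -/
noncomputable def mean (P : (Fin k → ℤˣ) → Bool) : ℝ :=
  ((Finset.univ.filter fun z : Fin k → ℤˣ => P z = true).card : ℝ) / 2 ^ k

/-- The random instance: each of the `2^k n^k` possible constraints is included independently
with probability `p`. -/
noncomputable def randomInstance (k n : ℕ) (p : unitInterval) : Measure (Set (Constraint k n)) :=
  setBernoulli Set.univ p

/-! ### A random access machine with logarithmic cost

Programs are structured programs over finitely many named infinite arrays of integers with indirect
addressing. Every operation is charged the bit length of the value that it produces (so that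
the operands of an operation and the addresses of memory accesses are charged too). This is the
usual logarithmic-cost random access machine; up to a polynomial, its running time is that of a
Turing machine. -/

/-- Contents of the memory: `σ a i` is the value of cell `i` of array `a`. -/
abbrev Mem : Type := ℕ → ℕ → ℤ

inductive Expr : Type
  /-- an integer constant -/
  | lit (z : ℤ)
  /-- `get a e` reads cell `e` of array `a` -/
  | get (a : ℕ) (e : Expr)
  | add (e₁ e₂ : Expr)
  | sub (e₁ e₂ : Expr)
  | mul (e₁ e₂ : Expr)
  /-- integer division with nonnegative remainder; division by `0` gives `0` -/
  | div (e₁ e₂ : Expr)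
  /-- `1` if the first value is less than the second one, `0` otherwise -/
  | lt (e₁ e₂ : Expr)

/-- The value of an expression; a negative address is read as `0`. -/
def Expr.eval (σ : Mem) : Expr → ℤ
  | lit z => z
  | get a e => σ a (e.eval σ).toNat
  | add e₁ e₂ => e₁.eval σ + e₂.eval σ
  | sub e₁ e₂ => e₁.eval σ - e₂.eval σ
  | mul e₁ e₂ => e₁.eval σ * e₂.eval σ
  | div e₁ e₂ => e₁.eval σ / e₂.eval σ
  | lt e₁ e₂ => if e₁.eval σ < e₂.eval σ then 1 else 0

/-- The number of bits of an integer. -/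
def bits (z : ℤ) : ℕ := Nat.size z.natAbs

/-- The cost of evaluating an expression: every node costs one plus the bit length of its value. -/
def Expr.cost (σ : Mem) : Expr → ℕ
  | lit z => 1 + bits z
  | get a e => e.cost σ + (1 + bits ((get a e).eval σ))
  | add e₁ e₂ => e₁.cost σ + e₂.cost σ + (1 + bits ((add e₁ e₂).eval σ))
  | sub e₁ e₂ => e₁.cost σ + e₂.cost σ + (1 + bits ((sub e₁ e₂).eval σ))
  | mul e₁ e₂ => e₁.cost σ + e₂.cost σ + (1 + bits ((mul e₁ e₂).eval σ))
  | div e₁ e₂ => e₁.cost σ + e₂.cost σ + (1 + bits ((div e₁ e₂).eval σ))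
  | lt e₁ e₂ => e₁.cost σ + e₂.cost σ + (1 + bits ((lt e₁ e₂).eval σ))

inductive Program : Type
  | skip
  /-- `set a i e` stores the value of `e` in cell `i` of array `a` -/
  | set (a : ℕ) (i e : Expr)
  | seq (c d : Program)
  /-- run `c` if the value of `e` is nonzero, and `d` otherwise -/
  | ite (e : Expr) (c d : Program)
  /-- repeat `c` as long as the value of `e` is nonzero -/
  | while (e : Expr) (c : Program)

/-- The memory after storing `z` in cell `i` of array `a`. -/
def Mem.store (σ : Mem) (a i : ℕ) (z : ℤ) : Mem :=
  fun b j => if b = a ∧ j = i then z else σ b j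

/-- `Exec c σ τ t`: started with memory `σ`, the program `c` halts with memory `τ` after time `t`. -/
inductive Exec : Program → Mem → Mem → ℕ → Prop
  | skip (σ : Mem) : Exec .skip σ σ 1
  | set (σ : Mem) (a : ℕ) (i e : Expr) :
      Exec (.set a i e) σ (σ.store a (i.eval σ).toNat (e.eval σ)) (1 + i.cost σ + e.cost σ)
  | seq {c d : Program} {σ τ ρ : Mem} {s t : ℕ} :
      Exec c σ τ s → Exec d τ ρ t → Exec (.seq c d) σ ρ (1 + s + t)
  | ite_true {e : Expr} {c d : Program} {σ τ : Mem} {t : ℕ} :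
      e.eval σ ≠ 0 → Exec c σ τ t → Exec (.ite e c d) σ τ (1 + e.cost σ + t)
  | ite_false {e : Expr} {c d : Program} {σ τ : Mem} {t : ℕ} :
      e.eval σ = 0 → Exec d σ τ t → Exec (.ite e c d) σ τ (1 + e.cost σ + t)
  | while_true {e : Expr} {c : Program} {σ τ ρ : Mem} {s t : ℕ} :
      e.eval σ ≠ 0 → Exec c σ τ s → Exec (.while e c) τ ρ t →
        Exec (.while e c) σ ρ (1 + e.cost σ + s + t)
  | while_false {e : Expr} {c : Program} {σ : Mem} :
      e.eval σ = 0 → Exec (.while e c) σ σ (1 + e.cost σ)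

/-- The machine is deterministic: the final memory and the running time are unique. -/
theorem Exec.unique {c : Program} {σ τ : Mem} {t : ℕ} (h : Exec c σ τ t) :
    ∀ {τ' : Mem} {t' : ℕ}, Exec c σ τ' t' → τ' = τ ∧ t' = t := by
  induction h with
  | skip σ => intro _ _ h'; cases h'; exact ⟨rfl, rfl⟩
  | set σ a i e => intro _ _ h'; cases h'; exact ⟨rfl, rfl⟩
  | seq _ _ ih₁ ih₂ =>
    intro _ _ h'
    cases h' with
    | seq h₁ h₂ =>
      obtain ⟨rfl, rfl⟩ := ih₁ h₁
      obtain ⟨rfl, rfl⟩ := ih₂ h₂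
      exact ⟨rfl, rfl⟩
  | ite_true he _ ih =>
    intro _ _ h'
    cases h' with
    | ite_true _ h₁ => obtain ⟨rfl, rfl⟩ := ih h₁; exact ⟨rfl, rfl⟩
    | ite_false he' _ => exact absurd he' he
  | ite_false he _ ih =>
    intro _ _ h'
    cases h' with
    | ite_true he' _ => exact absurd he he'
    | ite_false _ h₁ => obtain ⟨rfl, rfl⟩ := ih h₁; exact ⟨rfl, rfl⟩
  | while_true he _ _ ih₁ ih₂ =>
    intro _ _ h'
    cases h' with
    | while_true _ h₁ h₂ =>
      obtain ⟨rfl, rfl⟩ := ih₁ h₁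
      obtain ⟨rfl, rfl⟩ := ih₂ h₂
      exact ⟨rfl, rfl⟩
    | while_false he' => exact absurd he' he
  | while_false he =>
    intro _ _ h'
    cases h' with
    | while_true he' _ _ => exact absurd he he'
    | while_false _ => exact ⟨rfl, rfl⟩

/-- Initially, array `0` holds the input and all other cells are `0`. -/
def initMem (input : List ℤ) : Mem := fun a i => if a = 0 then input.getD i 0 else 0

/-- On the given input, the program `A` halts within time `t`. -/
def Program.HaltsWithin (A : Program) (input : List ℤ) (t : ℕ) : Prop :=
  ∃ τ s, Exec A (initMem input) τ s ∧ s ≤ t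

/-- On the given input, the program `A` halts and accepts: cell `0` of array `1` is nonzero at
the end. -/
def Program.Accepts (A : Program) (input : List ℤ) : Prop :=
  ∃ τ s, Exec A (initMem input) τ s ∧ τ 1 0 ≠ 0

/-! ### Instances as inputs of algorithms -/

/-- A constraint is written as `c_1, S_1, …, c_k, S_k`. -/
def encodeConstraint (C : Constraint k n) : List ℤ :=
  (List.ofFn fun i : Fin k => [((C.1 i : ℤˣ) : ℤ), ((C.2 i : ℕ) : ℤ)]).flatten

/-- The input for the instance listed by `l` and the rational number `γ`: the number of variables,
the number of constraints, the numerator and the denominator of `γ`, then all the constraints. -/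
def encode (l : List (Constraint k n)) (γ : ℚ) : List ℤ :=
  [(n : ℤ), (l.length : ℤ), γ.num, (γ.den : ℤ)] ++ l.flatMap encodeConstraint

/-- The size of the input: the number of variables, plus the number of constraints, plus the bit
length of `γ`. -/
def inputSize (l : List (Constraint k n)) (γ : ℚ) : ℕ :=
  n + l.length + bits γ.num + bits γ.den

/-- `A` certifies `Opt ≤ E[P] + γ` on the instance listed by `l` if it accepts; otherwise the
answer of `A` is "fail". -/
def Certifies (A : Program) (l : List (Constraint k n)) (γ : ℚ) : Prop :=
  A.Accepts (encode l γ)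

/-- `A` runs in polynomial time on all instances of arity `k`. -/
def PolyTime (k : ℕ) (A : Program) : Prop :=
  ∃ q : Polynomial ℕ, ∀ (n : ℕ) (l : List (Constraint k n)) (γ : ℚ), 0 < γ →
    A.HaltsWithin (encode l γ) (q.eval (inputSize l γ))

/-- `A` never errs: whenever it certifies `Opt(I) ≤ E[P] + γ`, this is true. -/
def NeverErrs (P : (Fin k → ℤˣ) → Bool) (A : Program) : Prop :=
  ∀ (n : ℕ) (l : List (Constraint k n)) (γ : ℚ), 0 < γ →
    Certifies A l γ → opt P (l : Instance k n) ≤ mean P + γ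

/-- The event that `A` certifies the bound with parameter `γ` on the random set `I` of constraints,
in whichever order these are listed. -/
def certifiedEvent (A : Program) (k n : ℕ) (γ : ℚ) : Set (Set (Constraint k n)) :=
  {I | ∀ l : List (Constraint k n), l.Nodup → (∀ C, C ∈ l ↔ C ∈ I) → Certifies A l γ}

end RandomCSP

/-! Expand the indicator of `P` in characters. The empty character contributes `E[P]`, and the other
coefficients, fewer than `2^k` of them, are at most `1` in absolute value. So it is enough to
certify for every nonempty set `T` of positions that `|∑_C ∏_{i ∈ T} c_i x_{S_i}| ≤ γ m / 2^k` for
all `x` (`opt_le_of_passes`).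

To certify this, cut `T` into two halves `a`, `b` of size `s` and a remainder `i` of size `r ≤ 1`.
Cauchy–Schwarz over the remainder bounds the square of the sum by `n^r` times a sum over pairs `(C,
C')` that agree in the remainder. Crossing the halves, so that `a(C)` goes with `b(C')` and `a(C')`
with `b(C)`, turns that sum into a diagonal term, independent of `x`, plus the value at a sign
vector of the quadratic form of an integer matrix `A` (`SignedTriples.sq_sum_le_card_mul`). Iterated
Cauchy–Schwarz bounds the form by the Frobenius norm of `A^(2^ρ)` with `2^ρ` of order `log n`
(`quadForm_pow_le`). All quantities are integers, so the test `Split.Passes` is an exact comparison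
and is sound for every instance (`Split.Passes.abs_sum_le`).

On random instances the test passes by the moment method. Negating one sign pairs each constraint
with an opposite one, and `A` is quadratic in the differences `ζ` of the two indicators. A monomial
in which some `ζ` has odd multiplicity has mean zero. In the others every `ζ` occurs at least twice,
so degree `2N` with `d` distinct factors gives at most `L^N (2p/L)^d` for any `L ≥ 1`. With this
weight the closed walks behind `tr A^R` can be summed one step at a time, each step costing a factor
`(2R)^2` (`sum_step_le`); no classification of walk shapes is needed. As `R` is at least of order
`log n`, factors polynomial in `n` disappear in the `R`-th root, and `Split.budget_ge` checks that
the assumed density leaves enough room. Markov and Chebyshev then give `Split.bexp_not_passes_le`.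

The algorithm runs the test for all `T`, and accepts at once if `γ ≥ 1`. It is polynomial because
only about `log log n` squarings are made, so the entries keep polynomially many bits; the running
time is derived from one bound on the cells and one on the numbers of iterations
(`exists_reaches_refuter`). -/

namespace RandomCSP

/-! ### Expectation over a Bernoulli random subset as a finite sum -/

section BernoulliExpectation

open scoped Classical in
/-- The expectation of `g I` where `I` contains each element independently with probability `p`. -/
noncomputable def bexp {Ω : Type*} [Fintype Ω] (p : ℝ) (g : Finset Ω → ℝ) : ℝ :=
  ∑ I : Finset Ω, p ^ I.card * (1 - p) ^ Iᶜ.card * g I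

variable {Ω : Type*} [Fintype Ω] {p : ℝ}

lemma bexp_sum {ι : Type*} (s : Finset ι) (g : ι → Finset Ω → ℝ) :
    bexp p (fun I => ∑ i ∈ s, g i I) = ∑ i ∈ s, bexp p (g i) := by
  simp only [bexp, Finset.mul_sum]
  exact Finset.sum_comm

lemma bexp_const_mul (c : ℝ) (g : Finset Ω → ℝ) :
    bexp p (fun I => c * g I) = c * bexp p g := by
  simp only [bexp, Finset.mul_sum]
  exact Finset.sum_congr rfl fun _ _ => by ring

lemma bexp_add (f g : Finset Ω → ℝ) :
    bexp p (fun I => f I + g I) = bexp p f + bexp p g := by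
  simp only [bexp, ← Finset.sum_add_distrib]
  exact Finset.sum_congr rfl fun _ _ => by ring

lemma bexp_neg (f : Finset Ω → ℝ) : bexp p (fun I => -f I) = -bexp p f := by
  simp only [bexp, ← Finset.sum_neg_distrib]
  exact Finset.sum_congr rfl fun _ _ => by ring

lemma bexp_mono (hp : p ∈ Set.Icc (0 : ℝ) 1) {f g : Finset Ω → ℝ} (h : ∀ I, f I ≤ g I) :
    bexp p f ≤ bexp p g := by
  have h0 := hp.1
  have h1 : 0 ≤ 1 - p := by linarith [hp.2]
  exact Finset.sum_le_sum fun I _ => mul_le_mul_of_nonneg_left (h I) (by positivity)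

lemma abs_bexp_le (hp : p ∈ Set.Icc (0 : ℝ) 1) (f : Finset Ω → ℝ) :
    |bexp p f| ≤ bexp p (fun I => |f I|) := by
  rw [abs_le, ← bexp_neg]
  exact ⟨bexp_mono hp fun I => neg_abs_le _, bexp_mono hp fun I => le_abs_self _⟩

/-- The probability that all elements of `F` are included. -/
lemma bexp_subset [DecidableEq Ω] (F : Finset Ω) : bexp p (fun I => if F ⊆ I then 1 else 0) = p ^ F.card := by
  -- Expanding this product over subsets `I` produces the weights of exactly those `I` that contain
  -- `F`; any omitted element of `F` contributes a factor `0`.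
  have h := Finset.prod_add (fun _ : Ω => p) (fun C => if C ∈ F then 0 else 1 - p) Finset.univ
  have hl : ∏ C : Ω, (p + if C ∈ F then 0 else 1 - p) = p ^ F.card := by
    rw [← Finset.prod_const, ← Finset.prod_subset (Finset.subset_univ F)]
    · exact Finset.prod_congr rfl fun C hC => by simp [hC]
    · intro C _ hC
      simp [hC]
  rw [← hl, h, Finset.powerset_univ, bexp]
  refine Finset.sum_congr rfl fun I _ => ?_
  rw [Finset.prod_const, mul_assoc, ← Finset.compl_eq_univ_sdiff]
  congr 1
  rw [Subsingleton.elim (fun a b => Classical.propDecidable (a = b)) ‹DecidableEq Ω›]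
  split_ifs with hF
  · rw [mul_one, ← Finset.prod_const]
    refine Finset.prod_congr rfl fun C hC => ?_
    rw [if_neg fun hCF => Finset.mem_compl.1 hC (hF hCF)]
  · obtain ⟨C, hCF, hCI⟩ := Finset.not_subset.1 hF
    rw [mul_zero, Finset.prod_eq_zero (Finset.mem_compl.2 hCI)]
    simp [hCF]

lemma bexp_one : bexp p (fun _ : Finset Ω => 1) = 1 := by
  classical simpa using bexp_subset (p := p) (∅ : Finset Ω)

/-- The weight of `I` depends only on its cardinality. Applied to transpositions of opposite
elements, this is the symmetry that kills odd moments. -/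
lemma bexp_perm (τ : Equiv.Perm Ω) (g : Finset Ω → ℝ) :
    bexp p (fun I => g (I.map τ.toEmbedding)) = bexp p g := by
  classical
  refine Fintype.sum_equiv (Equiv.finsetCongr τ) _ _ fun I => ?_
  simp [Finset.card_compl, Equiv.finsetCongr_apply]

open scoped Classical in
lemma bexp_markov (hp : p ∈ Set.Icc (0 : ℝ) 1) {g : Finset Ω → ℝ} (hg : ∀ I, 0 ≤ g I) {a b : ℝ}
    (ha : 0 < a) (hgb : bexp p g ≤ b) : bexp p (fun I => if g I ≤ a then 0 else 1) ≤ b / a := by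
  rw [le_div_iff₀ ha, mul_comm, ← bexp_const_mul]
  refine (bexp_mono hp fun I => ?_).trans hgb
  split_ifs with h
  · simpa using hg I
  · simpa using (not_le.1 h).le

open scoped Classical in
-- The bridge from finite sums to the measure of the theorem. A sufficient condition `G` for the
-- event is enough, as only a lower bound is needed.
lemma one_sub_bexp_le_setBernoulli (p : unitInterval) {G : Finset Ω → Prop} {E : Set (Set Ω)}
    (h : ∀ I : Finset Ω, G I → (I : Set Ω) ∈ E) :
    1 - bexp p (fun I => if G I then 0 else 1) ≤ (setBernoulli (Set.univ : Set Ω) p).real E := by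
  have h1 : 1 - bexp (p : ℝ) (fun I : Finset Ω => if G I then 0 else 1)
      = bexp (p : ℝ) (fun I : Finset Ω => if G I then 1 else 0) := by
    rw [sub_eq_iff_eq_add, ← bexp_add]
    refine (bexp_one (p := (p : ℝ)) (Ω := Ω)).symm.trans ?_
    congr 1
    funext I
    split_ifs <;> simp
  rw [h1]
  have h2 : ∀ I : Finset Ω, (p : ℝ) ^ I.card * (1 - p : ℝ) ^ Iᶜ.card
      = (setBernoulli (Set.univ : Set Ω) p).real {(I : Set Ω)} := by
    intro I
    rw [setBernoulli_real_singleton p (Set.subset_univ _) Set.finite_univ, Set.ncard_coe_finset,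
      ← Set.compl_eq_univ_sdiff, ← Finset.coe_compl, Set.ncard_coe_finset]
  have h3 : bexp (p : ℝ) (fun I : Finset Ω => if G I then 1 else 0)
      = ∑ I ∈ Finset.univ.filter G, (setBernoulli (Set.univ : Set Ω) p).real {(I : Set Ω)} := by
    rw [bexp, Finset.sum_filter]
    refine Finset.sum_congr rfl fun I _ => ?_
    rw [h2]
    split_ifs <;> simp
  rw [h3, ← measureReal_biUnion_finset]
  · refine measureReal_mono ?_
    intro S hS
    simp only [Finset.mem_filter, Finset.mem_univ, true_and, Set.mem_iUnion,
      Set.mem_singleton_iff, exists_prop] at hS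
    obtain ⟨I, hI, rfl⟩ := hS
    exact h I hI
  · intro I _ J _ hIJ
    simpa [Function.onFun] using hIJ
  · intro I _
    exact measurableSet_singleton _

end BernoulliExpectation

end RandomCSP

/-! ### Signed elements, sign flips, and moments of the signed indicators -/

namespace RandomCSP

/-- Signed elements of `Ω`, each of which is attached to a triple of `α × β × ι`. -/
structure SignedTriples (Ω α β ι : Type*) where
  a : Ω → α
  b : Ω → β
  i : Ω → ι
  χ : Ω → ℤ

namespace SignedTriples

variable {Ω α β ι : Type*} (D : SignedTriples Ω α β ι)

/-- The matrix of pairs of elements of `I` with the same `i`, without its diagonal. -/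
def corr [DecidableEq α] [DecidableEq β] [DecidableEq ι] (I : Multiset Ω) :
    Matrix (α × β) (α × β) ℤ := fun u v =>
  (I.map fun C => (I.map fun C' =>
    if D.i C = D.i C' ∧ (D.a C, D.b C') = u ∧ (D.a C', D.b C) = v ∧ u ≠ v
      then D.χ C * D.χ C' else 0).sum).sum

/-- The total weight of the pairs of elements of `I` that are attached to the same triple. -/
def diag [DecidableEq α] [DecidableEq β] [DecidableEq ι] (I : Multiset Ω) : ℤ :=
  (I.map fun C => (I.map fun C' =>
    if D.i C = D.i C' ∧ D.a C = D.a C' ∧ D.b C = D.b C' then D.χ C * D.χ C' else 0).sum).sum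

/-- An involution that changes the sign and keeps the triple. -/
structure Flip where
  toFun : Ω → Ω
  invol : ∀ C, toFun (toFun C) = C
  χ_flip : ∀ C, D.χ (toFun C) = -D.χ C
  a_flip : ∀ C, D.a (toFun C) = D.a C
  b_flip : ∀ C, D.b (toFun C) = D.b C
  i_flip : ∀ C, D.i (toFun C) = D.i C
  χ_sq : ∀ C, D.χ C = 1 ∨ D.χ C = -1

variable {D}

namespace Flip

/-- The elements of sign `1`. -/
abbrev Pos (_ : D.Flip) : Type _ := {C : Ω // D.χ C = 1}

variable (F : D.Flip)

lemma toFun_injective : Function.Injective F.toFun := Function.Involutive.injective F.invol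

lemma toFun_ne_pos (x y : F.Pos) : F.toFun x ≠ y := by
  intro h
  have h1 := F.χ_flip x
  rw [h, x.2, y.2] at h1
  norm_num at h1

variable [DecidableEq Ω]

/-- The signed indicator of a pair of opposite elements. -/
noncomputable def ζ (x : F.Pos) (I : Finset Ω) : ℝ :=
  (if (x : Ω) ∈ I then 1 else 0) - (if F.toFun x ∈ I then 1 else 0)

lemma abs_ζ_le (x : F.Pos) (I : Finset Ω) :
    |F.ζ x I| ≤ (if (x : Ω) ∈ I then 1 else 0) + (if F.toFun x ∈ I then 1 else 0) := by
  rw [ζ]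
  split_ifs <;> norm_num

lemma abs_ζ_le_one (x : F.Pos) (I : Finset Ω) : |F.ζ x I| ≤ 1 := by
  rw [ζ]
  split_ifs <;> norm_num

lemma ζ_map_swap (x y : F.Pos) (I : Finset Ω) :
    F.ζ y (I.map (Equiv.swap (x : Ω) (F.toFun x)).toEmbedding)
      = (if y = x then -1 else 1) * F.ζ y I := by
  simp only [ζ, Finset.mem_map_equiv, Equiv.symm_swap]
  by_cases h : y = x
  · subst h
    rw [Equiv.swap_apply_left, Equiv.swap_apply_right, if_pos rfl]
    ring
  · rw [Equiv.swap_apply_of_ne_of_ne (fun e => h (Subtype.ext e)) (F.toFun_ne_pos x y).symm,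
      Equiv.swap_apply_of_ne_of_ne (F.toFun_ne_pos y x)
        fun e => h (Subtype.ext (F.toFun_injective e)), if_neg h, one_mul]

/-- Repeated factors are dropped because each is at most `1` in absolute value; one copy of each
distinct factor is kept to supply a factor `2 * p` in expectation. -/
lemma abs_prod_ζ_le (h : List F.Pos) (I : Finset Ω) :
    |(h.map fun y => F.ζ y I).prod| ≤ ∏ x ∈ h.toFinset,
      ((if (x : Ω) ∈ I then 1 else 0) + (if F.toFun x ∈ I then (1 : ℝ) else 0)) := by
  induction h with
  | nil => simp
  | cons y h ih =>
    rw [List.map_cons, List.prod_cons, abs_mul, List.toFinset_cons]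
    by_cases hy : y ∈ h.toFinset
    · rw [Finset.insert_eq_of_mem hy]
      exact (mul_le_of_le_one_left (abs_nonneg _) (F.abs_ζ_le_one y I)).trans ih
    · rw [Finset.prod_insert hy]
      exact mul_le_mul (F.abs_ζ_le y I) ih (abs_nonneg _) ((abs_nonneg _).trans (F.abs_ζ_le y I))

lemma prod_ζ_map_swap (x : F.Pos) (h : List F.Pos) (I : Finset Ω) :
    (h.map fun y => F.ζ y (I.map (Equiv.swap (x : Ω) (F.toFun x)).toEmbedding)).prod
      = (-1) ^ (h : Multiset F.Pos).count x * (h.map fun y => F.ζ y I).prod := by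
  induction h with
  | nil => simp
  | cons y h ih =>
    rw [List.map_cons, List.prod_cons, ih, ζ_map_swap, ← Multiset.cons_coe,
      Multiset.count_cons, List.map_cons, List.prod_cons]
    by_cases hyx : y = x
    · rw [if_pos hyx, if_pos hyx.symm, pow_succ]
      ring
    · rw [if_neg hyx, if_neg (Ne.symm hyx), add_zero]
      ring

variable [Fintype Ω]

/-- The flip is a bijection between elements of sign `1` and `-1` that preserves `g`, so the sum can
be grouped by pairs. -/
lemma sum_eq_sum_ζ (I : Finset Ω) {g : Ω → ℝ}
    (hg : ∀ C, g (F.toFun C) = g C) :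
    ∑ C ∈ I, (D.χ C : ℝ) * g C = ∑ x : F.Pos, F.ζ x I * g x := by
  classical
  have h1 : ∑ C ∈ I, (D.χ C : ℝ) * g C
      = ∑ C : Ω, if C ∈ I then (D.χ C : ℝ) * g C else 0 := by
    rw [Finset.sum_ite_mem, Finset.univ_inter]
  rw [h1, ← Fintype.sum_subtype_add_sum_subtype (fun C => D.χ C = 1)]
  have h2 : (∑ x : {C : Ω // ¬ D.χ C = 1}, if (x : Ω) ∈ I then (D.χ x : ℝ) * g x else 0)
      = ∑ x : F.Pos, if F.toFun x ∈ I then (D.χ (F.toFun x) : ℝ) * g (F.toFun x) else 0 := by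
    symm
    refine Fintype.sum_bijective
      (fun x : F.Pos => (⟨F.toFun x, by rw [F.χ_flip, x.2]; norm_num⟩ : {C : Ω // ¬ D.χ C = 1}))
      ⟨fun x y h => Subtype.ext (F.toFun_injective (by simpa using h)), fun y => ?_⟩ _ _
      fun x => rfl
    refine ⟨⟨F.toFun y, ?_⟩, Subtype.ext (F.invol _)⟩
    rw [F.χ_flip, (F.χ_sq y).resolve_left y.2, neg_neg]
  rw [h2, ← Finset.sum_add_distrib]
  refine Finset.sum_congr rfl fun x _ => ?_
  rw [F.χ_flip, x.2, hg, ζ]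
  split_ifs <;> push_cast <;> ring

variable {p : ℝ}

/-- Exchanging `x` with its opposite preserves the distribution and negates the product, so the
expectation equals its own negative. -/
lemma bexp_prod_ζ_eq_zero {x : F.Pos} {h : List F.Pos} (hx : Odd ((h : Multiset F.Pos).count x)) :
    bexp p (fun I => (h.map fun y => F.ζ y I).prod) = 0 := by
  have h1 := bexp_perm (p := p) (Equiv.swap (x : Ω) (F.toFun x))
    (fun I => (h.map fun y => F.ζ y I).prod)
  simp only [prod_ζ_map_swap, hx.neg_one_pow, neg_one_mul, bexp_neg] at h1
  linarith

/-- Expand the product: each of the `2 ^ G.card` terms chooses one element from every pair. The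
pairs are disjoint, so the chosen elements are distinct and are all included with probability `p ^
G.card`. -/
lemma bexp_prod_add (G : Finset F.Pos) :
    bexp p (fun I => ∏ x ∈ G,
      ((if (x : Ω) ∈ I then 1 else 0) + (if F.toFun x ∈ I then (1 : ℝ) else 0)))
      = (2 * p) ^ G.card := by
  simp only [Finset.prod_add]
  rw [bexp_sum]
  have key : ∀ t ∈ G.powerset, bexp p (fun I => (∏ x ∈ t, if (x : Ω) ∈ I then (1 : ℝ) else 0) *
      ∏ x ∈ G \ t, if F.toFun x ∈ I then (1 : ℝ) else 0) = p ^ G.card := by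
    intro t ht
    have hinj : Function.Injective fun x : F.Pos => F.toFun x := fun x y e =>
      Subtype.ext (F.toFun_injective e)
    set S : Finset Ω := t.image Subtype.val ∪ (G \ t).image (fun x : F.Pos => F.toFun x) with hS
    have hcard : S.card = G.card := by
      rw [hS, Finset.card_union_of_disjoint, Finset.card_image_of_injective _ Subtype.val_injective,
        Finset.card_image_of_injective _ hinj, add_comm,
        Finset.card_sdiff_add_card_eq_card (Finset.mem_powerset.1 ht)]
      rw [Finset.disjoint_left]
      intro C h1 h2
      obtain ⟨x, -, rfl⟩ := Finset.mem_image.1 h1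
      obtain ⟨y, -, hy⟩ := Finset.mem_image.1 h2
      exact F.toFun_ne_pos y x hy
    rw [← hcard, ← bexp_subset]
    congr 1
    funext I
    rw [Finset.prod_ite_zero, Finset.prod_ite_zero, hS]
    simp only [Finset.prod_const_one, Finset.union_subset_iff, Finset.image_subset_iff]
    split_ifs <;> simp_all
  rw [Finset.sum_congr rfl key, Finset.sum_const, Finset.card_powerset, nsmul_eq_mul, mul_pow]
  push_cast
  rfl

lemma abs_bexp_prod_ζ_le (hp : p ∈ Set.Icc (0 : ℝ) 1) (h : List F.Pos) :
    |bexp p (fun I => (h.map fun y => F.ζ y I).prod)| ≤ (2 * p) ^ h.toFinset.card :=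
  (abs_bexp_le hp _).trans ((bexp_mono hp (F.abs_prod_ζ_le h)).trans (F.bexp_prod_add _).le)

/-- In a nonvanishing monomial of degree `2 * N` every factor occurs at least twice, so the number
`d` of distinct factors is at most `N` and `L ^ (N - d) ≥ 1` may be inserted. The evenness condition
is thereby traded for a weight `2 * p / L` per distinct factor, and later sums can range over all
monomials without tracking parities. -/
lemma abs_bexp_prod_ζ_le_pow (hp : p ∈ Set.Icc (0 : ℝ) 1) {L : ℝ} (hL : 1 ≤ L) {N : ℕ}
    {h : List F.Pos} (hN : h.length = 2 * N) :
    |bexp p (fun I => (h.map fun y => F.ζ y I).prod)|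
      ≤ L ^ N * (2 * p / L) ^ h.toFinset.card := by
  have hp0 := hp.1
  by_cases he : ∃ x, Odd ((h : Multiset F.Pos).count x)
  · obtain ⟨x, hx⟩ := he
    rw [F.bexp_prod_ζ_eq_zero hx, abs_zero]
    positivity
  · simp only [not_exists, Nat.not_odd_iff_even] at he
    have hc : h.toFinset.card ≤ N := by
      have h1 : 2 * h.toFinset.card ≤ ∑ x ∈ h.toFinset, (h : Multiset F.Pos).count x := by
        rw [mul_comm, ← smul_eq_mul]
        refine Finset.card_nsmul_le_sum _ _ _ fun x hx => ?_
        have h2 : 0 < (h : Multiset F.Pos).count x :=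
          Multiset.count_pos.2 (List.mem_toFinset.1 hx)
        obtain ⟨r, hr⟩ := he x
        omega
      have h2 := Multiset.toFinset_sum_count_eq (h : Multiset F.Pos)
      rw [Multiset.coe_card] at h2
      exact Nat.le_of_mul_le_mul_left ((h1.trans h2.le).trans hN.le) two_pos
    refine (F.abs_bexp_prod_ζ_le hp h).trans ?_
    obtain ⟨d, rfl⟩ := Nat.exists_eq_add_of_le hc
    have h0 : L ^ h.toFinset.card ≠ 0 := by positivity
    have h1 : L ^ (h.toFinset.card + d) * (2 * p / L) ^ h.toFinset.card
        = L ^ d * (2 * p) ^ h.toFinset.card := by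
      rw [div_pow, pow_add]
      field_simp
    rw [h1]
    exact le_mul_of_one_le_left (by positivity) (one_le_pow₀ hL)

end Flip

end SignedTriples

end RandomCSP

/-! ### The moment bound for the correlation matrix -/

namespace RandomCSP

namespace SignedTriples

variable {Ω α β ι : Type*} {D : SignedTriples Ω α β ι}

namespace Flip

variable (F : D.Flip) [DecidableEq Ω] [Fintype Ω]

lemma sum_sum_eq_sum_sum_ζ (I : Finset Ω) {g : Ω → Ω → ℝ}
    (hl : ∀ C C', g (F.toFun C) C' = g C C') (hr : ∀ C C', g C (F.toFun C') = g C C') :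
    ∑ C ∈ I, ∑ C' ∈ I, (D.χ C * D.χ C' : ℝ) * g C C'
      = ∑ x : F.Pos, ∑ y : F.Pos, F.ζ x I * F.ζ y I * g x y := by
  simp only [mul_assoc, ← Finset.mul_sum]
  rw [F.sum_eq_sum_ζ I (g := fun C => ∑ C' ∈ I, (D.χ C' : ℝ) * g C C') (by simp [hl])]
  refine Finset.sum_congr rfl fun x _ => ?_
  rw [F.sum_eq_sum_ζ I (hr x)]

lemma card_pos_filter_le {F : D.Flip} {P : Ω → Prop} [DecidablePred P] {m : ℕ}
    (h : (Finset.univ.filter P).card ≤ m) :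
    (Finset.univ.filter fun x : F.Pos => P x).card ≤ m := by
  refine le_trans ?_ h
  rw [← Finset.card_image_of_injective _ Subtype.val_injective]
  refine Finset.card_le_card fun C hC => ?_
  obtain ⟨x, hx, rfl⟩ := Finset.mem_image.1 hC
  simpa using hx

variable [DecidableEq α] [DecidableEq β] [DecidableEq ι]

lemma corr_eq_sum_ζ (I : Finset Ω) (u v : α × β) :
    (D.corr I.val u v : ℝ) = ∑ x : F.Pos, ∑ y : F.Pos,
      if D.i x = D.i y ∧ (D.a x, D.b y) = u ∧ (D.a y, D.b x) = v ∧ u ≠ v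
        then F.ζ x I * F.ζ y I else 0 := by
  have h := F.sum_sum_eq_sum_sum_ζ I (g := fun C C' =>
    if D.i C = D.i C' ∧ (D.a C, D.b C') = u ∧ (D.a C', D.b C) = v ∧ u ≠ v then 1 else 0)
    (by simp only [F.a_flip, F.b_flip, F.i_flip, implies_true])
    (by simp only [F.a_flip, F.b_flip, F.i_flip, implies_true])
  simp only [mul_ite, mul_one, mul_zero] at h
  rw [← h]
  have h0 : D.corr I.val u v = ∑ C ∈ I, ∑ C' ∈ I,
    if D.i C = D.i C' ∧ (D.a C, D.b C') = u ∧ (D.a C', D.b C) = v ∧ u ≠ v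
      then D.χ C * D.χ C' else 0 := rfl
  rw [h0]
  push_cast
  rfl

lemma diag_eq_sum_ζ (I : Finset Ω) :
    (D.diag I.val : ℝ) = ∑ x : F.Pos, ∑ y : F.Pos,
      if D.i x = D.i y ∧ D.a x = D.a y ∧ D.b x = D.b y then F.ζ x I * F.ζ y I else 0 := by
  have h := F.sum_sum_eq_sum_sum_ζ I (g := fun C C' =>
    if D.i C = D.i C' ∧ D.a C = D.a C' ∧ D.b C = D.b C' then 1 else 0)
    (by simp only [F.a_flip, F.b_flip, F.i_flip, implies_true])
    (by simp only [F.a_flip, F.b_flip, F.i_flip, implies_true])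
  simp only [mul_ite, mul_one, mul_zero] at h
  rw [← h]
  have h0 : D.diag I.val = ∑ C ∈ I, ∑ C' ∈ I,
    if D.i C = D.i C' ∧ D.a C = D.a C' ∧ D.b C = D.b C' then D.χ C * D.χ C' else 0 := rfl
  rw [h0]
  push_cast
  rfl

variable {p : ℝ}

/-- The expected diagonal weight is at most the expected number of elements. -/
lemma bexp_diag_le (F : D.Flip) (hp : p ∈ Set.Icc (0 : ℝ) 1) :
    bexp p (fun I => (D.diag I.val : ℝ)) ≤ 2 * p * Fintype.card Ω := by
  have hp0 := hp.1
  simp only [F.diag_eq_sum_ζ]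
  rw [bexp_sum]
  have key : ∀ x ∈ (Finset.univ : Finset F.Pos), bexp p (fun I => ∑ y : F.Pos,
      if D.i x = D.i y ∧ D.a x = D.a y ∧ D.b x = D.b y then F.ζ x I * F.ζ y I else 0)
      ≤ 2 * p := by
    intro x _
    -- Only `y = x` survives: for `y ≠ x` the factor of `x` occurs exactly once and the expectation
    -- vanishes.
    rw [bexp_sum, Finset.sum_eq_single x]
    · have h := F.abs_bexp_prod_ζ_le hp [x, x]
      simp only [List.map_cons, List.map_nil, List.prod_cons, List.prod_nil, mul_one] at h
      simpa using (le_abs_self _).trans h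
    · intro y _ hyx
      split_ifs
      · have h := F.bexp_prod_ζ_eq_zero (p := p) (x := x) (h := [x, y]) (by
          rw [← Multiset.cons_coe, Multiset.count_cons_self, Multiset.count_eq_zero.2]
          · simp
          · simpa using hyx.symm)
        simpa using h
      · simp [bexp]
    · simp
  refine (Finset.sum_le_sum key).trans ?_
  rw [Finset.sum_const, nsmul_eq_mul, mul_comm]
  refine mul_le_mul_of_nonneg_left ?_ (by positivity)
  exact_mod_cast (Finset.card_univ (α := F.Pos)).le.trans (Fintype.card_subtype_le _)

/-- Bounds on the number of elements over the parts of a triple, in terms of the weight `q` of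
an element. -/
structure Sparse (D : SignedTriples Ω α β ι) (q : ℝ) (cA cB c : ℕ) : Prop where
  card_ai : ∀ a i, (Finset.univ.filter fun C => D.a C = a ∧ D.i C = i).card ≤ cA
  card_bi : ∀ b i, (Finset.univ.filter fun C => D.b C = b ∧ D.i C = i).card ≤ cB
  card_a : ∀ a, (Finset.univ.filter fun C => D.a C = a).card ≤ c
  cA_le : cA * q ≤ 1
  cB_le : cB * q ≤ 1
  c_le : c * cB * q ^ 2 ≤ 1

variable {F}

/-- One step of a walk at `u`, where `H` is the set of factors already used. An old factor costs
nothing but has only `H.card` candidates; a new one costs `q`. Both old gives at most `H.card ^ 2`,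
one old and one new at most `H.card` for either order by `cB_le` and `cA_le`, and both new at most
`1` by `c_le`. The total is `(H.card + 1) ^ 2`. -/
lemma sum_step_le {q : ℝ} (hq : 0 ≤ q) {cA cB c : ℕ} (hD : Sparse D q cA cB c) (H : Finset F.Pos)
    (u : α × β) :
    ∑ x : F.Pos, ∑ y : F.Pos,
      (if D.i x = D.i y ∧ (D.a x, D.b y) = u ∧ (D.a y, D.b x) ≠ u
        then q ^ (insert x (insert y H)).card else 0) ≤ q ^ H.card * (H.card + 1) ^ 2 := by
  obtain ⟨a, b⟩ := u
  set w : F.Pos → ℝ := fun x => if x ∈ H then 1 else q with hw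
  set e : F.Pos → ℝ := fun x => if x ∈ H then 1 else 0 with he
  have hw0 : ∀ x, 0 ≤ w x := fun x => by simp only [hw]; split_ifs <;> positivity
  have he0 : ∀ x, 0 ≤ e x := fun x => by simp only [he]; split_ifs <;> positivity
  have hwe : ∀ x, w x ≤ e x + q := fun x => by simp only [hw, he]; split_ifs <;> linarith
  have hesum : ∑ x, e x = H.card := by simp [he]
  set cond : F.Pos → F.Pos → Prop := fun x y => D.i x = D.i y ∧ D.a x = a ∧ D.b y = b with hcond
  have h1 : ∀ x y : F.Pos, (if D.i x = D.i y ∧ (D.a x, D.b y) = (a, b) ∧ (D.a y, D.b x) ≠ (a, b)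
      then q ^ (insert x (insert y H)).card else 0)
      ≤ q ^ H.card * (if cond x y then (e x + q) * (e y + q) else 0) := by
    intro x y
    split_ifs with h h' h'
    -- Here the removal of the diagonal is used: a repeated new element would cost only `q` instead
    -- of `q ^ 2`.
    · have hxy : x ≠ y := by
        rintro rfl
        exact h.2.2 h.2.1
      have : q ^ (insert x (insert y H)).card = q ^ H.card * (w x * w y) := by
        by_cases hx : x ∈ H <;> by_cases hy : y ∈ H
        · simp [hw, hx, hy]
        · simp [hw, hx, hy, pow_succ]
        · simp [hw, hx, hy, pow_succ]
        · simp [hw, hx, hy, hxy, pow_succ, mul_assoc]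
      rw [this]
      exact mul_le_mul_of_nonneg_left
        (mul_le_mul (hwe x) (hwe y) (hw0 y) ((hw0 x).trans (hwe x))) (by positivity)
    · exact absurd ⟨h.1, (Prod.ext_iff.1 h.2.1).1, (Prod.ext_iff.1 h.2.1).2⟩ h'
    · exact mul_nonneg (by positivity)
        (mul_nonneg ((hw0 x).trans (hwe x)) ((hw0 y).trans (hwe y)))
    · simp
  refine (Finset.sum_le_sum fun x _ => Finset.sum_le_sum fun y _ => h1 x y).trans ?_
  simp only [← Finset.mul_sum]
  refine mul_le_mul_of_nonneg_left ?_ (by positivity)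
  have hx : ∀ x : F.Pos, ∑ y : F.Pos, (if cond x y then q else 0) ≤ 1 := by
    intro x
    rw [← Finset.sum_filter, Finset.sum_const, nsmul_eq_mul]
    refine le_trans (mul_le_mul_of_nonneg_right ?_ hq) hD.cB_le
    have := card_pos_filter_le (F := F) (hD.card_bi b (D.i x))
    refine Nat.cast_le.2 ((Finset.card_le_card fun y hy => ?_).trans this)
    simp only [hcond, Finset.mem_filter, Finset.mem_univ, true_and] at hy ⊢
    exact ⟨hy.2.2, hy.1.symm⟩
  have hy : ∀ y : F.Pos, ∑ x : F.Pos, (if cond x y then q else 0) ≤ 1 := by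
    intro y
    rw [← Finset.sum_filter, Finset.sum_const, nsmul_eq_mul]
    refine le_trans (mul_le_mul_of_nonneg_right ?_ hq) hD.cA_le
    have := card_pos_filter_le (F := F) (hD.card_ai a (D.i y))
    refine Nat.cast_le.2 ((Finset.card_le_card fun x hx => ?_).trans this)
    simp only [hcond, Finset.mem_filter, Finset.mem_univ, true_and] at hx ⊢
    exact ⟨hx.2.1, hx.1⟩
  have hxy : ∑ x : F.Pos, ∑ y : F.Pos, (if cond x y then q * q else 0) ≤ 1 := by
    have h2 : ∀ x ∈ Finset.univ, ∑ y : F.Pos, (if cond x y then q * q else 0)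
        ≤ if D.a x = a then cB * q ^ 2 else 0 := by
      intro x _
      split_ifs with hxa
      · rw [← Finset.sum_filter, Finset.sum_const, nsmul_eq_mul, ← sq]
        refine mul_le_mul_of_nonneg_right ?_ (by positivity)
        have := card_pos_filter_le (F := F) (hD.card_bi b (D.i x))
        refine Nat.cast_le.2 ((Finset.card_le_card fun y hy => ?_).trans this)
        simp only [hcond, Finset.mem_filter, Finset.mem_univ, true_and] at hy ⊢
        exact ⟨hy.2.2, hy.1.symm⟩
      · exact (Finset.sum_eq_zero fun y _ => if_neg fun h => hxa h.2.1).le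
    refine (Finset.sum_le_sum h2).trans ?_
    rw [← Finset.sum_filter, Finset.sum_const, nsmul_eq_mul]
    refine le_trans ?_ hD.c_le
    rw [mul_assoc]
    exact mul_le_mul_of_nonneg_right
      (Nat.cast_le.2 (card_pos_filter_le (F := F) (hD.card_a a))) (by positivity)
  have hsplit : ∀ x y : F.Pos, (if cond x y then (e x + q) * (e y + q) else 0)
      ≤ e x * e y + e x * (if cond x y then q else 0) + e y * (if cond x y then q else 0)
        + (if cond x y then q * q else 0) := by
    intro x y
    split_ifs
    · exact le_of_eq (by ring)
    · simpa using mul_nonneg (he0 x) (he0 y)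
  refine (Finset.sum_le_sum fun x _ => Finset.sum_le_sum fun y _ => hsplit x y).trans ?_
  simp only [Finset.sum_add_distrib]
  have t1 : ∑ x, ∑ y, e x * e y = (H.card : ℝ) * H.card := by
    rw [← Finset.sum_mul_sum, hesum]
  have t2 : ∑ x, ∑ y, e x * (if cond x y then q else 0) ≤ H.card := by
    rw [← hesum]
    refine Finset.sum_le_sum fun x _ => ?_
    rw [← Finset.mul_sum]
    exact mul_le_of_le_one_right (he0 x) (hx x)
  have t3 : ∑ x, ∑ y, e y * (if cond x y then q else 0) ≤ H.card := by
    rw [Finset.sum_comm, ← hesum]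
    refine Finset.sum_le_sum fun y _ => ?_
    rw [← Finset.mul_sum]
    exact mul_le_of_le_one_right (he0 y) (hy y)
  nlinarith [t1, t2, t3, hxy]

variable [Fintype α] [Fintype β]

/-- Induction on the remaining length `R` of the walk; the list `h` carries the factors met so far,
so the claim is about a monomial times an entry of the remaining power. `M` bounds the degree at the
end of the walk and hence the number of old factors at every step. -/
lemma abs_bexp_prod_ζ_mul_corr_pow_le (hp : p ∈ Set.Icc (0 : ℝ) 1) {L : ℝ} (hL : 1 ≤ L)
    {cA cB c : ℕ} (hD : Sparse D (2 * p / L) cA cB c) (M : ℕ) (R : ℕ) :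
    ∀ (N : ℕ) (h : List F.Pos) (u v : α × β), h.length = 2 * N → 2 * N + 2 * R ≤ M →
    |bexp p (fun I => (h.map fun y => F.ζ y I).prod * (((D.corr I.val) ^ R) u v : ℝ))|
      ≤ L ^ (N + R) * (2 * p / L) ^ h.toFinset.card * ((M : ℝ) ^ 2) ^ R := by
  have hp0 := hp.1
  have hq : 0 ≤ 2 * p / L := by positivity
  induction R with
  | zero =>
    intro N h u v hN _
    have h1 := F.abs_bexp_prod_ζ_le_pow hp hL hN
    rw [pow_zero, mul_one, add_zero]
    by_cases huv : u = v
    · simpa [Matrix.one_apply, huv] using h1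
    · simpa [Matrix.one_apply, huv, bexp] using (abs_nonneg _).trans h1
  | succ R ih =>
    intro N h u v hN hM
    have hexp : ∀ I : Finset Ω,
        (h.map fun y => F.ζ y I).prod * (((D.corr I.val) ^ (R + 1)) u v : ℝ)
        = ∑ x : F.Pos, ∑ y : F.Pos,
          if D.i x = D.i y ∧ (D.a x, D.b y) = u ∧ (D.a y, D.b x) ≠ u then
            ((x :: y :: h).map fun y => F.ζ y I).prod
              * (((D.corr I.val) ^ R) (D.a y, D.b x) v : ℝ) else 0 := by
      intro I
      rw [pow_succ', Matrix.mul_apply]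
      push_cast
      simp only [F.corr_eq_sum_ζ, Finset.sum_mul, Finset.mul_sum]
      rw [Finset.sum_comm]
      refine Finset.sum_congr rfl fun x _ => ?_
      rw [Finset.sum_comm]
      refine Finset.sum_congr rfl fun y _ => ?_
      -- The chosen pair of elements determines the next vertex of the walk.
      rw [Finset.sum_eq_single (D.a y, D.b x)]
      · simp only [List.map_cons, List.prod_cons, true_and]
        by_cases hc : D.i x = D.i y ∧ (D.a x, D.b y) = u ∧ (D.a y, D.b x) ≠ u
        · rw [if_pos hc, if_pos ⟨hc.1, hc.2.1, hc.2.2.symm⟩]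
          ring
        · rw [if_neg hc, if_neg fun hc' => hc ⟨hc'.1, hc'.2.1, hc'.2.2.symm⟩]
          ring
      · intro w _ hw
        rw [if_neg fun hc => hw hc.2.2.1.symm]
        ring
      · simp
    simp only [hexp]
    rw [bexp_sum]
    refine (Finset.abs_sum_le_sum_abs _ _).trans ?_
    have hstep : ∀ x y : F.Pos, |bexp p fun I =>
          if D.i x = D.i y ∧ (D.a x, D.b y) = u ∧ (D.a y, D.b x) ≠ u then
            ((x :: y :: h).map fun y => F.ζ y I).prod
              * (((D.corr I.val) ^ R) (D.a y, D.b x) v : ℝ) else 0|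
        ≤ (L ^ (N + 1 + R) * ((M : ℝ) ^ 2) ^ R) *
          if D.i x = D.i y ∧ (D.a x, D.b y) = u ∧ (D.a y, D.b x) ≠ u
            then (2 * p / L) ^ (insert x (insert y h.toFinset)).card else 0 := by
      intro x y
      split_ifs with hc
      · refine (ih (N + 1) (x :: y :: h) (D.a y, D.b x) v (by simp [hN]; ring)
          (by omega)).trans (le_of_eq ?_)
        rw [List.toFinset_cons, List.toFinset_cons]
        ring
      · simp [bexp]
    refine (Finset.sum_le_sum fun x _ => ?_).trans
      ((Finset.mul_sum _ _ (L ^ (N + 1 + R) * ((M : ℝ) ^ 2) ^ R)).symm.le.trans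
        ((mul_le_mul_of_nonneg_left (sum_step_le hq hD h.toFinset u) (by positivity)).trans ?_))
    · rw [bexp_sum, Finset.mul_sum]
      exact (Finset.abs_sum_le_sum_abs _ _).trans (Finset.sum_le_sum fun y _ => hstep x y)
    · have hcard : (h.toFinset.card : ℝ) + 1 ≤ M := by
        have := List.toFinset_card_le h
        exact_mod_cast (by omega : h.toFinset.card + 1 ≤ M)
      have h2 : ((h.toFinset.card : ℝ) + 1) ^ 2 ≤ (M : ℝ) ^ 2 :=
        pow_le_pow_left₀ (by positivity) hcard 2
      calc L ^ (N + 1 + R) * ((M : ℝ) ^ 2) ^ R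
            * ((2 * p / L) ^ h.toFinset.card * ((h.toFinset.card : ℝ) + 1) ^ 2)
          ≤ L ^ (N + 1 + R) * ((M : ℝ) ^ 2) ^ R
            * ((2 * p / L) ^ h.toFinset.card * (M : ℝ) ^ 2) := by gcongr
        _ = _ := by
          rw [pow_succ ((M : ℝ) ^ 2), add_assoc, add_comm 1 R]
          ring

/-- The moment bound for the correlation matrix. -/
lemma bexp_trace_corr_pow_le (F : D.Flip) (hp : p ∈ Set.Icc (0 : ℝ) 1) {L : ℝ} (hL : 1 ≤ L)
    {cA cB c : ℕ} (hD : Sparse D (2 * p / L) cA cB c) (R : ℕ) :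
    bexp p (fun I => (((D.corr I.val) ^ R).trace : ℝ))
      ≤ Fintype.card (α × β) * (L * (2 * R) ^ 2) ^ R := by
  simp only [Matrix.trace, Matrix.diag_apply]
  push_cast
  rw [bexp_sum, ← Finset.card_univ, ← nsmul_eq_mul]
  refine Finset.sum_le_card_nsmul _ _ _ fun u _ => ?_
  have h := abs_bexp_prod_ζ_mul_corr_pow_le (F := F) hp hL hD (2 * R) R 0 [] u u rfl (by omega)
  simp only [List.map_nil, List.prod_nil, one_mul, List.toFinset_nil, Finset.card_empty, pow_zero,
    mul_one, zero_add] at h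
  refine (le_abs_self _).trans (h.trans (le_of_eq ?_))
  rw [mul_pow]
  push_cast
  rfl

end Flip

end SignedTriples

end RandomCSP

/-! ### The deterministic certificate: Cauchy–Schwarz and iterated squaring -/

namespace RandomCSP

/-- Turns sums over a multiset into sums over a finite type that respect multiplicities, so that
orders of summation can be exchanged. One `g` serves all summands. -/
lemma Multiset.exists_sum_map_eq_sum_fin {Ω : Type*} (I : Multiset Ω) :
    ∃ g : Fin (Multiset.card I) → Ω, ∀ {M : Type} [AddCommMonoid M] (f : Ω → M),
      (I.map f).sum = ∑ j, f (g j) := by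
  induction I using Quot.inductionOn with
  | h l =>
    refine ⟨fun j => l.get j, fun f => ?_⟩
    have : (l.map f).sum = ∑ j : Fin l.length, f (l.get j) := by
      rw [← List.sum_ofFn, ← Function.comp_def f, ← List.map_ofFn, List.ofFn_get]
    exact (Multiset.sum_coe (l.map f)).trans this

section QuadraticForm

variable {V : Type*} [Fintype V] [DecidableEq V]

/-- Cauchy–Schwarz for the inner product of `Y` and `A Y`: the squared norm of `Y` is the number of
coordinates, and that of `A Y` is the form of `A ^ 2` by symmetry. -/
lemma quadForm_sq_le_card_mul (A : Matrix V V ℤ) (hA : A.IsSymm) {Y : V → ℤ}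
    (hY : ∀ u, Y u ^ 2 = 1) :
    (∑ u, ∑ v, A u v * (Y u * Y v)) ^ 2
      ≤ Fintype.card V * ∑ u, ∑ v, (A ^ 2) u v * (Y u * Y v) := by
  have h1 : ∑ u, ∑ v, A u v * (Y u * Y v) = ∑ u, Y u * ∑ v, A u v * Y v := by
    simp only [Finset.mul_sum]
    exact Finset.sum_congr rfl fun u _ => Finset.sum_congr rfl fun v _ => by ring
  have h2 : ∑ u, ∑ v, (A ^ 2) u v * (Y u * Y v) = ∑ w, (∑ v, A w v * Y v) ^ 2 := by
    simp only [sq, Matrix.mul_apply, Finset.sum_mul]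
    rw [Finset.sum_congr rfl fun u _ => Finset.sum_comm, Finset.sum_comm]
    refine Finset.sum_congr rfl fun w _ => ?_
    rw [← Finset.sum_mul, Finset.sum_mul_sum]
    refine Finset.sum_congr rfl fun u _ => Finset.sum_congr rfl fun v _ => ?_
    rw [hA.apply u w]
    ring
  rw [h1, h2]
  refine (Finset.sum_mul_sq_le_sq_mul_sq _ _ _).trans (le_of_eq ?_)
  simp [hY]

/-- A quadratic form at a sign vector is controlled by the Frobenius norm of an iterated square. -/
lemma quadForm_pow_le (A : Matrix V V ℤ) (hA : A.IsSymm) {Y : V → ℤ} (hY : ∀ u, Y u ^ 2 = 1)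
    (ρ : ℕ) :
    ((∑ u, ∑ v, A u v * (Y u * Y v)) ^ 2 ^ ρ) ^ 2
      ≤ ((Fintype.card V : ℤ) ^ 2 ^ ρ) ^ 2 * ∑ u, ∑ v, (A ^ 2 ^ ρ) u v ^ 2 := by
  induction ρ generalizing A with
  | zero =>
    simp only [pow_zero, pow_one]
    rw [← Fintype.sum_prod_type', ← Fintype.sum_prod_type']
    refine (Finset.sum_mul_sq_le_sq_mul_sq _ _ _).trans (le_of_eq ?_)
    rw [mul_comm]
    simp only [mul_pow, hY, mul_one, Finset.sum_const, Finset.card_univ, Fintype.card_prod]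
    rw [nsmul_one]
    push_cast
    ring
  | succ ρ ih =>
    -- Squaring once passes from the form of `A` to that of `A ^ 2`, to which the induction
    -- hypothesis applies; this is why `A` is generalized.
    have h0 := quadForm_sq_le_card_mul A hA hY
    rw [pow_succ' 2 ρ, pow_mul, pow_mul, pow_mul]
    calc (((∑ u, ∑ v, A u v * (Y u * Y v)) ^ 2) ^ 2 ^ ρ) ^ 2
        ≤ ((Fintype.card V * ∑ u, ∑ v, (A ^ 2) u v * (Y u * Y v)) ^ 2 ^ ρ) ^ 2 := by
          gcongr
      _ = ((Fintype.card V : ℤ) ^ 2 ^ ρ) ^ 2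
            * ((∑ u, ∑ v, (A ^ 2) u v * (Y u * Y v)) ^ 2 ^ ρ) ^ 2 := by
          rw [mul_pow, mul_pow]
      _ ≤ ((Fintype.card V : ℤ) ^ 2 ^ ρ) ^ 2 * (((Fintype.card V : ℤ) ^ 2 ^ ρ) ^ 2
            * ∑ u, ∑ v, ((A ^ 2) ^ 2 ^ ρ) u v ^ 2) := by
          gcongr
          exact ih (A ^ 2) (hA.pow 2)
      _ = _ := by ring

end QuadraticForm

namespace SignedTriples

variable {Ω α β ι : Type*} {D : SignedTriples Ω α β ι}
  [DecidableEq α] [DecidableEq β] [DecidableEq ι]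

lemma corr_isSymm (I : Multiset Ω) : (D.corr I).IsSymm := by
  obtain ⟨g, hg⟩ := Multiset.exists_sum_map_eq_sum_fin I
  ext u v
  simp only [Matrix.transpose_apply, corr, hg]
  rw [Finset.sum_comm]
  refine Finset.sum_congr rfl fun x _ => Finset.sum_congr rfl fun y _ => ?_
  rw [mul_comm (D.χ (g y))]
  refine if_congr ?_ rfl rfl
  constructor
  · rintro ⟨h1, h2, h3, h4⟩
    exact ⟨h1.symm, h3, h2, h4.symm⟩
  · rintro ⟨h1, h2, h3, h4⟩
    exact ⟨h1.symm, h3, h2, h4.symm⟩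

variable [Fintype α] [Fintype β] [Fintype ι]

/-- Cauchy–Schwarz over the common value `j` of `D.i` removes `yi`. The squares expand into pairs
`C`, `C'` with equal `i`, whose four remaining signs are regrouped as `(a C, b C')` against `(a C',
b C)`. Without this crossing the matrix would have rank one when `ι` is a point, and nothing would
be gained. The pairs with coinciding indices have a sign product that is a square, hence `1`, and
form the diagonal weight. -/
lemma sq_sum_le_card_mul (I : Multiset Ω) {ya : α → ℤ} {yb : β → ℤ} {yi : ι → ℤ}
    (ha : ∀ a, ya a ^ 2 = 1) (hb : ∀ b, yb b ^ 2 = 1) (hi : ∀ i, yi i ^ 2 = 1) :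
    ((I.map fun C => D.χ C * (ya (D.a C) * yb (D.b C) * yi (D.i C))).sum) ^ 2
      ≤ Fintype.card ι * (D.diag I
        + ∑ u, ∑ v, D.corr I u v * ((ya u.1 * yb u.2) * (ya v.1 * yb v.2))) := by
  obtain ⟨g, hg⟩ := Multiset.exists_sum_map_eq_sum_fin I
  set f : ι → ℤ := fun j => ∑ x, if D.i (g x) = j then
    D.χ (g x) * (ya (D.a (g x)) * yb (D.b (g x))) else 0 with hf
  have h1 : (I.map fun C => D.χ C * (ya (D.a C) * yb (D.b C) * yi (D.i C))).sum
      = ∑ j, yi j * f j := by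
    rw [hg]
    simp only [hf, Finset.mul_sum]
    rw [Finset.sum_comm]
    refine Finset.sum_congr rfl fun x _ => ?_
    rw [Finset.sum_eq_single (D.i (g x))]
    · rw [if_pos rfl]
      ring
    · intro j _ hj
      rw [if_neg hj.symm, mul_zero]
    · simp
  have h2 : ∑ j, f j ^ 2 = D.diag I
      + ∑ u, ∑ v, D.corr I u v * ((ya u.1 * yb u.2) * (ya v.1 * yb v.2)) := by
    have e1 : ∑ j, f j ^ 2 = ∑ x, ∑ y, if D.i (g x) = D.i (g y) then
        D.χ (g x) * (ya (D.a (g x)) * yb (D.b (g x)))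
          * (D.χ (g y) * (ya (D.a (g y)) * yb (D.b (g y)))) else 0 := by
      simp only [hf, sq, Finset.sum_mul_sum]
      rw [Finset.sum_comm]
      refine Finset.sum_congr rfl fun x _ => ?_
      rw [Finset.sum_comm]
      refine Finset.sum_congr rfl fun y _ => ?_
      rw [Finset.sum_eq_single (D.i (g x))]
      · rw [if_pos rfl]
        by_cases hxy : D.i (g x) = D.i (g y)
        · rw [if_pos hxy.symm, if_pos hxy]
        · rw [if_neg (Ne.symm hxy), if_neg hxy, mul_zero]
      · intro j _ hj
        rw [if_neg hj.symm, zero_mul]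
      · simp
    have e2 : ∑ u, ∑ v, D.corr I u v * ((ya u.1 * yb u.2) * (ya v.1 * yb v.2))
        = ∑ x, ∑ y, if D.i (g x) = D.i (g y) ∧
            (D.a (g x), D.b (g y)) ≠ (D.a (g y), D.b (g x)) then
          D.χ (g x) * (ya (D.a (g x)) * yb (D.b (g x)))
          * (D.χ (g y) * (ya (D.a (g y)) * yb (D.b (g y)))) else 0 := by
      simp only [corr, hg, Finset.sum_mul]
      rw [Finset.sum_congr rfl fun u _ => Finset.sum_comm, Finset.sum_comm]
      refine Finset.sum_congr rfl fun x _ => ?_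
      rw [Finset.sum_congr rfl fun u _ => Finset.sum_comm, Finset.sum_comm]
      refine Finset.sum_congr rfl fun y _ => ?_
      rw [Finset.sum_eq_single (D.a (g x), D.b (g y)),
        Finset.sum_eq_single (D.a (g y), D.b (g x))]
      · simp only [true_and]
        split_ifs
        · ring
        · ring
      · intro v _ hv
        rw [if_neg fun h => hv h.2.2.1.symm, zero_mul]
      · simp
      · intro u _ hu
        refine Finset.sum_eq_zero fun v _ => ?_
        rw [if_neg fun h => hu h.2.1.symm, zero_mul]
      · simp
    rw [e1, e2]
    simp only [diag, hg, ← Finset.sum_add_distrib]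
    refine Finset.sum_congr rfl fun x _ => Finset.sum_congr rfl fun y _ => ?_
    by_cases hi : D.i (g x) = D.i (g y)
    · by_cases hab : D.a (g x) = D.a (g y) ∧ D.b (g x) = D.b (g y)
      · rw [if_pos hi, if_pos ⟨hi, hab⟩, if_neg, hab.1, hab.2]
        · have e1 := ha (D.a (g y))
          have e2 := hb (D.b (g y))
          linear_combination (D.χ (g x) * D.χ (g y) * yb (D.b (g y)) ^ 2) * e1
            + D.χ (g x) * D.χ (g y) * e2
        · rw [hab.1, hab.2]
          simp
      · rw [if_pos hi, if_neg (fun h => hab h.2), if_pos ⟨hi, fun h => hab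
          ⟨(Prod.ext_iff.1 h).1, (Prod.ext_iff.1 h).2.symm⟩⟩, zero_add]
    · rw [if_neg hi, if_neg (fun h => hi h.1), if_neg (fun h => hi h.1), zero_add]
  rw [h1, ← h2]
  refine (Finset.sum_mul_sq_le_sq_mul_sq _ _ _).trans (le_of_eq ?_)
  simp [hi]

end SignedTriples

end RandomCSP

/-! ### The test for a set of positions and its soundness via Fourier expansion -/

namespace RandomCSP

/-- Distinct positions `f` of a constraint, divided into two parts of size `s` and one part of
size at most one. -/
structure Split (k : ℕ) where
  s : ℕ
  r : ℕ
  f : (Fin s ⊕ Fin s) ⊕ Fin r → Fin k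
  inj : Function.Injective f
  r_le : r ≤ 1
  pos : 0 < s + s + r

lemma Split.exists_image_eq {k : ℕ} {T : Finset (Fin k)} (hT : T.Nonempty) :
    ∃ E : Split k, Finset.univ.image E.f = T := by
  have hc : T.card / 2 + T.card / 2 + T.card % 2 = T.card := by omega
  have e : (Fin (T.card / 2) ⊕ Fin (T.card / 2)) ⊕ Fin (T.card % 2) ≃ T :=
    Fintype.equivOfCardEq (by simp [hc])
  refine ⟨⟨T.card / 2, T.card % 2, fun l => e l, Subtype.val_injective.comp e.injective,
    by omega, ?_⟩, ?_⟩
  · rw [hc]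
    exact hT.card_pos
  · ext j
    simp only [Finset.mem_image, Finset.mem_univ, true_and]
    exact ⟨fun ⟨l, hl⟩ => hl ▸ (e l).2, fun hj => ⟨e.symm ⟨j, hj⟩, by simp⟩⟩

variable {k n : ℕ}

/-- The parts of the scope at the positions of `E`, and the product of the signs there. -/
def Split.triples (E : Split k) (n : ℕ) :
    SignedTriples (Constraint k n) (Fin E.s → Fin n) (Fin E.s → Fin n) (Fin E.r → Fin n) where
  a C l := C.2 (E.f (.inl (.inl l)))
  b C l := C.2 (E.f (.inl (.inr l)))
  i C l := C.2 (E.f (.inr l))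
  χ C := ∏ l, (C.1 (E.f l) : ℤ)

/-- The number of squarings of the correlation matrix. -/
def rounds (n : ℕ) : ℕ := Nat.clog 2 (Nat.clog 2 n)

/-- The bound that the quadratic form of the correlation matrix has to satisfy. -/
def Split.budget (E : Split k) (I : Instance k n) (γ : ℚ) : ℤ :=
  γ.num ^ 2 * (Multiset.card I : ℤ) ^ 2 / (4 ^ k * (γ.den : ℤ) ^ 2 * (n : ℤ) ^ E.r)
    - (E.triples n).diag I

/-- The test for the monomials at the positions of `E`. -/
def Split.Passes (E : Split k) (I : Instance k n) (γ : ℚ) : Prop :=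
  0 ≤ E.budget I γ ∧
  (((n : ℤ) ^ E.s * (n : ℤ) ^ E.s) ^ 2 ^ rounds n) ^ 2
    * ∑ u, ∑ v, (((E.triples n).corr I) ^ 2 ^ rounds n) u v ^ 2
    ≤ (E.budget I γ ^ 2 ^ rounds n) ^ 2

/-- The test compares the bound of `quadForm_pow_le` with the same power of the budget; as the
budget is nonnegative, the powers can be removed and the quadratic form is at most the budget. The
diagonal weight was subtracted in the budget and cancels against the one in
`SignedTriples.sq_sum_le_card_mul`. Rounding down in the budget is on the safe side. -/
lemma Split.Passes.abs_sum_le {E : Split k} {I : Instance k n} {γ : ℚ} (hγ : 0 < γ)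
    (h : E.Passes I γ) (x : Fin n → ℤˣ) :
    |(((I.map fun C => ∏ l, ((C.1 (E.f l) : ℤ) * (x (C.2 (E.f l)) : ℤ))).sum : ℤ) : ℝ)|
      ≤ γ * Multiset.card I / 2 ^ k := by
  set S : ℤ := (I.map fun C => ∏ l, ((C.1 (E.f l) : ℤ) * (x (C.2 (E.f l)) : ℤ))).sum with hS
  have hu : ∀ z : ℤˣ, (z : ℤ) ^ 2 = 1 := fun z => by
    rcases Int.units_eq_one_or z with rfl | rfl <;> norm_num
  have hY : ∀ {q : ℕ} (a : Fin q → Fin n), (∏ l, (x (a l) : ℤ)) ^ 2 = 1 := fun a => by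
    rw [← Finset.prod_pow]
    exact Finset.prod_eq_one fun l _ => hu _
  have h1 := SignedTriples.sq_sum_le_card_mul (D := E.triples n) I
    (ya := fun a => ∏ l, (x (a l) : ℤ)) (yb := fun a => ∏ l, (x (a l) : ℤ))
    (yi := fun a => ∏ l, (x (a l) : ℤ)) hY hY hY
  have hS' : (I.map fun C => (E.triples n).χ C * ((∏ l, (x ((E.triples n).a C l) : ℤ))
      * (∏ l, (x ((E.triples n).b C l) : ℤ)) * ∏ l, (x ((E.triples n).i C l) : ℤ))).sum = S := by
    rw [hS]
    congr 1
    refine Multiset.map_congr rfl fun C _ => ?_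
    rw [Finset.prod_mul_distrib, Fintype.prod_sum_type (fun l => (x (C.2 (E.f l)) : ℤ)),
      Fintype.prod_sum_type (fun l => (x (C.2 (E.f (.inl l))) : ℤ))]
    rfl
  rw [hS'] at h1
  set q : ℤ := ∑ u, ∑ v, (E.triples n).corr I u v *
    (((∏ l, (x (u.1 l) : ℤ)) * ∏ l, (x (u.2 l) : ℤ))
      * ((∏ l, (x (v.1 l) : ℤ)) * ∏ l, (x (v.2 l) : ℤ))) with hq
  have h2 := quadForm_pow_le ((E.triples n).corr I) (SignedTriples.corr_isSymm I)
    (Y := fun u => (∏ l, (x (u.1 l) : ℤ)) * ∏ l, (x (u.2 l) : ℤ))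
    (fun u => by rw [mul_pow, hY, hY, one_mul]) (rounds n)
  rw [← hq, Fintype.card_prod, Fintype.card_fun, Fintype.card_fin, Fintype.card_fin] at h2
  have h3 : q ≤ E.budget I γ := by
    have h4 := h2.trans ((by push_cast; exact h.2))
    rw [sq_le_sq, abs_pow, abs_pow, abs_of_nonneg h.1] at h4
    exact (le_abs_self _).trans ((pow_le_pow_iff_left₀ (abs_nonneg _) h.1 (by positivity)).1 h4)
  have h4 : S ^ 2 ≤ (n : ℤ) ^ E.r * (γ.num ^ 2 * (Multiset.card I : ℤ) ^ 2
      / (4 ^ k * (γ.den : ℤ) ^ 2 * (n : ℤ) ^ E.r)) := by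
    refine h1.trans ?_
    rw [Fintype.card_fun, Fintype.card_fin, Fintype.card_fin]
    push_cast
    refine mul_le_mul_of_nonneg_left ?_ (by positivity)
    rw [Split.budget] at h3
    linarith
  have h5 : (2 ^ k * (γ.den : ℤ) * S) ^ 2 ≤ (γ.num * (Multiset.card I : ℤ)) ^ 2 := by
    have h6 : 4 ^ k * (γ.den : ℤ) ^ 2 * S ^ 2 ≤ γ.num ^ 2 * (Multiset.card I : ℤ) ^ 2 := by
      refine (mul_le_mul_of_nonneg_left h4 (by positivity)).trans ?_
      rw [← mul_assoc]
      -- The divisor vanishes only for `n = 0` with a nonempty remainder.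
      rcases eq_or_ne (4 ^ k * (γ.den : ℤ) ^ 2 * (n : ℤ) ^ E.r) 0 with h0 | h0
      · rw [h0, zero_mul]
        positivity
      · exact Int.mul_ediv_self_le h0
    calc (2 ^ k * (γ.den : ℤ) * S) ^ 2 = 4 ^ k * (γ.den : ℤ) ^ 2 * S ^ 2 := by
          rw [show (4 : ℤ) = 2 ^ 2 by norm_num, ← pow_mul, mul_comm 2 k, pow_mul]
          ring
      _ ≤ _ := h6
      _ = _ := by ring
  have hnum : 0 < γ.num := Rat.num_pos.2 hγ
  have hden : (0 : ℝ) < γ.den := by exact_mod_cast γ.den_pos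
  rw [sq_le_sq, abs_mul, abs_of_nonneg (by positivity : 0 ≤ 2 ^ k * (γ.den : ℤ)),
    abs_of_nonneg (by positivity : 0 ≤ γ.num * (Multiset.card I : ℤ))] at h5
  have h6 : 2 ^ k * (γ.den : ℝ) * |(S : ℝ)| ≤ γ.num * Multiset.card I := by exact_mod_cast h5
  rw [le_div_iff₀ (by positivity), Rat.cast_def, div_mul_eq_mul_div, le_div_iff₀ hden]
  linarith

/-- A Fourier coefficient of a predicate. -/
noncomputable def fourier (P : (Fin k → ℤˣ) → Bool) (T : Finset (Fin k)) : ℝ :=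
  (∑ z : Fin k → ℤˣ, if P z = true then ∏ i ∈ T, ((z i : ℤ) : ℝ) else 0) / 2 ^ k

lemma fourier_empty (P : (Fin k → ℤˣ) → Bool) : fourier P ∅ = mean P := by
  simp [fourier, mean]

lemma abs_fourier_le_one (P : (Fin k → ℤˣ) → Bool) (T : Finset (Fin k)) :
    |fourier P T| ≤ 1 := by
  rw [fourier, abs_div, abs_of_nonneg (by positivity : (0 : ℝ) ≤ 2 ^ k),
    div_le_one (by positivity)]
  refine (Finset.abs_sum_le_sum_abs _ _).trans ?_
  have h : ∀ z ∈ (Finset.univ : Finset (Fin k → ℤˣ)),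
      |if P z = true then ∏ i ∈ T, ((z i : ℤ) : ℝ) else 0| ≤ 1 := by
    intro z _
    split_ifs
    · rw [Finset.abs_prod]
      refine Finset.prod_le_one (fun i _ => abs_nonneg _) fun i _ => ?_
      rcases Int.units_eq_one_or (z i) with h | h <;> simp [h]
    · simp
  refine (Finset.sum_le_sum h).trans ?_
  simp

/-- Orthogonality of characters: summing `∏ i ∈ T, y i * z i` over `T` gives `∏ i, (1 + y i * z i)`,
which is `2 ^ k` if `y = z` and has a zero factor otherwise. -/
lemma fourier_expansion (P : (Fin k → ℤˣ) → Bool) (z : Fin k → ℤˣ) :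
    (if P z = true then (1 : ℝ) else 0)
      = ∑ T : Finset (Fin k), fourier P T * ∏ i ∈ T, ((z i : ℤ) : ℝ) := by
  simp only [fourier, div_mul_eq_mul_div, Finset.sum_mul, ← Finset.sum_div]
  rw [Finset.sum_comm, eq_div_iff (by positivity)]
  have h : ∀ y : Fin k → ℤˣ, ∑ T : Finset (Fin k),
      (if P y = true then ∏ i ∈ T, ((y i : ℤ) : ℝ) else 0) * ∏ i ∈ T, ((z i : ℤ) : ℝ)
      = if y = z then (if P y = true then 2 ^ k else 0) else 0 := by
    intro y
    split_ifs with hP hyz hyz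
    · subst hyz
      simp only [← Finset.prod_mul_distrib]
      have h1 : ∀ i, ((y i : ℤ) : ℝ) * ((y i : ℤ) : ℝ) = 1 := fun i => by
        rcases Int.units_eq_one_or (y i) with h | h <;> simp [h]
      simp [h1]
    · simp only [← Finset.prod_mul_distrib]
      rw [← Finset.powerset_univ, ← Finset.prod_one_add]
      obtain ⟨i, hi⟩ := Function.ne_iff.1 hyz
      refine Finset.prod_eq_zero (Finset.mem_univ i) ?_
      rcases Int.units_eq_one_or (y i) with h | h <;>
        rcases Int.units_eq_one_or (z i) with h' | h' <;> simp_all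
    · simp
    · simp
  rw [Finset.sum_congr rfl fun y _ => h y]
  simp

lemma cast_countP_eq_sum_map {Ω : Type*} (I : Multiset Ω) (p : Ω → Prop) [DecidablePred p] :
    ((I.countP p : ℕ) : ℝ) = (I.map fun C => if p C then (1 : ℝ) else 0).sum := by
  induction I using Multiset.induction with
  | empty => simp
  | cons C I ih =>
    rw [Multiset.countP_cons, Multiset.map_cons, Multiset.sum_cons, ← ih]
    push_cast
    ring

/-- The empty set contributes exactly `mean P` times the number of constraints; each of the at most
`2 ^ k` other sets adds at most a share `2 ^ (-k)` of the error `γ`. -/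
lemma opt_le_of_passes {P : (Fin k → ℤˣ) → Bool} {I : Instance k n} {γ : ℚ} (hγ : 0 < γ)
    (h : ∀ T : Finset (Fin k), T.Nonempty → ∃ E : Split k,
      Finset.univ.image E.f = T ∧ E.Passes I γ) :
    opt P I ≤ mean P + γ := by
  have hγ' : (0 : ℝ) < γ := by exact_mod_cast hγ
  have hmean : 0 ≤ mean P := by rw [mean]; positivity
  refine ciSup_le fun x => ?_
  rw [val]
  set m := Multiset.card I with hm
  rcases Nat.eq_zero_or_pos m with h0 | hpos
  · rw [h0]
    simp only [CharP.cast_eq_zero, div_zero]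
    positivity
  rw [div_le_iff₀ (by exact_mod_cast hpos)]
  set F : Finset (Fin k) → ℝ := fun T =>
    (((I.map fun C => ∏ i ∈ T, ((C.1 i : ℤ) * (x (C.2 i) : ℤ))).sum : ℤ) : ℝ) with hF
  have h1 : ((I.countP fun C => C.holds P x = true : ℕ) : ℝ) = ∑ T, fourier P T * F T := by
    obtain ⟨g, hg⟩ := Multiset.exists_sum_map_eq_sum_fin I
    rw [cast_countP_eq_sum_map, hg]
    simp only [hF, hg, Int.cast_sum, Int.cast_prod, Int.cast_mul, Finset.mul_sum]
    rw [Finset.sum_comm]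
    refine Finset.sum_congr rfl fun j _ => ?_
    rw [Constraint.holds, fourier_expansion]
    push_cast
    rfl
  have hFT : ∀ T : Finset (Fin k), T.Nonempty → |F T| ≤ γ * m / 2 ^ k := by
    intro T hT
    obtain ⟨E, rfl, hE⟩ := h T hT
    simp only [hF, Finset.prod_image fun a _ b _ hab => E.inj hab]
    exact hE.abs_sum_le hγ x
  have hF0 : F ∅ = m := by simp [hF, hm]
  rw [h1, ← Finset.sum_erase_add _ _ (Finset.mem_univ ∅), fourier_empty, hF0, add_mul, add_comm]
  refine add_le_add_right ?_ _
  have hterm : ∀ T ∈ Finset.univ.erase (∅ : Finset (Fin k)),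
      fourier P T * F T ≤ γ * m / 2 ^ k := by
    intro T hT
    have hT' : T.Nonempty := Finset.nonempty_iff_ne_empty.2 (Finset.ne_of_mem_erase hT)
    refine (le_abs_self _).trans ?_
    rw [abs_mul]
    exact (mul_le_of_le_one_left (abs_nonneg _) (abs_fourier_le_one P T)).trans (hFT T hT')
  refine (Finset.sum_le_card_nsmul _ _ _ hterm).trans ?_
  have hc : (((Finset.univ.erase (∅ : Finset (Fin k))).card : ℕ) : ℝ) ≤ 2 ^ k := by
    have := Finset.card_le_univ (Finset.univ.erase (∅ : Finset (Fin k)))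
    rw [Fintype.card_finset, Fintype.card_fin] at this
    exact_mod_cast this
  rw [nsmul_eq_mul]
  refine (mul_le_mul_of_nonneg_right hc (by positivity)).trans (le_of_eq ?_)
  field_simp

end RandomCSP

/-! ### Concentration of the number of constraints; sparsity and scale -/

namespace RandomCSP

section Concentration

variable {Ω : Type*} [Fintype Ω] {p : ℝ}

lemma bexp_card_sub_sq_le (hp : p ∈ Set.Icc (0 : ℝ) 1) :
    bexp p (fun I : Finset Ω => ((I.card : ℝ) - p * Fintype.card Ω) ^ 2)
      ≤ p * Fintype.card Ω := by
  classical
  have hp0 := hp.1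
  set M : ℝ := p * Fintype.card Ω with hM
  have hc : ∀ I : Finset Ω, (I.card : ℝ) = ∑ C : Ω, if {C} ⊆ I then 1 else 0 := fun I => by
    simp
  have hc2 : ∀ I : Finset Ω, (I.card : ℝ) ^ 2
      = ∑ C : Ω, ∑ C' : Ω, if {C, C'} ⊆ I then 1 else 0 := fun I => by
    rw [sq, hc, Finset.sum_mul_sum]
    refine Finset.sum_congr rfl fun C _ => Finset.sum_congr rfl fun C' _ => ?_
    simp only [Finset.insert_subset_iff, Finset.singleton_subset_iff]
    split_ifs <;> simp_all
  have h1 : bexp p (fun I : Finset Ω => (I.card : ℝ)) = M := by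
    simp only [hc]
    rw [bexp_sum]
    simp only [bexp_subset]
    simp [hM, mul_comm]
  have h2 : bexp p (fun I : Finset Ω => (I.card : ℝ) ^ 2) ≤ M ^ 2 + M := by
    simp only [hc2]
    rw [bexp_sum]
    have h3 : ∀ C ∈ (Finset.univ : Finset Ω), bexp p (fun I : Finset Ω =>
        ∑ C' : Ω, if {C, C'} ⊆ I then (1 : ℝ) else 0) ≤ Fintype.card Ω * p ^ 2 + p := by
      intro C _
      rw [bexp_sum]
      simp only [bexp_subset]
      -- Distinct elements are included together with probability `p ^ 2`; the excess `p ^ 2`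
      -- granted on the diagonal does no harm.
      have h4 : ∀ C' ∈ (Finset.univ : Finset Ω), p ^ ({C, C'} : Finset Ω).card
          ≤ p ^ 2 + if C' = C then p else 0 := by
        intro C' _
        split_ifs with h
        · subst h
          simpa using sq_nonneg p
        · rw [Finset.card_pair (Ne.symm h), add_zero]
      refine (Finset.sum_le_sum h4).trans (le_of_eq ?_)
      simp [Finset.sum_add_distrib]
    refine (Finset.sum_le_sum h3).trans (le_of_eq ?_)
    rw [Finset.sum_const, Finset.card_univ, nsmul_eq_mul, hM]
    ring
  have h3 : (fun I : Finset Ω => ((I.card : ℝ) - M) ^ 2)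
      = fun I => (I.card : ℝ) ^ 2 + ((-2 * M) * (I.card : ℝ) + M ^ 2 * 1) := by
    funext I
    ring
  rw [h3, bexp_add, bexp_add, bexp_const_mul, bexp_const_mul, h1, bexp_one]
  linarith

open scoped Classical in
lemma bexp_card_lt_le (hp : p ∈ Set.Icc (0 : ℝ) 1) (hM : 0 < p * Fintype.card Ω) :
    bexp p (fun I : Finset Ω => if p * Fintype.card Ω / 2 ≤ I.card then 0 else 1)
      ≤ 4 / (p * Fintype.card Ω) := by
  set M : ℝ := p * Fintype.card Ω
  have h := bexp_markov hp (g := fun I : Finset Ω => ((I.card : ℝ) - M) ^ 2)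
    (fun I => sq_nonneg _) (a := M ^ 2 / 4) (by positivity) (bexp_card_sub_sq_le hp)
  have e : M / (M ^ 2 / 4) = 4 / M := by field_simp
  rw [e] at h
  refine (bexp_mono hp fun I => ?_).trans h
  by_cases h1 : M / 2 ≤ I.card
  · rw [if_pos h1]
    split_ifs <;> norm_num
  · rw [if_neg h1, if_neg]
    intro h2
    rw [not_le] at h1
    nlinarith

end Concentration

variable {k n : ℕ}

lemma card_filter_scope_le {κ : Type*} [Fintype κ] {g : κ → Fin k} (hg : Function.Injective g)
    (U : κ → Fin n) :
    (Finset.univ.filter fun C : Constraint k n => ∀ l, C.2 (g l) = U l).card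
      ≤ 2 ^ k * n ^ (k - Fintype.card κ) := by
  classical
  let J := {j : Fin k // j ∉ Finset.univ.image g}
  have hJc : Fintype.card J = k - Fintype.card κ := by
    rw [Fintype.card_subtype_compl, Fintype.card_fin, Fintype.card_coe,
      Finset.card_image_of_injective _ hg, Finset.card_univ]
  have h1 : Fintype.card ((Fin k → ℤˣ) × (J → Fin n)) = 2 ^ k * n ^ (k - Fintype.card κ) := by
    simp [hJc]
  rw [← h1, ← Finset.card_univ]
  refine Finset.card_le_card_of_injOn (fun C => (C.1, fun j => C.2 j)) (by simp) ?_
  intro C hC C' hC' h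
  simp only [Finset.coe_filter, Finset.mem_univ, true_and, Set.mem_ofPred_eq] at hC hC'
  obtain ⟨h2, h3⟩ := Prod.ext_iff.1 h
  refine Prod.ext h2 (funext fun j => ?_)
  by_cases hj : j ∈ Finset.univ.image g
  · obtain ⟨l, -, rfl⟩ := Finset.mem_image.1 hj
    rw [hC, hC']
  · exact congrFun h3 ⟨j, hj⟩

namespace Split

variable (E : Split k)

lemma size_le : E.s + E.s + E.r ≤ k := by
  simpa using Fintype.card_le_of_injective E.f E.inj

lemma χ_eq_one_or (C : Constraint k n) :
    (E.triples n).χ C = 1 ∨ (E.triples n).χ C = -1 := by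
  have h : (E.triples n).χ C = ((∏ l, C.1 (E.f l) : ℤˣ) : ℤ) := by
    rw [Units.coe_prod]
    rfl
  rw [h]
  rcases Int.units_eq_one_or (∏ l, C.1 (E.f l)) with h | h <;> simp [h]

/-- Negate the sign at one fixed position of `E`; such a position exists because the set of
positions is nonempty. -/
lemma exists_flip : Nonempty (E.triples n).Flip := by
  have hne : Nonempty ((Fin E.s ⊕ Fin E.s) ⊕ Fin E.r) := by
    rw [← Fintype.card_pos_iff]
    simpa using E.pos
  obtain ⟨l₀⟩ := hne
  refine ⟨⟨fun C => (Function.update C.1 (E.f l₀) (-C.1 (E.f l₀)), C.2), fun C => ?_,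
    fun C => ?_, fun _ => rfl, fun _ => rfl, fun _ => rfl, E.χ_eq_one_or⟩⟩
  · simp
  · simp only [triples]
    rw [← Finset.mul_prod_erase _ _ (Finset.mem_univ l₀),
      ← Finset.mul_prod_erase Finset.univ (fun l => (C.1 (E.f l) : ℤ)) (Finset.mem_univ l₀),
      Function.update_self]
    rw [Finset.prod_congr rfl fun l hl => by
      rw [Function.update_of_ne (E.inj.ne (Finset.ne_of_mem_erase hl))]]
    simp

/-- The scale of the correlation matrix of a random instance. -/
noncomputable def scale (n : ℕ) (p : ℝ) : ℝ :=
  2 * (2 ^ k * (n : ℝ) ^ k * p) / ((n : ℝ) ^ E.s * √((n : ℝ) ^ E.r))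

/-- The scale is chosen so that the weight is `n ^ s * √(n ^ r) / (2 ^ k * n ^ k)`. The condition on
pairs of new elements then holds with equality, and the two conditions on single new elements reduce
to `1 ≤ √(n ^ r)`. -/
lemma sparse (hn : 0 < n) {p : ℝ} (hp : 0 < p) :
    SignedTriples.Flip.Sparse (E.triples n) (2 * p / E.scale n p)
      (2 ^ k * n ^ (k - (E.s + E.r))) (2 ^ k * n ^ (k - (E.s + E.r)))
      (2 ^ k * n ^ (k - E.s)) := by
  have hn' : (0 : ℝ) < n := by exact_mod_cast hn
  have hk := E.size_le
  set w : ℝ := √((n : ℝ) ^ E.r) with hw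
  have hw0 : 0 < w := by positivity
  have hww : w * w = (n : ℝ) ^ E.r := Real.mul_self_sqrt (by positivity)
  have hw1 : 1 ≤ w := by
    rw [hw, Real.one_le_sqrt]
    exact one_le_pow₀ (by exact_mod_cast hn)
  have hq : 2 * p / E.scale n p = (n : ℝ) ^ E.s * w / (2 ^ k * (n : ℝ) ^ k) := by
    rw [scale, ← hw]
    field_simp
  have e1 : (n : ℝ) ^ k = (n : ℝ) ^ (k - (E.s + E.r)) * ((n : ℝ) ^ E.s * (n : ℝ) ^ E.r) := by
    rw [← pow_add, ← pow_add]
    congr 1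
    omega
  have e2 : (n : ℝ) ^ k = (n : ℝ) ^ (k - E.s) * (n : ℝ) ^ E.s := by
    rw [← pow_add]
    congr 1
    omega
  have hcA : ((2 ^ k * n ^ (k - (E.s + E.r)) : ℕ) : ℝ) * (2 * p / E.scale n p) ≤ 1 := by
    rw [hq, e1, ← hww]
    push_cast
    rw [← mul_div_assoc, div_le_one (by positivity)]
    have h : (2 : ℝ) ^ k * (n : ℝ) ^ (k - (E.s + E.r)) * ((n : ℝ) ^ E.s * w)
        ≤ 2 ^ k * (n : ℝ) ^ (k - (E.s + E.r)) * ((n : ℝ) ^ E.s * (w * w)) := by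
      gcongr
      nlinarith
    linarith
  have hinj1 : Function.Injective fun l : Fin E.s ⊕ Fin E.r =>
      E.f (Sum.elim (fun l => .inl (.inl l)) .inr l) := by
    refine E.inj.comp ?_
    rintro (a | a) (b | b) h <;> simp at h ⊢ <;> exact h
  have hinj2 : Function.Injective fun l : Fin E.s ⊕ Fin E.r =>
      E.f (Sum.elim (fun l => .inl (.inr l)) .inr l) := by
    refine E.inj.comp ?_
    rintro (a | a) (b | b) h <;> simp at h ⊢ <;> exact h
  refine ⟨fun a i => ?_, fun b i => ?_, fun a => ?_, hcA, hcA, ?_⟩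
  · refine le_trans (Finset.card_le_card fun C hC => ?_)
      ((card_filter_scope_le hinj1 (Sum.elim a i)).trans (by simp))
    simp only [Finset.mem_filter, Finset.mem_univ, true_and] at hC ⊢
    rintro (l | l)
    · exact congrFun hC.1 l
    · exact congrFun hC.2 l
  · refine le_trans (Finset.card_le_card fun C hC => ?_)
      ((card_filter_scope_le hinj2 (Sum.elim b i)).trans (by simp))
    simp only [Finset.mem_filter, Finset.mem_univ, true_and] at hC ⊢
    rintro (l | l)
    · exact congrFun hC.1 l
    · exact congrFun hC.2 l
  · refine le_trans (Finset.card_le_card fun C hC => ?_)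
      ((card_filter_scope_le (g := fun l : Fin E.s => E.f (.inl (.inl l)))
        (E.inj.comp fun l l' h => by simpa using h) a).trans (by simp))
    simp only [Finset.mem_filter, Finset.mem_univ, true_and] at hC ⊢
    exact fun l => congrFun hC l
  · rw [hq]
    push_cast
    have h : (2 : ℝ) ^ k * (n : ℝ) ^ (k - E.s) * (2 ^ k * (n : ℝ) ^ (k - (E.s + E.r)))
        * ((n : ℝ) ^ E.s * w / (2 ^ k * (n : ℝ) ^ k)) ^ 2
        = ((n : ℝ) ^ (k - E.s) * (n : ℝ) ^ E.s)
          * ((n : ℝ) ^ (k - (E.s + E.r)) * ((n : ℝ) ^ E.s * (w * w))) / ((n : ℝ) ^ k) ^ 2 := by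
      field_simp
    rw [h, hww, ← e1, ← e2, ← sq, div_self (by positivity)]

end Split

/-- This makes any fixed power of `n` at most a constant to the power `2 ^ rounds n`, so that
polynomial losses vanish after taking roots. -/
lemma le_two_pow_rounds (n : ℕ) : n ≤ 2 ^ 2 ^ rounds n :=
  (Nat.le_pow_clog one_lt_two n).trans
    (Nat.pow_le_pow_right two_pos (Nat.le_pow_clog one_lt_two _))

/-- Conversely, the exponent is not much larger than needed: removing both ceilings gives `2 ^
(rounds n - 1) ≤ log n / log 2`, and `4 / log 2 < 6`. For `n ≥ 3` both ceilings are positive. -/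
lemma two_mul_two_pow_rounds_le {n : ℕ} (hn : 3 ≤ n) :
    2 * (2 : ℝ) ^ rounds n ≤ 6 * Real.log n := by
  have hc : 1 < Nat.clog 2 n := by
    rw [Nat.lt_clog_iff_pow_lt one_lt_two]
    omega
  have h1 := Nat.pow_pred_clog_lt_self one_lt_two hc
  have h2 := Nat.pow_pred_clog_lt_self one_lt_two (x := n) (by omega)
  have h3 : 0 < rounds n := Nat.clog_pos one_lt_two hc
  obtain ⟨c, hc'⟩ := Nat.exists_eq_succ_of_ne_zero (Nat.ne_of_gt (Nat.zero_lt_of_lt hc))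
  obtain ⟨q, hq⟩ := Nat.exists_eq_succ_of_ne_zero h3.ne'
  rw [← rounds, hq] at h1
  rw [hc'] at h1 h2
  simp only [Nat.pred_succ] at h1 h2
  have h4 : (2 : ℝ) ^ q ≤ c := by exact_mod_cast Nat.lt_succ_iff.1 h1
  have h5 : (c : ℝ) * Real.log 2 ≤ Real.log n := by
    rw [← Real.log_pow]
    exact Real.log_le_log (by positivity) (by exact_mod_cast h2.le)
  have h6 := Real.log_two_gt_d9
  rw [hq, pow_succ]
  nlinarith

end RandomCSP

/-! ### Completeness: the test passes on random instances with high probability -/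

namespace RandomCSP

lemma sum_sq_pow_eq_trace {V : Type*} [Fintype V] [DecidableEq V] {A : Matrix V V ℤ}
    (hA : A.IsSymm) (m : ℕ) : ∑ u, ∑ v, (A ^ m) u v ^ 2 = (A ^ (m * 2)).trace := by
  rw [pow_mul, sq, Matrix.trace]
  refine Finset.sum_congr rfl fun u _ => ?_
  rw [Matrix.diag_apply, Matrix.mul_apply]
  refine Finset.sum_congr rfl fun v _ => ?_
  rw [sq, (hA.pow m).apply u v]

/-- Grouping by triples turns the weight into a sum of squares. Markov's inequality needs this
nonnegativity. -/
lemma SignedTriples.diag_nonneg {Ω α β ι : Type*} {D : SignedTriples Ω α β ι} [DecidableEq α]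
    [DecidableEq β] [DecidableEq ι] [Fintype α] [Fintype β] [Fintype ι] (I : Multiset Ω) :
    0 ≤ D.diag I := by
  obtain ⟨g, hg⟩ := Multiset.exists_sum_map_eq_sum_fin I
  have h : D.diag I = ∑ t : ι × α × β,
      (∑ x, if (D.i (g x), D.a (g x), D.b (g x)) = t then D.χ (g x) else 0) ^ 2 := by
    simp only [diag, hg, sq, Finset.sum_mul_sum]
    symm
    rw [Finset.sum_comm]
    refine Finset.sum_congr rfl fun x _ => ?_
    rw [Finset.sum_comm]
    refine Finset.sum_congr rfl fun y _ => ?_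
    rw [Finset.sum_eq_single (D.i (g x), D.a (g x), D.b (g x))]
    · simp only [if_true, Prod.mk.injEq]
      by_cases hc : D.i (g x) = D.i (g y) ∧ D.a (g x) = D.a (g y) ∧ D.b (g x) = D.b (g y)
      · rw [if_pos hc, if_pos ⟨hc.1.symm, hc.2.1.symm, hc.2.2.symm⟩]
      · rw [if_neg hc, if_neg fun h => hc ⟨h.1.symm, h.2.1.symm, h.2.2.symm⟩, mul_zero]
    · intro t _ ht
      rw [if_neg ht.symm, zero_mul]
    · simp
  rw [h]
  positivity

lemma one_le_log_of_three_le {n : ℕ} (hn : 3 ≤ n) : 1 ≤ Real.log n := by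
  rw [Real.le_log_iff_exp_le (by positivity)]
  have h1 := Real.exp_one_lt_d9
  have h2 : (3 : ℝ) ≤ n := by exact_mod_cast hn
  linarith

namespace Split

variable {k n : ℕ} (E : Split k)

lemma pow_r_le_rpow_half (hk : 2 ≤ k) (hn : 1 ≤ n) :
    (n : ℝ) ^ E.r ≤ (n : ℝ) ^ ((k : ℝ) / 2) := by
  have hn' : (1 : ℝ) ≤ n := by exact_mod_cast hn
  rw [← Real.rpow_natCast]
  refine Real.rpow_le_rpow_of_exponent_le hn' ?_
  have h1 : (2 : ℝ) ≤ k := by exact_mod_cast hk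
  have h2 : (E.r : ℝ) ≤ 1 := by exact_mod_cast E.r_le
  linarith

lemma pow_s_mul_sqrt_le_rpow_half (hn : 1 ≤ n) :
    (n : ℝ) ^ E.s * √((n : ℝ) ^ E.r) ≤ (n : ℝ) ^ ((k : ℝ) / 2) := by
  have hn' : (1 : ℝ) ≤ n := by exact_mod_cast hn
  refine (abs_le_of_sq_le_sq' ?_ (by positivity)).2
  rw [mul_pow, Real.sq_sqrt (by positivity), ← pow_mul, ← pow_add, ← Real.rpow_natCast,
    ← Real.rpow_natCast, ← Real.rpow_mul (by positivity)]
  refine Real.rpow_le_rpow_of_exponent_le hn' ?_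
  have h : ((E.s + E.s + E.r : ℕ) : ℝ) ≤ k := by exact_mod_cast E.size_le
  push_cast at h ⊢
  linarith

/-- In the application `t = 2 ^ k`, `ℓ = log n`, `M` is the expected number of constraints, `A = n ^
(k / 2) / n ^ r` and `S = n ^ s / √(n ^ r)`. The terms on the left are the required size of the
quadratic form, the rounding error and the diagonal weight. Two logarithms would suffice here; the
exponent `5` is slack. -/
lemma slack_le {t ℓ M A S : ℝ} (ht : 4 ≤ t) (hℓ : 1 ≤ ℓ) (hM : 1 ≤ M) (hA : 1 ≤ A)
    (hS : S ≤ A) :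
    t * 2 * (288 * (ℓ ^ 2 * M * S)) + 1 + 2 * M * ℓ ≤ t ^ 18 / 4 * (ℓ ^ 5 * M * A) := by
  set U : ℝ := ℓ ^ 5 * M * A with hU
  have hℓ2 : ℓ ^ 2 ≤ ℓ ^ 5 := pow_le_pow_right₀ hℓ (by norm_num)
  have hℓ5 : 1 ≤ ℓ ^ 5 := one_le_pow₀ hℓ
  have hℓ15 : ℓ ≤ ℓ ^ 5 := le_self_pow₀ hℓ (by norm_num)
  have b1 : ℓ ^ 2 * M * S ≤ U := by
    calc ℓ ^ 2 * M * S ≤ ℓ ^ 2 * M * A := by gcongr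
      _ ≤ U := by rw [hU]; gcongr
  have b2 : 1 ≤ U := by
    calc (1 : ℝ) = 1 * 1 * 1 := by norm_num
      _ ≤ U := by rw [hU]; gcongr
  have b3 : M * ℓ ≤ U := by
    calc M * ℓ = ℓ * M * 1 := by ring
      _ ≤ U := by rw [hU]; gcongr
  have b4 : t * 2 * (288 * (ℓ ^ 2 * M * S)) ≤ t * 2 * (288 * U) := by gcongr
  have ht18 : 576 * t + 3 ≤ t ^ 18 / 4 := by
    have h1 : (4 : ℝ) ^ 17 ≤ t ^ 17 := pow_le_pow_left₀ (by norm_num) ht 17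
    have h2 : (4 : ℝ) ^ 17 * t ≤ t ^ 18 := by
      rw [pow_succ t 17]
      exact mul_le_mul_of_nonneg_right h1 (by linarith)
    linarith only [h2, ht]
  have b5 : (576 * t + 3) * U ≤ t ^ 18 / 4 * U :=
    mul_le_mul_of_nonneg_right ht18 (by linarith)
  linarith only [b2, b3, b4, b5]

lemma rpow_half_le (hn : 3 ≤ n) {γ : ℚ} (hγ0 : 0 < γ) (hγ1 : γ < 1) {M : ℝ}
    (hM : 2 ^ (20 * k) * (n : ℝ) ^ ((k : ℝ) / 2) * Real.log n ^ 5 / (γ : ℝ) ^ 2 ≤ M) :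
    (n : ℝ) ^ ((k : ℝ) / 2) ≤ M := by
  have hγ0' : (0 : ℝ) < γ := by exact_mod_cast hγ0
  have hγ1' : (γ : ℝ) < 1 := by exact_mod_cast hγ1
  refine le_trans ?_ hM
  rw [le_div_iff₀ (by positivity)]
  have h1 : (1 : ℝ) ≤ 2 ^ (20 * k) := one_le_pow₀ (by norm_num)
  have h2 : 1 ≤ Real.log n ^ 5 := one_le_pow₀ (one_le_log_of_three_le hn)
  have h3 : (γ : ℝ) ^ 2 ≤ 1 := pow_le_one₀ hγ0'.le hγ1'.le
  calc (n : ℝ) ^ ((k : ℝ) / 2) * (γ : ℝ) ^ 2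
      ≤ (n : ℝ) ^ ((k : ℝ) / 2) * 1 := by gcongr
    _ = 1 * (n : ℝ) ^ ((k : ℝ) / 2) * 1 := by ring
    _ ≤ _ := by gcongr

/-- The numerical heart of the completeness of the test. -/
lemma budget_ge (hk : 2 ≤ k) (hn : 3 ≤ n) {γ : ℚ} (hγ0 : 0 < γ) (hγ1 : γ < 1) {p : ℝ}
    (hM : 2 ^ (20 * k) * (n : ℝ) ^ ((k : ℝ) / 2) * Real.log n ^ 5 / (γ : ℝ) ^ 2
      ≤ 2 ^ k * (n : ℝ) ^ k * p)
    {I : Finset (Constraint k n)} (hI : 2 ^ k * (n : ℝ) ^ k * p / 2 ≤ I.card)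
    (hdiag : ((E.triples n).diag I.val : ℝ) ≤ 2 * (2 ^ k * (n : ℝ) ^ k * p) * Real.log n) :
    2 ^ (k + 1) * (((n : ℝ) ^ E.s * (n : ℝ) ^ E.s) * (E.scale n p * (12 * Real.log n) ^ 2))
      ≤ E.budget I.val γ := by
  set M : ℝ := 2 ^ k * (n : ℝ) ^ k * p with hMdef
  set x : ℝ := (n : ℝ) with hx
  set ℓ : ℝ := Real.log x with hℓ
  set H : ℝ := x ^ ((k : ℝ) / 2) with hH
  set w : ℝ := √(x ^ E.r) with hw
  have hx3 : (3 : ℝ) ≤ x := hx ▸ (by exact_mod_cast hn)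
  have hx0 : 0 < x := by linarith
  have hℓ1 : 1 ≤ ℓ := one_le_log_of_three_le hn
  have hγ0' : (0 : ℝ) < γ := by exact_mod_cast hγ0
  have hγ1' : (γ : ℝ) < 1 := by exact_mod_cast hγ1
  have hw0 : 0 < w := by positivity
  have hww : w * w = x ^ E.r := Real.mul_self_sqrt (by positivity)
  have hH0 : 0 < H := by positivity
  have hwH : w * w ≤ H := hww ▸ E.pow_r_le_rpow_half hk (by omega)
  have hsH : x ^ E.s * w ≤ H := E.pow_s_mul_sqrt_le_rpow_half (by omega)
  set A : ℝ := H / (w * w) with hA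
  have hA1 : 1 ≤ A := by rwa [hA, one_le_div (by positivity)]
  have hsA : x ^ E.s / w ≤ A := by
    rw [hA, div_le_div_iff₀ hw0 (by positivity)]
    nlinarith
  set t : ℝ := 2 ^ k with ht
  have ht4 : 4 ≤ t := by
    calc (4 : ℝ) = 2 ^ 2 := by norm_num
      _ ≤ t := pow_le_pow_right₀ (by norm_num) hk
  have ht20 : (2 : ℝ) ^ (20 * k) = t ^ 20 := by rw [ht, ← pow_mul, mul_comm]
  have ht2 : (4 : ℝ) ^ k = t ^ 2 := by
    rw [ht, ← pow_mul, mul_comm, pow_mul]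
    norm_num
  have hM1 : 1 ≤ M :=
    (Real.one_le_rpow (by linarith) (by positivity)).trans (rpow_half_le hn hγ0 hγ1 hM)
  rw [ht20, div_le_iff₀ (by positivity)] at hM
  -- The integer division in the budget loses at most `1`.
  have hfloor : (γ : ℝ) ^ 2 * (I.card : ℝ) ^ 2 / (t ^ 2 * (w * w)) - 1
      ≤ ((γ.num ^ 2 * (I.card : ℤ) ^ 2 / (4 ^ k * (γ.den : ℤ) ^ 2 * (n : ℤ) ^ E.r) : ℤ) : ℝ) := by
    have hden : (0 : ℝ) < γ.den := by exact_mod_cast γ.den_pos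
    have hb : (0 : ℤ) < 4 ^ k * (γ.den : ℤ) ^ 2 * (n : ℤ) ^ E.r := by
      have := γ.den_pos
      have : 0 < n := by omega
      positivity
    have h1 := Int.lt_ediv_add_one_mul_self (γ.num ^ 2 * (I.card : ℤ) ^ 2) hb
    have h2 : (γ.num : ℝ) ^ 2 * (I.card : ℝ) ^ 2
        < (((γ.num ^ 2 * (I.card : ℤ) ^ 2 / (4 ^ k * (γ.den : ℤ) ^ 2 * (n : ℤ) ^ E.r) : ℤ) : ℝ) + 1)
          * (4 ^ k * (γ.den : ℝ) ^ 2 * x ^ E.r) := by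
      have h3 := (Int.cast_lt (R := ℝ)).2 h1
      push_cast at h3
      exact h3
    rw [sub_le_iff_le_add, div_le_iff₀ (by positivity), Rat.cast_def, div_pow,
      div_mul_eq_mul_div, div_le_iff₀ (by positivity)]
    rw [ht2, ← hww] at h2
    linarith
  have hbud : (γ : ℝ) ^ 2 * (I.card : ℝ) ^ 2 / (t ^ 2 * (w * w)) - 1 - 2 * M * ℓ
      ≤ E.budget I.val γ := by
    rw [Split.budget]
    push_cast
    simp only [Finset.card_val]
    linarith
  refine le_trans ?_ hbud
  have hM0 : 0 ≤ M := by linarith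
  -- One factor of `M ^ 2` is replaced by the density hypothesis. The `1 / 4` comes from having only
  -- half the expected number of constraints, and `t ^ 18` is `t ^ 20` over the `4 ^ k` of the
  -- budget.
  have hmain : t ^ 18 / 4 * (ℓ ^ 5 * M * A)
      ≤ (γ : ℝ) ^ 2 * (I.card : ℝ) ^ 2 / (t ^ 2 * (w * w)) := by
    rw [le_div_iff₀ (by positivity), hA]
    have e : t ^ 18 / 4 * (ℓ ^ 5 * M * (H / (w * w))) * (t ^ 2 * (w * w))
        = t ^ 20 * H * ℓ ^ 5 * M / 4 := by
      field_simp
    rw [e]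
    have h1 : t ^ 20 * H * ℓ ^ 5 * M ≤ M * γ ^ 2 * M :=
      mul_le_mul_of_nonneg_right hM hM0
    have h2 : (M / 2) ^ 2 ≤ (I.card : ℝ) ^ 2 := pow_le_pow_left₀ (by positivity) hI 2
    have h3 : (γ : ℝ) ^ 2 * (M / 2) ^ 2 ≤ γ ^ 2 * (I.card : ℝ) ^ 2 := by gcongr
    linarith only [h1, h3]
  have hL : (x ^ E.s * x ^ E.s) * (E.scale n p * (12 * ℓ) ^ 2)
      = 288 * (ℓ ^ 2 * M * (x ^ E.s / w)) := by
    rw [scale, ← hx, ← hw, ← ht, ← hMdef]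
    field_simp
    ring
  rw [hL, pow_succ, ← ht]
  have hslack := slack_le ht4 hℓ1 hM1 hA1 hsA
  linarith only [hslack, hmain]

/-- The Frobenius norm in the test is a trace of an even power. The factor `n` lost in Markov's
inequality and the dimension `N` are together at most `n ^ (k + 1)`, which is absorbed by the `R`-th
power of the extra `2 ^ (k + 1)` in `budget_ge`. -/
lemma passes_of_bounds (hk : 2 ≤ k) (hn : 3 ≤ n) {γ : ℚ} (hγ0 : 0 < γ) (hγ1 : γ < 1) {p : ℝ}
    (hp : p ∈ Set.Icc (0 : ℝ) 1)
    (hM : 2 ^ (20 * k) * (n : ℝ) ^ ((k : ℝ) / 2) * Real.log n ^ 5 / (γ : ℝ) ^ 2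
      ≤ 2 ^ k * (n : ℝ) ^ k * p)
    {I : Finset (Constraint k n)} (hI : 2 ^ k * (n : ℝ) ^ k * p / 2 ≤ I.card)
    (hdiag : ((E.triples n).diag I.val : ℝ) ≤ 2 * (2 ^ k * (n : ℝ) ^ k * p) * Real.log n)
    (htr : ((((E.triples n).corr I.val) ^ (2 ^ rounds n * 2)).trace : ℝ)
      ≤ n * (((n : ℝ) ^ E.s * (n : ℝ) ^ E.s)
        * (E.scale n p * (12 * Real.log n) ^ 2) ^ (2 ^ rounds n * 2))) :
    E.Passes I.val γ := by
  have hb := E.budget_ge hk hn hγ0 hγ1 hM hI hdiag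
  set N : ℝ := (n : ℝ) ^ E.s * (n : ℝ) ^ E.s with hN
  set B : ℝ := E.scale n p * (12 * Real.log n) ^ 2 with hB
  set R : ℕ := 2 ^ rounds n * 2 with hR
  have hp0 := hp.1
  have hB0 : 0 ≤ B := by
    rw [hB, scale]
    positivity
  have hN0 : 0 ≤ N := by positivity
  have hb0 : (0 : ℝ) ≤ E.budget I.val γ := le_trans (by positivity) hb
  refine ⟨by exact_mod_cast hb0, ?_⟩
  rw [sum_sq_pow_eq_trace (SignedTriples.corr_isSymm _), ← pow_mul, ← pow_mul, ← hR]
  have hn1 : (1 : ℝ) ≤ n := by exact_mod_cast (by omega : 1 ≤ n)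
  have hsize := E.size_le
  have h1 : N * n ≤ (2 ^ (k + 1)) ^ R := by
    calc N * n = (n : ℝ) ^ (E.s + E.s + 1) := by rw [hN]; ring
      _ ≤ (n : ℝ) ^ (k + 1) := pow_le_pow_right₀ hn1 (by omega)
      _ ≤ (2 ^ R) ^ (k + 1) := by
        refine pow_le_pow_left₀ (by positivity) ?_ _
        have h2 : n ≤ 2 ^ R := (le_two_pow_rounds n).trans
          (Nat.pow_le_pow_right two_pos (by omega))
        exact_mod_cast h2
      _ = _ := by rw [← pow_mul, ← pow_mul, mul_comm]
  have h2 : N ^ R * ((((E.triples n).corr I.val) ^ R).trace : ℝ) ≤ (E.budget I.val γ : ℝ) ^ R := by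
    calc N ^ R * ((((E.triples n).corr I.val) ^ R).trace : ℝ)
        ≤ N ^ R * (n * (N * B ^ R)) := by gcongr
      _ = (N * n) * (N * B) ^ R := by rw [mul_pow]; ring
      _ ≤ (2 ^ (k + 1)) ^ R * (N * B) ^ R := by gcongr
      _ = (2 ^ (k + 1) * (N * B)) ^ R := by rw [← mul_pow]
      _ ≤ _ := pow_le_pow_left₀ (by positivity) hb _
  rw [hN] at h2
  exact_mod_cast h2

open scoped Classical in
/-- The test succeeds with high probability. -/
lemma bexp_not_passes_le (hk : 2 ≤ k) (hn : 3 ≤ n) {γ : ℚ} (hγ0 : 0 < γ) (hγ1 : γ < 1) {p : ℝ}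
    (hp : p ∈ Set.Icc (0 : ℝ) 1)
    (hM : 2 ^ (20 * k) * (n : ℝ) ^ ((k : ℝ) / 2) * Real.log n ^ 5 / (γ : ℝ) ^ 2
      ≤ 2 ^ k * (n : ℝ) ^ k * p) :
    bexp p (fun I : Finset (Constraint k n) =>
      if 2 ^ k * (n : ℝ) ^ k * p / 2 ≤ I.card → E.Passes I.val γ then 0 else 1)
      ≤ 1 / n + 1 / Real.log n := by
  obtain ⟨F⟩ := E.exists_flip (n := n)
  set M : ℝ := 2 ^ k * (n : ℝ) ^ k * p with hMdef
  have hn1 : (1 : ℝ) ≤ n := by exact_mod_cast (by omega : 1 ≤ n)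
  have hlog := one_le_log_of_three_le hn
  have hγ0' : (0 : ℝ) < γ := by exact_mod_cast hγ0
  have hM0 : 0 < M := lt_of_lt_of_le (by positivity) hM
  have hp0 : 0 < p := by
    refine lt_of_le_of_ne hp.1 fun h => ?_
    rw [hMdef, ← h] at hM0
    simp at hM0
  have hΩ : (Fintype.card (Constraint k n) : ℝ) = 2 ^ k * (n : ℝ) ^ k := by simp
  -- The mean is at most `2 * M`; exceeding it by a factor `log n` has probability at most `1 / log
  -- n`.
  have hdiag := bexp_markov hp (g := fun I => ((E.triples n).diag I.val : ℝ))
    (fun I => by exact_mod_cast SignedTriples.diag_nonneg _) (a := 2 * M * Real.log n)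
    (by positivity) (F.bexp_diag_le hp)
  -- The moment bound requires a scale of at least `1`; this follows from `M ≥ n ^ (k / 2)`.
  have hsc : 1 ≤ E.scale n p := by
    rw [scale, ← hMdef, one_le_div (by positivity)]
    have h1 := E.pow_s_mul_sqrt_le_rpow_half (n := n) (by omega)
    have h2 := rpow_half_le hn hγ0 hγ1 hM
    linarith
  set B : ℝ := E.scale n p * (2 * (2 ^ rounds n * 2 : ℕ)) ^ 2 with hB
  set N : ℝ := (n : ℝ) ^ E.s * (n : ℝ) ^ E.s with hN
  -- The threshold is `n` times the bound on the expectation, so this fails with probability at most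
  -- `1 / n`.
  have htrace := bexp_markov hp
    (g := fun I => ((((E.triples n).corr I.val) ^ (2 ^ rounds n * 2)).trace : ℝ))
    (fun I => by
      rw [← sum_sq_pow_eq_trace (SignedTriples.corr_isSymm _)]
      positivity) (a := n * (N * B ^ (2 ^ rounds n * 2))) (by positivity)
    (SignedTriples.Flip.bexp_trace_corr_pow_le F hp hsc (E.sparse (by omega) hp0) _)
  have hN' : (Fintype.card ((Fin E.s → Fin n) × (Fin E.s → Fin n)) : ℝ) = N := by simp [hN]
  rw [hN', ← hB, div_mul_cancel_right₀ (by positivity), ← one_div] at htrace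
  rw [hΩ] at hdiag
  have e : 2 * p * (2 ^ k * (n : ℝ) ^ k) / (2 * M * Real.log n) = 1 / Real.log n := by
    rw [hMdef]
    field_simp
  rw [e] at hdiag
  refine le_trans ?_ (add_le_add htrace hdiag)
  rw [← bexp_add]
  refine bexp_mono hp fun I => ?_
  by_cases h1 : ((((E.triples n).corr I.val) ^ (2 ^ rounds n * 2)).trace : ℝ)
      ≤ n * (N * B ^ (2 ^ rounds n * 2))
  · by_cases h2 : ((E.triples n).diag I.val : ℝ) ≤ 2 * M * Real.log n
    · rw [if_pos]
      · split_ifs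
        norm_num
      intro hI
      refine E.passes_of_bounds hk hn hγ0 hγ1 hp hM hI h2 (h1.trans ?_)
      have h3 := two_mul_two_pow_rounds_le hn
      rw [hB]
      push_cast
      have h4 : 2 * ((2 : ℝ) ^ rounds n * 2) ≤ 12 * Real.log n := by linarith
      gcongr _ * (_ * (_ * ?_ ^ _) ^ _)
    · rw [if_neg h2]
      split_ifs <;> norm_num
  · rw [if_neg h1]
    split_ifs <;> norm_num

end Split

end RandomCSP

namespace RandomCSP

/-! ### Reasoning about programs -/

/-- All cells are bounded by `X`. -/
def Bdd (X : ℕ) (σ : Mem) : Prop := ∀ a i, (σ a i).natAbs ≤ X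

lemma bits_le_iff {z : ℤ} {b : ℕ} : bits z ≤ b ↔ z.natAbs < 2 ^ b := Nat.size_le

lemma natAbs_lt_two_pow_bits (z : ℤ) : z.natAbs < 2 ^ bits z := Nat.lt_size_self _

lemma bits_le_bits {x y : ℤ} (h : x.natAbs ≤ y.natAbs) : bits x ≤ bits y := Nat.size_le_size h

lemma bits_add_le (x y : ℤ) : bits (x + y) ≤ bits x + bits y + 1 := by
  rw [bits_le_iff]
  have h1 := (natAbs_lt_two_pow_bits x).trans_le
    (Nat.pow_le_pow_right two_pos (Nat.le_add_right (bits x) (bits y)))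
  have h2 := (natAbs_lt_two_pow_bits y).trans_le
    (Nat.pow_le_pow_right two_pos (Nat.le_add_left (bits y) (bits x)))
  have h3 := Int.natAbs_add_le x y
  rw [pow_succ]
  omega

lemma bits_sub_le (x y : ℤ) : bits (x - y) ≤ bits x + bits y + 1 := by
  have h : bits (-y) = bits y := by rw [bits, Int.natAbs_neg, ← bits]
  rw [sub_eq_add_neg, ← h]
  exact bits_add_le x (-y)

lemma bits_mul_le (x y : ℤ) : bits (x * y) ≤ bits x + bits y := by
  rw [bits_le_iff, Int.natAbs_mul, pow_add]
  exact Nat.mul_lt_mul'' (natAbs_lt_two_pow_bits x) (natAbs_lt_two_pow_bits y)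

lemma bits_div_le (x y : ℤ) : bits (x / y) ≤ bits x :=
  bits_le_bits (Int.natAbs_ediv_le_natAbs x y)

namespace Expr

/-- A coefficient for bounding the bit length of the value. -/
def len : Expr → ℕ
  | lit z => bits z
  | get _ _ => 1
  | add e f => e.len + f.len + 1
  | sub e f => e.len + f.len + 1
  | mul e f => e.len + f.len
  | div e _ => e.len
  | lt _ _ => 1

/-- A coefficient for bounding the cost. -/
def weight : Expr → ℕ
  | lit z => 1 + bits z
  | get _ e => e.weight + 2
  | add e f => e.weight + f.weight + (1 + (add e f).len)
  | sub e f => e.weight + f.weight + (1 + (sub e f).len)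
  | mul e f => e.weight + f.weight + (1 + (mul e f).len)
  | div e f => e.weight + f.weight + (1 + (div e f).len)
  | lt e f => e.weight + f.weight + 2

/-- For a fixed expression the bit length grows at most linearly in that of the cells, since a
product only adds lengths. Hence intermediate values may exceed `X` and only stored values must be
bounded. -/
lemma bits_eval_le {X : ℕ} {σ : Mem} (h : Bdd X σ) (e : Expr) :
    bits (e.eval σ) ≤ e.len * (Nat.size X + 1) := by
  induction e with
  | lit z => exact Nat.le_mul_of_pos_right _ (Nat.succ_pos _)
  | get a e _ =>
    rw [len, one_mul]
    exact (Nat.size_le_size (h _ _)).trans (Nat.le_succ _)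
  | add e f he hf =>
    refine (bits_add_le _ _).trans ?_
    rw [len]
    nlinarith
  | sub e f he hf =>
    refine (bits_sub_le _ _).trans ?_
    rw [len]
    nlinarith
  | mul e f he hf =>
    refine (bits_mul_le _ _).trans ?_
    rw [len]
    nlinarith
  | div e f he hf => exact (bits_div_le _ _).trans he
  | lt e f he hf =>
    rw [len, eval, one_mul]
    split_ifs
    · exact Nat.le_add_left _ _
    · exact Nat.zero_le _

lemma cost_le {X : ℕ} {σ : Mem} (h : Bdd X σ) (e : Expr) :
    e.cost σ ≤ e.weight * (Nat.size X + 1) := by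
  induction e with
  | lit z => exact Nat.le_mul_of_pos_right _ (Nat.succ_pos _)
  | get a e he =>
    have := bits_eval_le h (get a e)
    rw [len] at this
    rw [cost, weight]
    nlinarith
  | add e f he hf =>
    have := bits_eval_le h (add e f)
    rw [cost, weight]
    nlinarith
  | sub e f he hf =>
    have := bits_eval_le h (sub e f)
    rw [cost, weight]
    nlinarith
  | mul e f he hf =>
    have := bits_eval_le h (mul e f)
    rw [cost, weight]
    nlinarith
  | div e f he hf =>
    have := bits_eval_le h (div e f)
    rw [cost, weight]
    nlinarith
  | lt e f he hf =>
    have := bits_eval_le h (lt e f)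
    rw [len] at this
    rw [cost, weight]
    nlinarith

/-- Cell `0` of an array. -/
abbrev var (a : ℕ) : Expr := get a (lit 0)

/-- The remainder of a division. -/
def mod (e f : Expr) : Expr := sub e (mul f (div e f))

lemma eval_mod (σ : Mem) (e f : Expr) : (mod e f).eval σ = e.eval σ % f.eval σ := by
  rw [Int.emod_def]
  rfl

/-- `1` if the values are equal, `0` otherwise. -/
def eqv (e f : Expr) : Expr := sub (sub (lit 1) (lt e f)) (lt f e)

lemma eval_eqv (σ : Mem) (e f : Expr) :
    (eqv e f).eval σ = if e.eval σ = f.eval σ then 1 else 0 := by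
  simp only [eqv, eval]
  split_ifs <;> omega

/-- A power with a fixed exponent. -/
def power (e : Expr) : ℕ → Expr
  | 0 => lit 1
  | q + 1 => mul (power e q) e

lemma eval_power (σ : Mem) (e : Expr) (q : ℕ) : (power e q).eval σ = e.eval σ ^ q := by
  induction q with
  | zero => rw [pow_zero, power, eval]
  | succ q ih => rw [power, eval, ih, pow_succ]

/-- A sum of finitely many expressions. -/
def sumOf (L : List Expr) : Expr := L.foldr add (lit 0)

lemma eval_sumOf (σ : Mem) (L : List Expr) : (sumOf L).eval σ = (L.map (eval σ)).sum := by
  induction L with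
  | nil => rfl
  | cons e L ih => rw [List.map_cons, List.sum_cons, ← ih]; rfl

/-- A product of finitely many expressions. -/
def prodOf (L : List Expr) : Expr := L.foldr mul (lit 1)

lemma eval_prodOf (σ : Mem) (L : List Expr) : (prodOf L).eval σ = (L.map (eval σ)).prod := by
  induction L with
  | nil => rfl
  | cons e L ih => rw [List.map_cons, List.prod_cons, ← ih]; rfl

end Expr

/-- Started with memory `σ`, the program `c` halts with memory `τ` within time `t`. -/
def Reaches (c : Program) (σ τ : Mem) (t : ℕ) : Prop := ∃ s, Exec c σ τ s ∧ s ≤ t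

lemma Reaches.mono {c : Program} {σ τ : Mem} {s t : ℕ} (h : Reaches c σ τ s) (hst : s ≤ t) :
    Reaches c σ τ t := by
  obtain ⟨r, h, hr⟩ := h
  exact ⟨r, h, hr.trans hst⟩

lemma Reaches.seq {c d : Program} {σ τ ρ : Mem} {s t : ℕ} (h : Reaches c σ τ s)
    (h' : Reaches d τ ρ t) : Reaches (.seq c d) σ ρ (1 + s + t) := by
  obtain ⟨r, h, hr⟩ := h
  obtain ⟨r', h', hr'⟩ := h'
  exact ⟨_, h.seq h', by omega⟩

/-- Assign the value of `e` to cell `0` of array `a`. -/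
def assign (a : ℕ) (e : Expr) : Program := .set a (.lit 0) e

/-- The memory after assigning a value to cell `0` of an array. -/
def Mem.put (σ : Mem) (a : ℕ) (z : ℤ) : Mem := Function.update σ a (Function.update (σ a) 0 z)

lemma Mem.put_self (σ : Mem) (a : ℕ) (z : ℤ) : σ.put a z a = Function.update (σ a) 0 z :=
  Function.update_self ..

lemma Mem.put_of_ne (σ : Mem) {a b : ℕ} (z : ℤ) (h : b ≠ a) : σ.put a z b = σ b :=
  Function.update_of_ne h ..

lemma Mem.store_eq (σ : Mem) (a i : ℕ) (z : ℤ) :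
    σ.store a i z = Function.update σ a (Function.update (σ a) i z) := by
  funext b j
  by_cases hb : b = a
  · subst hb
    by_cases hj : j = i
    · subst hj
      simp [Mem.store]
    · simp [Mem.store, hj]
  · simp [Mem.store, hb]

lemma Bdd.update {X : ℕ} {σ : Mem} (h : Bdd X σ) {a : ℕ} {f : ℕ → ℤ}
    (hf : ∀ i, (f i).natAbs ≤ X) : Bdd X (Function.update σ a f) := by
  intro b i
  by_cases hb : b = a
  · subst hb
    simpa using hf i
  · simpa [hb] using h b i

lemma Bdd.put {X : ℕ} {σ : Mem} (h : Bdd X σ) {a : ℕ} {z : ℤ} (hz : z.natAbs ≤ X) :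
    Bdd X (σ.put a z) := by
  refine h.update fun i => ?_
  by_cases hi : i = 0
  · subst hi
    simpa using hz
  · simpa [hi] using h a i

lemma reaches_assign {X : ℕ} {σ : Mem} (h : Bdd X σ) (a : ℕ) (e : Expr) {z : ℤ}
    (he : e.eval σ = z) : Reaches (assign a e) σ (σ.put a z) ((2 + e.weight) * (Nat.size X + 1)) := by
  have h1 := Exec.set σ a (.lit 0) e
  rw [Mem.store_eq, he] at h1
  refine ⟨_, h1, ?_⟩
  have := Expr.cost_le h e
  simp only [Expr.cost, bits, Int.natAbs_zero, Nat.size_zero]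
  nlinarith

/-- For every value of counter `c` below the value of `e`, assign a value to a cell of `a`. -/
def loop (c : ℕ) (e : Expr) (a : ℕ) (i v : Expr) : Program :=
  .seq (assign c (.lit 0)) (.while (.lt (.var c) e)
    (.seq (.set a i v) (assign c (.add (.var c) (.lit 1)))))

/-- A coefficient for bounding the running time of a loop. -/
def loopWeight (e i v : Expr) : ℕ := 20 + e.weight + i.weight + v.weight

/-- The memory in a loop: the counter `c` has value `w` and the array `a` has contents `f`. -/
def Mem.at (σ : Mem) (c : ℕ) (w : ℕ) (a : ℕ) (f : ℕ → ℤ) : Mem :=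
  Function.update (σ.put c w) a f

lemma Mem.at_self (σ : Mem) (c w a : ℕ) (f : ℕ → ℤ) : σ.at c w a f a = f :=
  Function.update_self ..

lemma Mem.at_of_ne (σ : Mem) {c a b : ℕ} (w : ℕ) (f : ℕ → ℤ) (ha : b ≠ a) (hc : b ≠ c) :
    σ.at c w a f b = σ b :=
  (Function.update_of_ne ha ..).trans (σ.put_of_ne _ hc)

lemma Mem.at_counter (σ : Mem) {c a : ℕ} (w : ℕ) (f : ℕ → ℤ) (hac : a ≠ c) :
    σ.at c w a f c 0 = w := by
  rw [Mem.at, Function.update_of_ne hac.symm, Mem.put_self, Function.update_self]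

/-- The sequence `f` is the loop invariant: `f w` is the content of the array after `w` iterations.
Expressions are evaluated against the current `f w`, so the body may read the array that it writes.
-/
lemma reaches_loop {X : ℕ} {σ : Mem} (h : Bdd X σ) {c a : ℕ} (hac : a ≠ c) {e i v : Expr} {m : ℕ}
    (hm : m ≤ X) {f : ℕ → ℕ → ℤ} (hf0 : f 0 = σ a)
    (he : ∀ w ≤ m, e.eval (σ.at c w a (f w)) = m)
    (hf : ∀ w < m, Function.update (f w) (i.eval (σ.at c w a (f w))).toNat
      (v.eval (σ.at c w a (f w))) = f (w + 1))
    (hX : ∀ w ≤ m, ∀ j, (f w j).natAbs ≤ X) :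
    Reaches (loop c e a i v) σ (σ.at c m a (f m))
      ((m + 1) * (loopWeight e i v * (Nat.size X + 1))) := by
  set b := Nat.size X + 1 with hb
  have hbdd : ∀ w ≤ m, Bdd X (σ.at c w a (f w)) := fun w hw =>
    (h.put (by simpa using hw.trans hm)).update (hX w hw)
  have hc : ∀ w g, (Expr.var c).eval (σ.at c w a g) = w := fun w g =>
    σ.at_counter w g hac
  have hat : ∀ w g g', Function.update (σ.at c w a g) a g' = σ.at c w a g' := fun w g g' =>
    Function.update_idem ..
  -- Induction on the number `d` of remaining iterations.
  have key : ∀ d w : ℕ, w + d = m → Reaches (.while (.lt (.var c) e)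
      (.seq (.set a i v) (assign c (.add (.var c) (.lit 1)))))
      (σ.at c w a (f w)) (σ.at c m a (f m))
      (d * ((20 + e.weight + i.weight + v.weight) * b) + (6 + e.weight) * b) := by
    intro d
    induction d with
    | zero =>
      intro w hw
      obtain rfl : w = m := by omega
      refine ⟨_, Exec.while_false ?_, ?_⟩
      · rw [Expr.eval, hc, he w le_rfl, if_neg (lt_irrefl _)]
      · have := Expr.cost_le (hbdd w le_rfl) (.lt (.var c) e)
        simp only [Expr.weight, bits, Int.natAbs_zero, Nat.size_zero] at this
        rw [← hb] at this
        nlinarith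
    | succ d ih =>
      intro w hw
      have hwm : w < m := by omega
      obtain ⟨t, ht, htle⟩ := ih (w + 1) (by omega)
      have hs1 := Exec.set (σ.at c w a (f w)) a i v
      rw [Mem.store_eq, Mem.at_self, hf w hwm, hat] at hs1
      have hb1 : Bdd X (σ.at c w a (f (w + 1))) :=
        (h.put (by simpa using hwm.le.trans hm)).update (hX _ hwm)
      obtain ⟨t2, hs2, ht2⟩ := reaches_assign hb1 c (.add (.var c) (.lit 1)) (z := w + 1) (by
        rw [Expr.eval, hc]
        rfl)
      have e1 : (σ.at c w a (f (w + 1))).put c (w + 1) = σ.at c (w + 1 : ℕ) a (f (w + 1)) := by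
        simp only [Mem.at, Mem.put]
        funext b j
        by_cases hba : b = a
        · subst hba
          simp [Function.update_of_ne hac]
        · by_cases hbc : b = c
          · subst hbc
            simp [Function.update_of_ne hba]
          · simp [hba, hbc]
      rw [e1] at hs2
      refine ⟨_, Exec.while_true ?_ (hs1.seq hs2) ht, ?_⟩
      · rw [Expr.eval, hc, he w hwm.le, if_pos (by exact_mod_cast hwm)]
        exact one_ne_zero
      · have c1 := Expr.cost_le (hbdd w hwm.le) (.lt (.var c) e)
        have c2 := Expr.cost_le (hbdd w hwm.le) i
        have c3 := Expr.cost_le (hbdd w hwm.le) v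
        have hb1 : bits 1 = 1 := rfl
        have hb0 : bits 0 = 0 := rfl
        simp only [Expr.weight, Expr.len, hb1, hb0] at c1 ht2
        rw [← hb] at c1 c2 c3 ht2
        have hb2 : 1 ≤ b := by omega
        nlinarith
  obtain ⟨t, ht, htle⟩ := key m 0 (by omega)
  have h0 := reaches_assign h c (.lit 0) (z := 0) rfl
  have e0 : σ.put c 0 = σ.at c (0 : ℕ) a (f 0) := by
    rw [Mem.at, hf0, ← σ.put_of_ne ((0 : ℕ) : ℤ) hac]
    exact (Function.update_eq_self ..).symm
  rw [e0] at h0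
  refine (h0.seq ⟨t, ht, htle⟩).mono ?_
  have hb0 : bits 0 = 0 := rfl
  simp only [Expr.weight, hb0, loopWeight]
  have hb2 : 1 ≤ b := by omega
  nlinarith

/-- Add values to cells of an array. -/
def accLoop (c : ℕ) (e : Expr) (a : ℕ) (i v : Expr) : Program :=
  loop c e a i (.add (.get a i) v)

/-- Index and increment must not depend on the array being accumulated, hence the quantification
over all `f`. The final content is then an explicit sum. -/
lemma reaches_accLoop {X : ℕ} {σ : Mem} (h : Bdd X σ) {c a : ℕ} (hac : a ≠ c) {e i v : Expr}
    {m : ℕ} (hm : m ≤ X) {I : ℕ → ℕ} {V : ℕ → ℤ}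
    (he : ∀ w ≤ m, ∀ f, e.eval (σ.at c w a f) = m)
    (hi : ∀ w < m, ∀ f, (i.eval (σ.at c w a f)).toNat = I w)
    (hv : ∀ w < m, ∀ f, v.eval (σ.at c w a f) = V w)
    (hX : ∀ w ≤ m, ∀ j, (σ a j + ∑ w' ∈ Finset.range w, if I w' = j then V w' else 0).natAbs ≤ X) :
    Reaches (accLoop c e a i v) σ
      (σ.at c m a fun j => σ a j + ∑ w ∈ Finset.range m, if I w = j then V w else 0)
      ((m + 1) * (loopWeight e i (.add (.get a i) v) * (Nat.size X + 1))) := by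
  refine reaches_loop h hac hm
    (f := fun w j => σ a j + ∑ w' ∈ Finset.range w, if I w' = j then V w' else 0)
    (by simp) (fun w hw => he w hw _) (fun w hw => ?_) hX
  funext j
  rw [Finset.sum_range_succ, Expr.eval, hv w hw, Expr.eval, hi w hw, Mem.at_self]
  by_cases hj : j = I w
  · subst hj
    rw [Function.update_self, if_pos rfl]
    ring
  · rw [Function.update_of_ne hj, if_neg (Ne.symm hj), add_zero]

/-- Assign values to an initial segment of an array. -/
def mapLoop (c : ℕ) (e : Expr) (a : ℕ) (v : Expr) : Program := loop c e a (.var c) v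

lemma reaches_mapLoop {X : ℕ} {σ : Mem} (h : Bdd X σ) {c a : ℕ} (hac : a ≠ c) {e v : Expr}
    {m : ℕ} (hm : m ≤ X) {V : ℕ → ℤ}
    (he : ∀ w ≤ m, ∀ f, e.eval (σ.at c w a f) = m)
    (hv : ∀ w < m, ∀ f, v.eval (σ.at c w a f) = V w)
    (hX : ∀ w < m, (V w).natAbs ≤ X) :
    Reaches (mapLoop c e a v) σ (σ.at c m a fun j => if j < m then V j else σ a j)
      ((m + 1) * (loopWeight e (.var c) v * (Nat.size X + 1))) := by
  refine reaches_loop h hac hm (f := fun w j => if j < w then V j else σ a j)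
    (by simp) (fun w hw => he w hw _) (fun w hw => ?_) (fun w hw j => ?_)
  · funext j
    have h1 : ((Expr.var c).eval (σ.at c w a fun j => if j < w then V j else σ a j)).toNat = w := by
      rw [Expr.eval, Expr.eval, Int.toNat_zero, σ.at_counter w _ hac, Int.toNat_natCast]
    rw [h1, hv w hw]
    by_cases hj : j = w
    · subst hj
      simp
    · rw [Function.update_of_ne hj]
      exact if_congr (by omega) rfl rfl
  · split_ifs with hj
    · exact hX j (by omega)
    · exact h a j

end RandomCSP

namespace RandomCSP

/-! ### Reading the input -/

lemma getD_flatMap {Ω : Type*} {g : Ω → List ℤ} {d : ℕ} (hg : ∀ C, (g C).length = d)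
    {l : List Ω} {j : ℕ} {C : Ω} (hj : l[j]? = some C) {o : ℕ} (ho : o < d) :
    (l.flatMap g).getD (d * j + o) 0 = (g C).getD o 0 := by
  induction l generalizing j with
  | nil => simp at hj
  | cons D l ih =>
    rw [List.flatMap_cons]
    cases j with
    | zero =>
      simp only [List.getElem?_cons_zero, Option.some.injEq] at hj
      subst hj
      rw [mul_zero, zero_add, List.getD_append _ _ _ _ (by rw [hg]; exact ho)]
    | succ j =>
      rw [List.getD_append_right _ _ _ _ (by rw [hg]; nlinarith), hg, ← ih (by simpa using hj)]
      congr 1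
      rw [mul_add, mul_one]
      omega

variable {k n : ℕ}

lemma encodeConstraint_eq (C : Constraint k n) :
    encodeConstraint C
      = (List.finRange k).flatMap fun i => [((C.1 i : ℤˣ) : ℤ), ((C.2 i : ℕ) : ℤ)] := by
  rw [encodeConstraint, List.ofFn_eq_map, List.flatMap]

lemma length_encodeConstraint (C : Constraint k n) : (encodeConstraint C).length = 2 * k := by
  rw [encodeConstraint_eq, List.length_flatMap]
  simp [mul_comm]

/-- The contents of the input array. -/
def inp (l : List (Constraint k n)) (γ : ℚ) : ℕ → ℤ := fun i => (encode l γ).getD i 0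

lemma inp_field {l : List (Constraint k n)} (γ : ℚ) {j : ℕ} {C : Constraint k n}
    (hj : l[j]? = some C) (i : Fin k) {o : ℕ} (ho : o < 2) :
    inp l γ (4 + (2 * k * j + (2 * i + o)))
      = [((C.1 i : ℤˣ) : ℤ), ((C.2 i : ℕ) : ℤ)].getD o 0 := by
  have hi := i.2
  rw [inp, encode, List.getD_append_right _ _ _ _ (by simp)]
  have h0 : 4 + (2 * k * j + (2 * (i : ℕ) + o))
      - [(n : ℤ), (l.length : ℤ), γ.num, (γ.den : ℤ)].length = 2 * k * j + (2 * i + o) := by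
    simp
  rw [h0, getD_flatMap length_encodeConstraint hj (by omega), encodeConstraint_eq,
    getD_flatMap (d := 2) (g := fun i : Fin k => [((C.1 i : ℤˣ) : ℤ), ((C.2 i : ℕ) : ℤ)])
      (fun _ => rfl) (C := i) (by simp) ho]

lemma natAbs_inp_le (l : List (Constraint k n)) (γ : ℚ) (i : ℕ) :
    (inp l γ i).natAbs ≤ n + l.length + γ.num.natAbs + γ.den + 1 := by
  rw [inp]
  by_cases hi : i < (encode l γ).length
  · rw [List.getD_eq_getElem _ _ hi]
    have hmem := List.getElem_mem hi
    generalize (encode l γ)[i] = z at hmem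
    simp only [encode, List.mem_append, List.mem_cons, List.not_mem_nil, or_false,
      List.mem_flatMap] at hmem
    rcases hmem with (rfl | rfl | rfl | rfl) | ⟨C, -, hC⟩
    · omega
    · omega
    · omega
    · omega
    · rw [encodeConstraint_eq] at hC
      simp only [List.mem_flatMap, List.mem_cons, List.not_mem_nil, or_false] at hC
      obtain ⟨j, -, rfl | rfl⟩ := hC
      · rw [Int.units_natAbs]
        omega
      · have := (C.2 j).2
        omega
  · rw [List.getD_eq_default _ _ (not_lt.1 hi)]
    simp

namespace Expr

/-- The number of variables. -/
def vars : Expr := get 0 (lit 0)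
/-- The number of constraints. -/
def size : Expr := get 0 (lit 1)
/-- The numerator of the parameter. -/
def num : Expr := get 0 (lit 2)
/-- The denominator of the parameter. -/
def den : Expr := get 0 (lit 3)

/-- An entry of the constraint with index `j`. -/
def field (k : ℕ) (j : Expr) (o : ℕ) : Expr :=
  get 0 (add (lit 4) (add (mul (lit (2 * k : ℕ)) j) (lit o)))

/-- The code of a part of the scope of the constraint with index `j`. -/
def code (j : Expr) {q : ℕ} (g : Fin q → Fin k) : Expr :=
  sumOf (List.ofFn fun l => mul (field k j (2 * g l + 1)) (power vars l))

/-- The product of some signs of the constraint with index `j`. -/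
def sign (j : Expr) {q : ℕ} (g : Fin q → Fin k) : Expr :=
  prodOf (List.ofFn fun l => field k j (2 * g l + 0))

section Eval

variable {σ : Mem} {l : List (Constraint k n)} {γ : ℚ}

lemma eval_vars (hσ : σ 0 = inp l γ) : vars.eval σ = n := by rw [vars, eval, hσ]; rfl
lemma eval_size (hσ : σ 0 = inp l γ) : size.eval σ = l.length := by rw [size, eval, hσ]; rfl
lemma eval_num (hσ : σ 0 = inp l γ) : num.eval σ = γ.num := by rw [num, eval, hσ]; rfl
lemma eval_den (hσ : σ 0 = inp l γ) : den.eval σ = γ.den := by rw [den, eval, hσ]; rfl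

lemma eval_field (hσ : σ 0 = inp l γ) {j : Expr} {w : ℕ} (hj : j.eval σ = w) {C : Constraint k n}
    (hC : l[w]? = some C) (i : Fin k) {o : ℕ} (ho : o < 2) :
    (field k j (2 * i + o)).eval σ = [((C.1 i : ℤˣ) : ℤ), ((C.2 i : ℕ) : ℤ)].getD o 0 := by
  rw [← inp_field γ hC i ho, ← hσ]
  simp only [field, eval, hj]
  congr 1

/-- Scopes are coded as numbers in base `n`, with the same digits as in `finFunctionFinEquiv`; being
a bijection, it makes equality of codes equivalent to equality of scopes. -/
lemma eval_code (hσ : σ 0 = inp l γ) {j : Expr} {w : ℕ} (hj : j.eval σ = w) {C : Constraint k n}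
    (hC : l[w]? = some C) {q : ℕ} (g : Fin q → Fin k) :
    (code j g).eval σ = ((finFunctionFinEquiv fun i => C.2 (g i) : Fin (n ^ q)) : ℕ) := by
  rw [code, eval_sumOf, List.map_ofFn, List.sum_ofFn, finFunctionFinEquiv_apply]
  push_cast
  refine Finset.sum_congr rfl fun i _ => ?_
  rw [Function.comp_apply, eval, eval_field hσ hj hC _ one_lt_two, eval_power, eval_vars hσ]
  rfl

lemma eval_sign (hσ : σ 0 = inp l γ) {j : Expr} {w : ℕ} (hj : j.eval σ = w) {C : Constraint k n}
    (hC : l[w]? = some C) {q : ℕ} (g : Fin q → Fin k) :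
    (sign j g).eval σ = ∏ i, (C.1 (g i) : ℤ) := by
  rw [sign, eval_prodOf, List.map_ofFn, List.prod_ofFn]
  refine Finset.prod_congr rfl fun i _ => ?_
  rw [Function.comp_apply, eval_field hσ hj hC _ two_pos]
  rfl

end Eval

end Expr

lemma sum_range_mul (g : ℕ → ℤ) (a b : ℕ) :
    ∑ w ∈ Finset.range (a * b), g w
      = ∑ i ∈ Finset.range a, ∑ x ∈ Finset.range b, g (i * b + x) := by
  induction a with
  | zero => simp
  | succ a ih => rw [add_mul, one_mul, Finset.sum_range_add, ih, Finset.sum_range_succ]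

/-- Nested loops are run with a single counter, whose quotient and remainder are the two indices. -/
lemma sum_range_div_mod (g : ℕ → ℕ → ℤ) (a b : ℕ) :
    ∑ w ∈ Finset.range (a * b), g (w / b) (w % b)
      = ∑ i ∈ Finset.range a, ∑ x ∈ Finset.range b, g i x := by
  rw [sum_range_mul]
  refine Finset.sum_congr rfl fun i _ => Finset.sum_congr rfl fun x hx => ?_
  have hx' := Finset.mem_range.1 hx
  rw [mul_comm, Nat.mul_add_div (by omega), Nat.mul_add_mod, Nat.div_eq_of_lt hx',
    Nat.mod_eq_of_lt hx', add_zero]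

lemma sum_range_getElem?_elim {Ω : Type*} (l : List Ω) (f : Ω → ℤ) :
    ∑ j ∈ Finset.range l.length, (l[j]?).elim 0 f = (l.map f).sum := by
  induction l with
  | nil => simp
  | cons C l ih =>
    rw [List.length_cons, Finset.sum_range_succ', List.map_cons, List.sum_cons, ← ih, add_comm]
    simp

lemma sum_pairs_eq {Ω : Type*} (l : List Ω) (f : Ω → Ω → ℤ) {V : ℕ → ℤ}
    (hV : ∀ w C C', l[w / l.length]? = some C → l[w % l.length]? = some C' → V w = f C C') :
    ∑ w ∈ Finset.range (l.length * l.length), V w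
      = (l.map fun C => (l.map fun C' => f C C').sum).sum := by
  simp only [← sum_range_getElem?_elim]
  have h := sum_range_div_mod
    (fun i x : ℕ => (l[i]?).elim 0 fun C => (l[x]?).elim 0 (f C)) l.length l.length
  have h2 : ∀ i : ℕ, ((l[i]?).elim 0 fun C => ∑ x ∈ Finset.range l.length, (l[x]?).elim 0 (f C))
      = ∑ x ∈ Finset.range l.length, (l[i]?).elim 0 fun C => (l[x]?).elim 0 (f C) := by
    intro i
    cases l[i]? <;> simp
  simp only [h2]
  rw [← h]
  refine Finset.sum_congr rfl fun w hw => ?_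
  have hw' := Finset.mem_range.1 hw
  have hpos : 0 < l.length := by
    by_contra h0
    obtain h0 : l.length = 0 := by omega
    simp [h0] at hw'
  rw [hV w _ _ (List.getElem?_eq_getElem (Nat.div_lt_of_lt_mul hw'))
    (List.getElem?_eq_getElem (Nat.mod_lt _ hpos)),
    List.getElem?_eq_getElem (Nat.div_lt_of_lt_mul hw'),
    List.getElem?_eq_getElem (Nat.mod_lt _ hpos)]
  rfl

end RandomCSP

namespace RandomCSP

/-! ### The program -/

lemma natAbs_sum_ite_le {w c : ℕ} {V : ℕ → ℤ} (p : ℕ → Prop) [DecidablePred p]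
    (hV : ∀ w' < w, (V w').natAbs ≤ c) :
    (∑ w' ∈ Finset.range w, if p w' then V w' else 0).natAbs ≤ w * c := by
  induction w with
  | zero => simp
  | succ w ih =>
    rw [Finset.sum_range_succ, add_mul, one_mul]
    refine (Int.natAbs_add_le _ _).trans (add_le_add (ih fun w' hw' => hV w' (by omega)) ?_)
    split_ifs
    · exact hV w (by omega)
    · simp

/-- An input together with a base `Y` for bounding cells and a bound `W` on numbers of
iterations. -/
structure Env (k : ℕ) where
  n : ℕ
  l : List (Constraint k n)
  γ : ℚ
  Y : ℕ
  W : ℕ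

namespace Env

variable {k : ℕ} (e : Env k)

/-- The bound on cells. -/
def X : ℕ := e.Y ^ (12 * 2 ^ rounds e.n)

/-- The unit in which running times are measured. -/
def unit : ℕ := (e.W + 1) * (Nat.size e.X + 1)

/-- The bounds are large enough for the test of `E`. -/
structure Ok (E : Split k) : Prop where
  card_le : e.l.length * e.l.length ≤ e.W
  dim_le : (e.n ^ E.s * e.n ^ E.s) * (e.n ^ E.s * e.n ^ E.s) * (e.n ^ E.s * e.n ^ E.s) ≤ e.W
  W_le : e.W ≤ e.X
  two_le : 2 ≤ e.Y
  dim_le_base : e.n ^ E.s * e.n ^ E.s ≤ e.Y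
  card_le_base : e.l.length * e.l.length ≤ e.Y ^ 2
  budget_le : (E.budget (e.l : Instance k e.n) e.γ).natAbs ≤ e.Y ^ 4

/-- The memory holds the input and is bounded. -/
structure Good (σ : Mem) : Prop where
  inp_eq : σ 0 = inp e.l e.γ
  bdd : Bdd e.X σ

variable {e}

lemma Ok.sq_dim_le {E : Split k} (h : e.Ok E) :
    (e.n ^ E.s * e.n ^ E.s) * (e.n ^ E.s * e.n ^ E.s) ≤ e.W := by
  rcases Nat.eq_zero_or_pos (e.n ^ E.s * e.n ^ E.s) with h0 | h0
  · rw [h0]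
    exact Nat.zero_le _
  · exact (Nat.le_mul_of_pos_right _ h0).trans h.dim_le

lemma one_le_unit : 1 ≤ e.unit :=
  Nat.mul_pos (Nat.succ_pos _) (Nat.succ_pos _)

/-- All times are multiples of a common unit, so only coefficients independent of the input need to
be composed. -/
lemma reaches_seq {c d : Program} {σ τ ρ : Mem} {s t U : ℕ} (hU : 1 ≤ U)
    (h : Reaches c σ τ (s * U)) (h' : Reaches d τ ρ (t * U)) :
    Reaches (.seq c d) σ ρ ((s + t + 1) * U) := by
  refine (h.seq h').mono ?_
  nlinarith

lemma reaches_assign {σ : Mem} (h : e.Good σ) (a : ℕ) (f : Expr) {z : ℤ} (hf : f.eval σ = z) :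
    Reaches (assign a f) σ (σ.put a z) ((2 + f.weight) * e.unit) := by
  refine (RandomCSP.reaches_assign h.bdd a f hf).mono (Nat.mul_le_mul_left _ ?_)
  exact Nat.le_mul_of_pos_left _ (Nat.succ_pos _)

lemma Good.put {σ : Mem} (h : e.Good σ) {a : ℕ} (ha : a ≠ 0) {z : ℤ} (hz : z.natAbs ≤ e.X) :
    e.Good (σ.put a z) :=
  ⟨(σ.put_of_ne z ha.symm).trans h.inp_eq, h.bdd.put hz⟩

lemma loop_time_le {m κ : ℕ} (hm : m ≤ e.W) :
    (m + 1) * (κ * (Nat.size e.X + 1)) ≤ κ * e.unit := by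
  rw [unit, mul_left_comm κ]
  exact Nat.mul_le_mul_right _ (Nat.succ_le_succ hm)

end Env

open RandomCSP.Expr

namespace Split

variable {k : ℕ} (E : Split k)

/-- The number of rows of the correlation matrix. -/
abbrev dim (n : ℕ) : ℕ := n ^ E.s * n ^ E.s

/-- The numbering of the rows of the correlation matrix. -/
def rowEquiv (n : ℕ) : (Fin E.s → Fin n) × (Fin E.s → Fin n) ≃ Fin (E.dim n) :=
  (Equiv.prodCongr finFunctionFinEquiv finFunctionFinEquiv).trans finProdFinEquiv

lemma val_rowEquiv {n : ℕ} (u : (Fin E.s → Fin n) × (Fin E.s → Fin n)) :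
    (E.rowEquiv n u : ℕ) = (finFunctionFinEquiv u.2 : Fin (n ^ E.s))
      + n ^ E.s * (finFunctionFinEquiv u.1 : Fin (n ^ E.s)) := rfl

/-- The correlation matrix with numbered rows and columns. -/
def corrFin {n : ℕ} (I : Instance k n) : Matrix (Fin (E.dim n)) (Fin (E.dim n)) ℤ :=
  ((E.triples n).corr I).submatrix (E.rowEquiv n).symm (E.rowEquiv n).symm

/-- The array `f` holds the entries of the matrix `M`. -/
def Holds {d : ℕ} (f : ℕ → ℤ) (M : Matrix (Fin d) (Fin d) ℤ) : Prop :=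
  ∀ a b, f (finProdFinEquiv (a, b) : Fin (d * d)) = M a b

/-- The number of rows. -/
def dimE : Expr := mul (power vars E.s) (power vars E.s)

lemma eval_dimE {n : ℕ} {σ : Mem} {l : List (Constraint k n)} {γ : ℚ} (hσ : σ 0 = inp l γ) :
    E.dimE.eval σ = (E.dim n : ℕ) := by
  simp only [dimE, eval, eval_power, eval_vars hσ]
  push_cast
  rfl

/-- The first index of a pair of constraints, read off the counter. -/
def fstE : Expr := div (var 4) size
/-- The second index of a pair of constraints, read off the counter. -/
def sndE : Expr := mod (var 4) size

/-- The number of a row, given by the two indices. -/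
def rowE (i j : Expr) : Expr :=
  add (code j fun l => E.f (.inl (.inr l)))
    (mul (power vars E.s) (code i fun l => E.f (.inl (.inl l))))

/-- The product of the signs of a constraint. -/
def signE (i : Expr) : Expr :=
  mul (mul (sign i fun l => E.f (.inl (.inl l))) (sign i fun l => E.f (.inl (.inr l))))
    (sign i fun l => E.f (.inr l))

/-- Whether a pair of constraints agrees in the last part of the scope. -/
def agreeE : Expr :=
  eqv (code fstE fun l => E.f (.inr l)) (code sndE fun l => E.f (.inr l))

section Eval

variable {n : ℕ} {σ : Mem} {l : List (Constraint k n)} {γ : ℚ}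

lemma eval_fstE (hσ : σ 0 = inp l γ) {w : ℕ} (hw : σ 4 0 = w) :
    fstE.eval σ = (w / l.length : ℕ) := by
  rw [fstE, eval, eval_size hσ, eval, eval, Int.toNat_zero, hw]
  rfl

lemma eval_sndE (hσ : σ 0 = inp l γ) {w : ℕ} (hw : σ 4 0 = w) :
    sndE.eval σ = (w % l.length : ℕ) := by
  rw [sndE, eval_mod, eval_size hσ, eval, eval, Int.toNat_zero, hw]
  rfl

lemma eval_rowE (hσ : σ 0 = inp l γ) {i j : Expr} {x y : ℕ} (hi : i.eval σ = x)
    (hj : j.eval σ = y) {C C' : Constraint k n} (hC : l[x]? = some C) (hC' : l[y]? = some C') :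
    (E.rowE i j).eval σ
      = (E.rowEquiv n ((E.triples n).a C, (E.triples n).b C') : ℕ) := by
  rw [val_rowEquiv, rowE, eval, eval, eval_power, eval_vars hσ, eval_code hσ hi hC,
    eval_code hσ hj hC']
  push_cast
  rfl

lemma eval_signE (hσ : σ 0 = inp l γ) {i : Expr} {x : ℕ} (hi : i.eval σ = x)
    {C : Constraint k n} (hC : l[x]? = some C) :
    (E.signE i).eval σ = (E.triples n).χ C := by
  rw [signE, eval, eval, eval_sign hσ hi hC, eval_sign hσ hi hC, eval_sign hσ hi hC]
  have h : (E.triples n).χ C = ∏ l, (C.1 (E.f l) : ℤ) := rfl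
  rw [h, Fintype.prod_sum_type, Fintype.prod_sum_type]

lemma eval_agreeE (hσ : σ 0 = inp l γ) {w : ℕ} (hw : σ 4 0 = w) {C C' : Constraint k n}
    (hC : l[w / l.length]? = some C) (hC' : l[w % l.length]? = some C') :
    E.agreeE.eval σ = if (E.triples n).i C = (E.triples n).i C' then 1 else 0 := by
  rw [agreeE, eval_eqv, eval_code hσ (eval_fstE hσ hw) hC, eval_code hσ (eval_sndE hσ hw) hC']
  refine if_congr ?_ rfl rfl
  rw [Nat.cast_inj, Fin.val_inj, finFunctionFinEquiv.apply_eq_iff_eq]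
  rfl

end Eval

/-- The program that computes the correlation matrix. -/
def corrProg : Program :=
  .seq (mapLoop 4 (mul E.dimE E.dimE) 2 (lit 0))
    (accLoop 4 (mul size size) 2 (add (E.rowE sndE fstE) (mul E.dimE (E.rowE fstE sndE)))
      (mul (mul E.agreeE (sub (lit 1) (eqv (E.rowE fstE sndE) (E.rowE sndE fstE))))
        (mul (E.signE fstE) (E.signE sndE))))

/-- The program that computes the diagonal weight. -/
def diagProg : Program :=
  .seq (assign 5 (lit 0))
    (accLoop 4 (mul size size) 5 (lit 0)
      (mul (mul E.agreeE (eqv (E.rowE fstE sndE) (E.rowE sndE fstE)))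
        (mul (E.signE fstE) (E.signE sndE))))

lemma natAbs_χ {n : ℕ} (C : Constraint k n) : ((E.triples n).χ C).natAbs = 1 := by
  rcases E.χ_eq_one_or C with h | h <;> simp [h]

lemma exists_getElem?_div_mod {Ω : Type*} {l : List Ω} {w : ℕ} (hw : w < l.length * l.length) :
    ∃ C C', l[w / l.length]? = some C ∧ l[w % l.length]? = some C' := by
  have hpos : 0 < l.length := by
    by_contra h0
    obtain h0 : l.length = 0 := by omega
    simp [h0] at hw
  exact ⟨_, _, List.getElem?_eq_getElem (Nat.div_lt_of_lt_mul hw),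
    List.getElem?_eq_getElem (Nat.mod_lt _ hpos)⟩

/-- The function of a pair of list entries that the counter encodes. -/
def ofPair {Ω M : Type*} [Zero M] (l : List Ω) (f : Ω → Ω → M) (w : ℕ) : M :=
  (l[w / l.length]?).elim 0 fun C => (l[w % l.length]?).elim 0 fun C' => f C C'

lemma ofPair_eq {Ω M : Type*} [Zero M] {l : List Ω} (f : Ω → Ω → M) {w : ℕ} {C C' : Ω}
    (hC : l[w / l.length]? = some C) (hC' : l[w % l.length]? = some C') :
    ofPair l f w = f C C' := by
  rw [ofPair, hC, hC']
  rfl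

lemma reaches_corrProg : ∃ κ, ∀ (e : Env k) (σ : Mem), e.Ok E → e.Good σ →
    ∃ τ, Reaches E.corrProg σ τ (κ * e.unit) ∧ e.Good τ ∧
      (∀ a, a ≠ 2 → a ≠ 4 → τ a = σ a) ∧ Holds (τ 2) (E.corrFin (e.l : Instance k e.n)) ∧
      ∀ i < E.dim e.n * E.dim e.n, (τ 2 i).natAbs ≤ e.l.length * e.l.length := by
  -- The coefficient `κ` is left to unification; it is read off the weights of the fixed expressions
  -- and cannot depend on the input.
  apply Exists.intro
  intro e σ hE hσ
  have h24 : (2 : ℕ) ≠ 4 := by norm_num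
  have hm := hE.card_le
  have hd := hE.sq_dim_le
  have hW := hE.W_le
  set m := e.l.length with hm'
  set N := E.dim e.n with hN
  have h1 := reaches_mapLoop hσ.bdd (c := 4) (a := 2) (e := mul E.dimE E.dimE) (v := lit 0)
    (m := N * N) (V := fun _ => 0) h24 (hd.trans hW)
    (fun w _ f => by
      rw [eval, E.eval_dimE (l := e.l) (γ := e.γ)
        ((σ.at_of_ne w f (by norm_num) (by norm_num)).trans hσ.inp_eq)]
      push_cast
      rfl) (fun _ _ _ => rfl) (by simp)
  set σ₁ := σ.at 4 (N * N) 2 (fun j => if j < N * N then 0 else σ 2 j) with hσ₁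
  have hσ₁0 : σ₁ 0 = inp e.l e.γ :=
    (σ.at_of_ne _ _ (by norm_num) (by norm_num)).trans hσ.inp_eq
  have hσ₁2 : σ₁ 2 = fun j => if j < N * N then 0 else σ 2 j := σ.at_self ..
  have hb₁ : Bdd e.X σ₁ := by
    refine (hσ.bdd.put ((Int.natAbs_natCast _).le.trans (hd.trans hW))).update fun i => ?_
    split_ifs
    · simp
    · exact hσ.bdd 2 i
  -- Column plus `N` times row, which is definitionally `finProdFinEquiv`.
  set idx : Constraint k e.n → Constraint k e.n → ℕ := fun C C' =>
    (E.rowEquiv e.n ((E.triples e.n).a C', (E.triples e.n).b C) : ℕ)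
      + N * (E.rowEquiv e.n ((E.triples e.n).a C, (E.triples e.n).b C') : ℕ) with hidx
  set val : Constraint k e.n → Constraint k e.n → ℤ := fun C C' =>
    (if (E.triples e.n).i C = (E.triples e.n).i C' then 1 else 0)
      * (1 - if (E.rowEquiv e.n ((E.triples e.n).a C, (E.triples e.n).b C') : ℕ)
        = (E.rowEquiv e.n ((E.triples e.n).a C', (E.triples e.n).b C) : ℕ) then 1 else 0)
      * ((E.triples e.n).χ C * (E.triples e.n).χ C') with hval
  have hidx_lt : ∀ C C', idx C C' < N * N := by
    intro C C'
    exact (finProdFinEquiv (E.rowEquiv e.n ((E.triples e.n).a C, (E.triples e.n).b C'),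
      E.rowEquiv e.n ((E.triples e.n).a C', (E.triples e.n).b C)) : Fin (N * N)).2
  have hval_le : ∀ C C', (val C C').natAbs ≤ 1 := by
    intro C C'
    simp only [hval, Int.natAbs_mul, natAbs_χ]
    split_ifs <;> simp
  have hat0 : ∀ w f, (σ₁.at 4 w 2 f) 0 = inp e.l e.γ := fun w f =>
    (σ₁.at_of_ne w f (by norm_num) (by norm_num)).trans hσ₁0
  have hat4 : ∀ w f, (σ₁.at 4 w 2 f) 4 0 = w := fun w f => σ₁.at_counter w f h24
  have hV_le : ∀ w, (ofPair e.l val w).natAbs ≤ 1 := by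
    intro w
    rw [ofPair]
    cases e.l[w / e.l.length]? with
    | none => simp
    | some C =>
      cases e.l[w % e.l.length]? with
      | none => simp
      | some C' => exact hval_le C C'
  have hsum_le : ∀ w ≤ m * m, ∀ j, (∑ w' ∈ Finset.range w,
      if ofPair e.l idx w' = j then ofPair e.l val w' else 0).natAbs ≤ m * m := fun w hw j =>
    (natAbs_sum_ite_le _ fun w' _ => hV_le w').trans (by simpa using hw)
  have hX : ∀ w ≤ m * m, ∀ j, (σ₁ 2 j + ∑ w' ∈ Finset.range w,
      if ofPair e.l idx w' = j then ofPair e.l val w' else 0).natAbs ≤ e.X := by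
    intro w hw j
    rw [hσ₁2]
    dsimp only
    split_ifs with hj
    · rw [zero_add]
      exact (hsum_le w hw j).trans (hm.trans hW)
    -- Cells beyond the matrix may hold remnants of earlier tests; they are never touched and keep
    -- their old bound.
    · rw [Finset.sum_eq_zero, add_zero]
      · exact hσ.bdd 2 j
      · intro w' hw'
        obtain ⟨C, C', hC, hC'⟩ := exists_getElem?_div_mod
          (l := e.l) ((Finset.mem_range.1 hw').trans_le hw)
        rw [ofPair_eq _ hC hC', if_neg]
        intro h
        exact hj (h ▸ hidx_lt C C')
  have h2 := reaches_accLoop hb₁ (c := 4) (a := 2) (e := mul size size)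
    (i := add (E.rowE sndE fstE) (mul E.dimE (E.rowE fstE sndE)))
    (v := mul (mul E.agreeE (sub (lit 1) (eqv (E.rowE fstE sndE) (E.rowE sndE fstE))))
        (mul (E.signE fstE) (E.signE sndE)))
    (m := m * m) (I := ofPair e.l idx) (V := ofPair e.l val) h24 (hm.trans hW)
    (fun w _ f => by
      rw [eval, eval_size (hat0 w f)]
      push_cast
      rfl)
    (fun w hw f => by
      obtain ⟨C, C', hC, hC'⟩ := exists_getElem?_div_mod hw
      rw [ofPair_eq _ hC hC', eval, eval,
        E.eval_rowE (hat0 w f) (eval_sndE (hat0 w f) (hat4 w f))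
          (eval_fstE (hat0 w f) (hat4 w f)) hC' hC,
        E.eval_rowE (hat0 w f) (eval_fstE (hat0 w f) (hat4 w f))
          (eval_sndE (hat0 w f) (hat4 w f)) hC hC', E.eval_dimE (hat0 w f), ← Nat.cast_mul,
        ← Nat.cast_add, Int.toNat_natCast])
    (fun w hw f => by
      obtain ⟨C, C', hC, hC'⟩ := exists_getElem?_div_mod hw
      have e1 := E.eval_rowE (hat0 w f) (eval_sndE (hat0 w f) (hat4 w f))
          (eval_fstE (hat0 w f) (hat4 w f)) hC' hC
      have e2 := E.eval_rowE (hat0 w f) (eval_fstE (hat0 w f) (hat4 w f))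
          (eval_sndE (hat0 w f) (hat4 w f)) hC hC'
      rw [ofPair_eq _ hC hC']
      simp only [eval, eval_eqv, e1, e2, E.eval_agreeE (hat0 w f) (hat4 w f) hC hC',
        E.eval_signE (hat0 w f) (eval_fstE (hat0 w f) (hat4 w f)) hC,
        E.eval_signE (hat0 w f) (eval_sndE (hat0 w f) (hat4 w f)) hC', hval, Nat.cast_inj])
    hX
  refine ⟨_, Env.reaches_seq e.one_le_unit (h1.mono (e.loop_time_le hd)) (h2.mono (e.loop_time_le hm)),
    ⟨hat0 _ _, ?_⟩, fun a ha2 ha4 => ?_, ?_, ?_⟩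
  · exact (hb₁.put ((Int.natAbs_natCast _).le.trans (hm.trans hW))).update (hX (m * m) le_rfl)
  · rw [σ₁.at_of_ne _ _ ha2 ha4, hσ₁, σ.at_of_ne _ _ ha2 ha4]
  · rw [Mem.at_self]
    intro a b
    have hlt : (finProdFinEquiv (a, b) : Fin (N * N)).val < N * N := Fin.is_lt _
    rw [hσ₁2]
    dsimp only
    rw [if_pos hlt, zero_add, sum_pairs_eq e.l (fun C C' =>
      if idx C C' = (finProdFinEquiv (a, b) : Fin (N * N)).val then val C C' else 0)
      fun w C C' hC hC' => by rw [ofPair_eq _ hC hC', ofPair_eq _ hC hC']]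
    rw [corrFin, Matrix.submatrix_apply, SignedTriples.corr]
    simp only [Multiset.map_coe, Multiset.sum_coe]
    congr 1
    refine List.map_congr_left fun C _ => ?_
    congr 1
    refine List.map_congr_left fun C' _ => ?_
    have hiff : idx C C' = (finProdFinEquiv (a, b) : Fin (N * N)).val ↔
        ((E.triples e.n).a C, (E.triples e.n).b C') = (E.rowEquiv e.n).symm a ∧
        ((E.triples e.n).a C', (E.triples e.n).b C) = (E.rowEquiv e.n).symm b := by
      have : idx C C' = (finProdFinEquiv
          (E.rowEquiv e.n ((E.triples e.n).a C, (E.triples e.n).b C'),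
            E.rowEquiv e.n ((E.triples e.n).a C', (E.triples e.n).b C)) : Fin (N * N)).val := rfl
      rw [this, Fin.val_inj, finProdFinEquiv.apply_eq_iff_eq, Prod.mk_inj,
        Equiv.eq_symm_apply, Equiv.eq_symm_apply]
    by_cases h : idx C C' = (finProdFinEquiv (a, b) : Fin (N * N)).val
    · rw [if_pos h]
      obtain ⟨ha, hb⟩ := hiff.1 h
      simp only [hval, ha, hb, Equiv.apply_symm_apply, Fin.val_inj, true_and]
      by_cases hab : a = b
      · simp [hab]
      · simp [hab]
    · rw [if_neg h, if_neg fun h' => h (hiff.2 ⟨h'.2.1, h'.2.2.1⟩)]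
  · intro i hi
    rw [Mem.at_self, hσ₁2]
    dsimp only
    rw [if_pos hi, zero_add]
    exact hsum_le _ le_rfl i

end Split

end RandomCSP

/-! ### Programs for the diagonal weight and for squaring the matrix -/

namespace RandomCSP

open RandomCSP.Expr

namespace Split

variable {k : ℕ} (E : Split k)

/-- A pair of constraints agrees in both halves exactly when its crossed row and column numbers
coincide, so the expressions of the correlation program can be reused. -/
lemma reaches_diagProg : ∃ κ, ∀ (e : Env k) (σ : Mem), e.Ok E → e.Good σ →
    ∃ τ, Reaches E.diagProg σ τ (κ * e.unit) ∧ e.Good τ ∧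
      (∀ a, a ≠ 5 → a ≠ 4 → τ a = σ a) ∧ τ 5 0 = (E.triples e.n).diag (e.l : Instance k e.n) := by
  apply Exists.intro
  intro e σ hE hσ
  have h54 : (5 : ℕ) ≠ 4 := by norm_num
  have hm := hE.card_le
  have hW := hE.W_le
  set m := e.l.length with hm'
  have h1 := Env.reaches_assign hσ 5 (lit 0) (z := 0) rfl
  set σ₁ := σ.put 5 0 with hσ₁
  have hG₁ : e.Good σ₁ := hσ.put (by norm_num) (by simp)
  set val : Constraint k e.n → Constraint k e.n → ℤ := fun C C' =>
    (if (E.triples e.n).i C = (E.triples e.n).i C' then 1 else 0)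
      * (if (E.rowEquiv e.n ((E.triples e.n).a C, (E.triples e.n).b C') : ℕ)
        = (E.rowEquiv e.n ((E.triples e.n).a C', (E.triples e.n).b C) : ℕ) then 1 else 0)
      * ((E.triples e.n).χ C * (E.triples e.n).χ C') with hval
  have hval_le : ∀ C C', (val C C').natAbs ≤ 1 := by
    intro C C'
    simp only [hval, Int.natAbs_mul, natAbs_χ]
    split_ifs <;> simp
  have hat0 : ∀ w f, (σ₁.at 4 w 5 f) 0 = inp e.l e.γ := fun w f =>
    (σ₁.at_of_ne w f (by norm_num) (by norm_num)).trans hG₁.inp_eq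
  have hat4 : ∀ w f, (σ₁.at 4 w 5 f) 4 0 = w := fun w f => σ₁.at_counter w f h54
  have hV_le : ∀ w, (ofPair e.l val w).natAbs ≤ 1 := by
    intro w
    rw [ofPair]
    cases e.l[w / e.l.length]? with
    | none => simp
    | some C =>
      cases e.l[w % e.l.length]? with
      | none => simp
      | some C' => exact hval_le C C'
  have hsum_le : ∀ w ≤ m * m, ∀ j, (∑ w' ∈ Finset.range w,
      if 0 = j then ofPair e.l val w' else 0).natAbs ≤ m * m := fun w hw j =>
    (natAbs_sum_ite_le _ fun w' _ => hV_le w').trans (by simpa using hw)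
  have h50 : σ₁ 5 0 = 0 := by rw [hσ₁, Mem.put_self, Function.update_self]
  have hX : ∀ w ≤ m * m, ∀ j, (σ₁ 5 j + ∑ w' ∈ Finset.range w,
      if 0 = j then ofPair e.l val w' else 0).natAbs ≤ e.X := by
    intro w hw j
    rcases eq_or_ne 0 j with rfl | hj
    · rw [h50, zero_add]
      exact (hsum_le w hw 0).trans (hm.trans hW)
    · simp only [if_neg hj, Finset.sum_const_zero, add_zero]
      exact hG₁.bdd 5 j
  have h2 := reaches_accLoop hG₁.bdd (c := 4) (a := 5) (e := mul size size) (i := lit 0)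
    (v := mul (mul E.agreeE (eqv (E.rowE fstE sndE) (E.rowE sndE fstE)))
        (mul (E.signE fstE) (E.signE sndE)))
    (m := m * m) (I := fun _ => 0) (V := ofPair e.l val) h54 (hm.trans hW)
    (fun w _ f => by
      rw [eval, eval_size (hat0 w f)]
      push_cast
      rfl)
    (fun _ _ _ => rfl)
    (fun w hw f => by
      obtain ⟨C, C', hC, hC'⟩ := exists_getElem?_div_mod hw
      have e1 := E.eval_rowE (hat0 w f) (eval_sndE (hat0 w f) (hat4 w f))
          (eval_fstE (hat0 w f) (hat4 w f)) hC' hC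
      have e2 := E.eval_rowE (hat0 w f) (eval_fstE (hat0 w f) (hat4 w f))
          (eval_sndE (hat0 w f) (hat4 w f)) hC hC'
      rw [ofPair_eq _ hC hC']
      simp only [eval, eval_eqv, e1, e2, E.eval_agreeE (hat0 w f) (hat4 w f) hC hC',
        E.eval_signE (hat0 w f) (eval_fstE (hat0 w f) (hat4 w f)) hC,
        E.eval_signE (hat0 w f) (eval_sndE (hat0 w f) (hat4 w f)) hC', hval, Nat.cast_inj])
    hX
  refine ⟨_, Env.reaches_seq e.one_le_unit h1 (h2.mono (e.loop_time_le hm)),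
    ⟨hat0 _ _, ?_⟩, fun a ha5 ha4 => ?_, ?_⟩
  · exact (hG₁.bdd.put ((Int.natAbs_natCast _).le.trans (hm.trans hW))).update (hX (m * m) le_rfl)
  · rw [σ₁.at_of_ne _ _ ha5 ha4, hσ₁, σ.put_of_ne _ ha5]
  · rw [Mem.at_self]
    simp only [h50, zero_add, if_true]
    rw [sum_pairs_eq e.l val fun w C C' hC hC' => ofPair_eq _ hC hC', SignedTriples.diag]
    simp only [Multiset.map_coe, Multiset.sum_coe]
    congr 1
    refine List.map_congr_left fun C _ => ?_
    congr 1
    refine List.map_congr_left fun C' _ => ?_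
    simp only [hval, Fin.val_inj, (E.rowEquiv e.n).apply_eq_iff_eq, Prod.mk_inj]
    by_cases hi : (E.triples e.n).i C = (E.triples e.n).i C' <;>
      by_cases ha : (E.triples e.n).a C = (E.triples e.n).a C' <;>
      by_cases hb : (E.triples e.n).b C = (E.triples e.n).b C' <;> simp [hi, ha, hb, eq_comm]

/-- The counter without its last digit. -/
def prefE : Expr := div (var 4) E.dimE

/-- The last digit of the counter. -/
def lastE : Expr := mod (var 4) E.dimE

/-- The program that squares the matrix in array `2`. -/
def squareProg : Program :=
  .seq (mapLoop 4 (mul E.dimE E.dimE) 3 (lit 0))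
    (.seq (accLoop 4 (mul (mul E.dimE E.dimE) E.dimE) 3 E.prefE
        (mul (get 2 (add E.lastE (mul E.dimE (div E.prefE E.dimE))))
          (get 2 (add (mod E.prefE E.dimE) (mul E.dimE E.lastE)))))
      (mapLoop 4 (mul E.dimE E.dimE) 2 (get 3 (var 4))))

/-- The counter below `N ^ 3` splits into the target cell (quotient by `N`) and the summation index
(remainder). The product is built in array `3` and copied back. The number of all iterations serves
as a crude bound on the number of terms per cell. -/
lemma reaches_squareProg : ∃ κ, ∀ (e : Env k) (σ : Mem), e.Ok E → e.Good σ →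
    ∀ (M : Matrix (Fin (E.dim e.n)) (Fin (E.dim e.n)) ℤ) (G : ℕ), Holds (σ 2) M →
    (∀ i < E.dim e.n * E.dim e.n, (σ 2 i).natAbs ≤ G) →
    E.dim e.n * E.dim e.n * E.dim e.n * G ^ 2 ≤ e.X →
    ∃ τ, Reaches E.squareProg σ τ (κ * e.unit) ∧ e.Good τ ∧
      (∀ a, a ≠ 2 → a ≠ 3 → a ≠ 4 → τ a = σ a) ∧ Holds (τ 2) (M * M) ∧
      ∀ i < E.dim e.n * E.dim e.n,
        (τ 2 i).natAbs ≤ E.dim e.n * E.dim e.n * E.dim e.n * G ^ 2 := by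
  apply Exists.intro
  intro e σ hE hσ M G hM hG hGX
  have h34 : (3 : ℕ) ≠ 4 := by norm_num
  have h24 : (2 : ℕ) ≠ 4 := by norm_num
  have hd := hE.sq_dim_le
  have hd3 := hE.dim_le
  have hW := hE.W_le
  set N := E.dim e.n with hN
  have h1 := reaches_mapLoop hσ.bdd (c := 4) (a := 3) (e := mul E.dimE E.dimE) (v := lit 0)
    (m := N * N) (V := fun _ => 0) h34 (hd.trans hW)
    (fun w _ f => by
      rw [eval, E.eval_dimE (l := e.l) (γ := e.γ)
        ((σ.at_of_ne w f (by norm_num) (by norm_num)).trans hσ.inp_eq)]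
      push_cast
      rfl) (fun _ _ _ => rfl) (by simp)
  set σ₁ := σ.at 4 (N * N) 3 (fun j => if j < N * N then 0 else σ 3 j) with hσ₁
  have hσ₁0 : σ₁ 0 = inp e.l e.γ :=
    (σ.at_of_ne _ _ (by norm_num) (by norm_num)).trans hσ.inp_eq
  have hσ₁2 : σ₁ 2 = σ 2 := σ.at_of_ne _ _ (by norm_num) (by norm_num)
  have hσ₁3 : σ₁ 3 = fun j => if j < N * N then 0 else σ 3 j := σ.at_self ..
  have hb₁ : Bdd e.X σ₁ := by
    refine (hσ.bdd.put ((Int.natAbs_natCast _).le.trans (hd.trans hW))).update fun i => ?_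
    split_ifs
    · simp
    · exact hσ.bdd 3 i
  set val : ℕ → ℕ → ℤ := fun j x => σ 2 (x + N * (j / N)) * σ 2 (j % N + N * x) with hval
  have hat0 : ∀ w f, (σ₁.at 4 w 3 f) 0 = inp e.l e.γ := fun w f =>
    (σ₁.at_of_ne w f (by norm_num) (by norm_num)).trans hσ₁0
  have hat2 : ∀ w f, (σ₁.at 4 w 3 f) 2 = σ 2 := fun w f =>
    (σ₁.at_of_ne w f (by norm_num) (by norm_num)).trans hσ₁2
  have hat4 : ∀ w f, (σ₁.at 4 w 3 f) 4 0 = w := fun w f => σ₁.at_counter w f h34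
  have hvar : ∀ w f, (var 4).eval (σ₁.at 4 w 3 f) = w := fun w f => hat4 w f
  have hpref : ∀ w f, E.prefE.eval (σ₁.at 4 w 3 f) = (w / N : ℕ) := fun w f => by
    rw [prefE, eval, hvar, E.eval_dimE (hat0 w f)]
    rfl
  have hlast : ∀ w f, E.lastE.eval (σ₁.at 4 w 3 f) = (w % N : ℕ) := fun w f => by
    rw [lastE, eval_mod, hvar, E.eval_dimE (hat0 w f)]
    rfl
  have hcell : ∀ a < N, ∀ b < N, b + N * a < N * N := by
    intro a ha b hb
    have : N * a + N ≤ N * N := by rw [← Nat.mul_succ]; exact Nat.mul_le_mul_left _ ha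
    omega
  have hval_le : ∀ w < N * N * N, (val (w / N) (w % N)).natAbs ≤ G ^ 2 := by
    intro w hw
    have hpos : 0 < N := by
      by_contra h0
      obtain h0 : N = 0 := by omega
      simp [h0] at hw
    have hj : w / N < N * N := Nat.div_lt_of_lt_mul (by rwa [mul_comm])
    have hx := Nat.mod_lt w hpos
    have hj1 : w / N / N < N := Nat.div_lt_of_lt_mul hj
    have hj2 := Nat.mod_lt (w / N) hpos
    rw [hval, Int.natAbs_mul, sq]
    exact Nat.mul_le_mul (hG _ (hcell _ hj1 _ hx)) (hG _ (hcell _ hx _ hj2))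
  have hsum_le : ∀ w ≤ N * N * N, ∀ j, (∑ w' ∈ Finset.range w,
      if w' / N = j then val (w' / N) (w' % N) else 0).natAbs ≤ N * N * N * G ^ 2 := fun w hw j =>
    (natAbs_sum_ite_le _ fun w' hw' => hval_le w' (hw'.trans_le hw)).trans
      (Nat.mul_le_mul_right _ hw)
  have hX : ∀ w ≤ N * N * N, ∀ j, (σ₁ 3 j + ∑ w' ∈ Finset.range w,
      if w' / N = j then val (w' / N) (w' % N) else 0).natAbs ≤ e.X := by
    intro w hw j
    rw [hσ₁3]
    dsimp only
    split_ifs with hj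
    · rw [zero_add]
      exact (hsum_le w hw j).trans hGX
    · rw [Finset.sum_eq_zero, add_zero]
      · exact hσ.bdd 3 j
      · intro w' hw'
        rw [if_neg]
        rintro rfl
        exact hj (Nat.div_lt_of_lt_mul
          (by rw [mul_comm]; exact (Finset.mem_range.1 hw').trans_le hw))
  have h2 := reaches_accLoop hb₁ (c := 4) (a := 3) (e := mul (mul E.dimE E.dimE) E.dimE)
    (i := E.prefE) (v := mul (get 2 (add E.lastE (mul E.dimE (div E.prefE E.dimE))))
          (get 2 (add (mod E.prefE E.dimE) (mul E.dimE E.lastE))))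
    (m := N * N * N) (I := fun w => w / N) (V := fun w => val (w / N) (w % N)) h34
    (hd3.trans hW)
    (fun w _ f => by
      rw [eval, eval, E.eval_dimE (hat0 w f)]
      push_cast
      rfl)
    (fun w _ f => by rw [hpref, Int.toNat_natCast])
    (fun w _ f => by
      simp only [eval, eval_mod, hpref, hlast, E.eval_dimE (hat0 w f), hat2]
      rfl)
    hX
  set f₂ : ℕ → ℤ := fun j => σ₁ 3 j + ∑ w ∈ Finset.range (N * N * N),
    if w / N = j then val (w / N) (w % N) else 0 with hf₂
  set σ₂ := σ₁.at 4 (N * N * N) 3 f₂ with hσ₂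
  have hb₂ : Bdd e.X σ₂ :=
    (hb₁.put ((Int.natAbs_natCast _).le.trans (hd3.trans hW))).update (hX _ le_rfl)
  have h3 := reaches_mapLoop hb₂ (c := 4) (a := 2) (e := mul E.dimE E.dimE) (v := get 3 (var 4))
    (m := N * N) (V := f₂) h24 (hd.trans hW)
    (fun w _ f => by
      rw [eval, E.eval_dimE (l := e.l) (γ := e.γ)
        ((σ₂.at_of_ne w f (by norm_num) (by norm_num)).trans (hat0 _ _))]
      push_cast
      rfl)
    (fun w _ f => by
      rw [eval, eval, eval, Int.toNat_zero, σ₂.at_counter _ _ h24, Int.toNat_natCast,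
        σ₂.at_of_ne _ _ (by norm_num) (by norm_num), hσ₂, Mem.at_self])
    (fun w _ => hX _ le_rfl w)
  refine ⟨_, Env.reaches_seq e.one_le_unit (h1.mono (e.loop_time_le hd))
    (Env.reaches_seq e.one_le_unit (h2.mono (e.loop_time_le hd3)) (h3.mono (e.loop_time_le hd))),
    ⟨(σ₂.at_of_ne _ _ (by norm_num) (by norm_num)).trans (hat0 _ _), ?_⟩,
    fun a ha2 ha3 ha4 => ?_, ?_, ?_⟩
  · refine (hb₂.put ((Int.natAbs_natCast _).le.trans (hd.trans hW))).update fun i => ?_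
    split_ifs
    · exact hX _ le_rfl i
    · exact hb₂ 2 i
  · rw [σ₂.at_of_ne _ _ ha2 ha4, hσ₂, σ₁.at_of_ne _ _ ha3 ha4, hσ₁, σ.at_of_ne _ _ ha3 ha4]
  · rw [Mem.at_self]
    intro a b
    have hlt : (finProdFinEquiv (a, b) : Fin (N * N)).val < N * N := Fin.is_lt _
    dsimp only
    rw [if_pos hlt, hf₂]
    dsimp only
    rw [hσ₁3]
    dsimp only
    rw [if_pos hlt, zero_add, sum_range_div_mod
      (fun i x => if i = (finProdFinEquiv (a, b) : Fin (N * N)).val then val i x else 0),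
      Finset.sum_comm]
    simp only [Finset.sum_ite_eq', Finset.mem_range, hlt, if_true]
    rw [Matrix.mul_apply, Finset.sum_range]
    refine Finset.sum_congr rfl fun x _ => ?_
    have hpos : 0 < N := Nat.lt_of_le_of_lt (Nat.zero_le _) a.2
    have hv : (finProdFinEquiv (a, b) : Fin (N * N)).val = b + N * a := rfl
    rw [← hM a x, ← hM x b, hval, hv]
    dsimp only
    rw [Nat.add_mul_div_left _ _ hpos, Nat.div_eq_of_lt b.2, zero_add, Nat.add_mul_mod_self_left,
      Nat.mod_eq_of_lt b.2]
    rfl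
  · intro i hi
    rw [Mem.at_self]
    rw [if_pos hi, hf₂]
    dsimp only
    rw [hσ₁3]
    dsimp only
    rw [if_pos hi, zero_add]
    exact hsum_le _ le_rfl i

end Split

end RandomCSP

/-! ### The program for one test: repeated squaring and comparison -/

namespace RandomCSP

open RandomCSP.Expr

lemma Env.le_X {k : ℕ} {e : Env k} (hY : 2 ≤ e.Y) {q j : ℕ} (hq : q ≤ 12 * 2 ^ j)
    (hj : j ≤ rounds e.n) {x : ℕ} (hx : x ≤ e.Y ^ q) : x ≤ e.X :=
  hx.trans (Nat.pow_le_pow_right (by omega)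
    (hq.trans (Nat.mul_le_mul_left _ (Nat.pow_le_pow_right two_pos hj))))

namespace Split

variable {k : ℕ} (E : Split k)

/-- The memory after `j` squarings. -/
structure Inv (e : Env k) (j : ℕ) (σ : Mem) : Prop where
  good : e.Good σ
  z_eq : σ 6 0 = ((2 ^ 2 ^ j : ℕ) : ℤ)
  dim_eq : σ 7 0 = ((E.dim e.n) ^ 2 ^ j : ℕ)
  budget_eq : σ 8 0 = E.budget (e.l : Instance k e.n) e.γ ^ 2 ^ j
  holds : Holds (σ 2) (E.corrFin (e.l : Instance k e.n) ^ 2 ^ j)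
  entry_le : ∀ i < E.dim e.n * E.dim e.n, (σ 2 i).natAbs ≤ e.Y ^ (5 * 2 ^ j - 3)

/-- One squaring of all quantities. -/
def roundProg : Program :=
  .seq E.squareProg (.seq (assign 6 (mul (var 6) (var 6)))
    (.seq (assign 7 (mul (var 7) (var 7))) (assign 8 (mul (var 8) (var 8)))))

/-- The exponents `5 * 2 ^ j - 3` in the bound on entries start at `2` and satisfy `x ↦ 2 * x + 3`,
the `3` accounting for the cube of the dimension. -/
lemma reaches_roundProg : ∃ κ, ∀ (e : Env k) (σ : Mem) (j : ℕ), e.Ok E → E.Inv e j σ →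
    j < rounds e.n →
    ∃ τ, Reaches E.roundProg σ τ (κ * e.unit) ∧ E.Inv e (j + 1) τ ∧ τ 1 = σ 1 := by
  obtain ⟨κ, hκ⟩ := E.reaches_squareProg
  apply Exists.intro
  intro e σ j hE hσ hj
  have hY := hE.two_le
  have hj2 : 1 ≤ 2 ^ j := Nat.one_le_two_pow
  have hG : E.dim e.n * E.dim e.n * E.dim e.n * (e.Y ^ (5 * 2 ^ j - 3)) ^ 2
      ≤ e.Y ^ (5 * 2 ^ (j + 1) - 3) := by
    have h1 : E.dim e.n * E.dim e.n * E.dim e.n ≤ e.Y ^ 3 := by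
      rw [pow_succ, sq]
      exact Nat.mul_le_mul (Nat.mul_le_mul hE.dim_le_base hE.dim_le_base) hE.dim_le_base
    refine (Nat.mul_le_mul_right _ h1).trans (le_of_eq ?_)
    rw [← pow_mul, ← pow_add]
    congr 1
    rw [pow_succ]
    omega
  obtain ⟨τ, hτ, hgood, hframe, hholds, hentry⟩ := hκ e σ hE hσ.good _ _ hσ.holds hσ.entry_le
    (Env.le_X hY (j := j + 1) (by omega) hj hG)
  have hsq : ∀ x : ℕ, x ^ 2 ^ j * x ^ 2 ^ j = x ^ 2 ^ (j + 1) := fun x => by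
    rw [← pow_add, ← two_mul, pow_succ' 2 j]
  have hsqz : ∀ x : ℤ, x ^ 2 ^ j * x ^ 2 ^ j = x ^ 2 ^ (j + 1) := fun x => by
    rw [← pow_add, ← two_mul, pow_succ' 2 j]
  have hle : ∀ (x q : ℕ), x ≤ e.Y ^ q → q ≤ 4 → x ^ 2 ^ (j + 1) ≤ e.X := by
    intro x q hx hq
    refine Env.le_X hY (q := q * 2 ^ (j + 1)) (j := j + 1) ?_ hj ?_
    · exact Nat.mul_le_mul_right _ (by omega)
    · rw [pow_mul]
      exact Nat.pow_le_pow_left hx _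
  have h6 := Env.reaches_assign hgood 6 (mul (var 6) (var 6)) (z := ((2 ^ 2 ^ (j + 1) : ℕ) : ℤ)) (by
    rw [← hsq, Nat.cast_mul, ← hσ.z_eq, ← hframe 6 (by norm_num) (by norm_num) (by norm_num)]
    rfl)
  have hg6 := hgood.put (a := 6) (by norm_num) (z := ((2 ^ 2 ^ (j + 1) : ℕ) : ℤ))
    ((Int.natAbs_natCast _).le.trans (hle 2 1 (by simpa using hY) (by norm_num)))
  set τ₆ := τ.put 6 ((2 ^ 2 ^ (j + 1) : ℕ) : ℤ) with hτ₆
  have h7 := Env.reaches_assign hg6 7 (mul (var 7) (var 7))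
    (z := (((E.dim e.n) ^ 2 ^ (j + 1) : ℕ) : ℤ)) (by
    rw [← hsq, Nat.cast_mul, ← hσ.dim_eq, ← hframe 7 (by norm_num) (by norm_num) (by norm_num),
      ← τ.put_of_ne ((2 ^ 2 ^ (j + 1) : ℕ) : ℤ) (show 7 ≠ 6 by norm_num)]
    rfl)
  have hg7 := hg6.put (a := 7) (by norm_num) (z := (((E.dim e.n) ^ 2 ^ (j + 1) : ℕ) : ℤ))
    ((Int.natAbs_natCast _).le.trans
      (hle _ 1 (by simpa using hE.dim_le_base) (by norm_num)))
  set τ₇ := τ₆.put 7 (((E.dim e.n) ^ 2 ^ (j + 1) : ℕ) : ℤ) with hτ₇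
  have h8 := Env.reaches_assign hg7 8 (mul (var 8) (var 8))
    (z := E.budget (e.l : Instance k e.n) e.γ ^ 2 ^ (j + 1)) (by
    rw [← hsqz, ← hσ.budget_eq, ← hframe 8 (by norm_num) (by norm_num) (by norm_num),
      ← τ.put_of_ne ((2 ^ 2 ^ (j + 1) : ℕ) : ℤ) (show 8 ≠ 6 by norm_num), ← hτ₆,
      ← τ₆.put_of_ne (((E.dim e.n) ^ 2 ^ (j + 1) : ℕ) : ℤ) (show 8 ≠ 7 by norm_num)]
    rfl)
  have hg8 := hg7.put (a := 8) (by norm_num)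
    (z := E.budget (e.l : Instance k e.n) e.γ ^ 2 ^ (j + 1))
    (by rw [Int.natAbs_pow]; exact hle _ 4 hE.budget_le le_rfl)
  have h2 : ∀ a, a ≠ 6 → a ≠ 7 → a ≠ 8 →
      τ₇.put 8 (E.budget (e.l : Instance k e.n) e.γ ^ 2 ^ (j + 1)) a = τ a := by
    intro a ha6 ha7 ha8
    rw [Mem.put_of_ne _ _ ha8, hτ₇, Mem.put_of_ne _ _ ha7, hτ₆, Mem.put_of_ne _ _ ha6]
  refine ⟨_, Env.reaches_seq e.one_le_unit hτ (Env.reaches_seq e.one_le_unit h6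
    (Env.reaches_seq e.one_le_unit h7 h8)), ⟨hg8, ?_, ?_, ?_, ?_, ?_⟩, ?_⟩
  · rw [Mem.put_of_ne _ _ (by norm_num), hτ₇, Mem.put_of_ne _ _ (by norm_num), hτ₆,
      Mem.put_self, Function.update_self]
  · rw [Mem.put_of_ne _ _ (by norm_num), hτ₇, Mem.put_self, Function.update_self]
  · rw [Mem.put_self, Function.update_self]
  · rw [h2 2 (by norm_num) (by norm_num) (by norm_num), pow_succ 2 j, mul_two, pow_add]
    exact hholds
  · rw [h2 2 (by norm_num) (by norm_num) (by norm_num)]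
    exact fun i hi => (hentry i hi).trans hG
  · rw [h2 1 (by norm_num) (by norm_num) (by norm_num)]
    exact hframe 1 (by norm_num) (by norm_num) (by norm_num)

/-- The program that squares all quantities the required number of times. -/
def powProg : Program := .while (lt (var 6) vars) E.roundProg

/-- No logarithm is computed: cell `6` holds `2 ^ 2 ^ j`, and this is less than `n` exactly as long
as `j < rounds n`. -/
lemma reaches_powProg : ∃ κ, ∀ (e : Env k) (σ : Mem), e.Ok E → E.Inv e 0 σ →
    ∃ τ, Reaches E.powProg σ τ (κ * ((rounds e.n + 1) * e.unit)) ∧ E.Inv e (rounds e.n) τ ∧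
      τ 1 = σ 1 := by
  obtain ⟨κ, hκ⟩ := E.reaches_roundProg
  refine ⟨κ + 1 + (lt (var 6) vars).weight, fun e σ hE hσ => ?_⟩
  have hU := e.one_le_unit
  set c := (lt (var 6) vars).weight with hc
  have hcost : ∀ τ : Mem, e.Good τ → (lt (var 6) vars).cost τ ≤ c * e.unit := fun τ hτ =>
    (cost_le hτ.bdd _).trans (Nat.mul_le_mul_left _ (Nat.le_mul_of_pos_left _ (Nat.succ_pos _)))
  have heval : ∀ (τ : Mem) (j : ℕ), E.Inv e j τ →
      (lt (var 6) vars).eval τ = if j < rounds e.n then 1 else 0 := by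
    intro τ j hτ
    have h6 : (var 6).eval τ = ((2 ^ 2 ^ j : ℕ) : ℤ) := hτ.z_eq
    rw [eval, h6, eval_vars hτ.good.inp_eq]
    refine if_congr ?_ rfl rfl
    rw [Nat.cast_lt, rounds, Nat.lt_clog_iff_pow_lt one_lt_two,
      Nat.lt_clog_iff_pow_lt one_lt_two]
  have key : ∀ d j : ℕ, j + d = rounds e.n → ∀ σ, E.Inv e j σ →
      ∃ τ, Reaches E.powProg σ τ ((κ + 1 + c) * ((d + 1) * e.unit)) ∧ E.Inv e (rounds e.n) τ ∧
        τ 1 = σ 1 := by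
    intro d
    induction d with
    | zero =>
      intro j hj σ hσ
      obtain rfl : j = rounds e.n := by omega
      refine ⟨σ, ⟨_, Exec.while_false ?_, ?_⟩, hσ, rfl⟩
      · rw [heval σ _ hσ, if_neg (lt_irrefl _)]
      · have := hcost σ hσ.good
        nlinarith
    | succ d ih =>
      intro j hj σ hσ
      have hjlt : j < rounds e.n := by omega
      obtain ⟨τ, ⟨s, hs, hsle⟩, hτ, h1⟩ := hκ e σ j hE hσ hjlt
      obtain ⟨ρ, ⟨t, ht, htle⟩, hρ, h1'⟩ := ih (j + 1) (by omega) τ hτ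
      refine ⟨ρ, ⟨_, Exec.while_true ?_ hs ht, ?_⟩, hρ, h1'.trans h1⟩
      · rw [heval σ _ hσ, if_pos hjlt]
        exact one_ne_zero
      · have := hcost σ hσ.good
        nlinarith
  exact key (rounds e.n) 0 (zero_add _) σ hσ

/-- The initial budget. -/
def budgetE : Expr :=
  sub (div (mul (power num 2) (power size 2))
    (mul (mul (lit (4 ^ k)) (power den 2)) (power vars E.r))) (var 5)

/-- The program that prepares the squarings. -/
def initProg : Program :=
  .seq E.corrProg (.seq E.diagProg (.seq (assign 6 (lit 2)) (.seq (assign 7 E.dimE)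
    (assign 8 E.budgetE))))

lemma reaches_initProg : ∃ κ, ∀ (e : Env k) (σ : Mem), e.Ok E → e.Good σ →
    ∃ τ, Reaches E.initProg σ τ (κ * e.unit) ∧ E.Inv e 0 τ ∧ τ 1 = σ 1 := by
  obtain ⟨κ, hκ⟩ := E.reaches_corrProg
  obtain ⟨κ', hκ'⟩ := E.reaches_diagProg
  apply Exists.intro
  intro e σ hE hσ
  have hY := hE.two_le
  obtain ⟨τ, hτ, hτg, hτf, hτ2, hτe⟩ := hκ e σ hE hσ
  obtain ⟨ρ, hρ, hρg, hρf, hρ5⟩ := hκ' e τ hE hτg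
  have hle : ∀ (x q : ℕ), x ≤ e.Y ^ q → q ≤ 4 → x ≤ e.X := fun x q hx hq =>
    Env.le_X hY (q := q) (j := 0) (by omega) (Nat.zero_le _) hx
  have h6 := Env.reaches_assign hρg 6 (lit 2) (z := 2) rfl
  have hg6 := hρg.put (a := 6) (by norm_num) (z := 2) (hle 2 1 (by simpa using hY) (by norm_num))
  set τ₆ := ρ.put 6 2 with hτ₆
  have h7 := Env.reaches_assign hg6 7 E.dimE (E.eval_dimE hg6.inp_eq)
  have hg7 := hg6.put (a := 7) (by norm_num) (z := ((E.dim e.n : ℕ) : ℤ))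
    ((Int.natAbs_natCast _).le.trans (hle _ 1 (by simpa using hE.dim_le_base) (by norm_num)))
  set τ₇ := τ₆.put 7 ((E.dim e.n : ℕ) : ℤ) with hτ₇
  have h8 := Env.reaches_assign hg7 8 E.budgetE (z := E.budget (e.l : Instance k e.n) e.γ) (by
    have h5 : (var 5).eval τ₇ = (E.triples e.n).diag (e.l : Instance k e.n) := by
      rw [← hρ5, ← ρ.put_of_ne 2 (show 5 ≠ 6 by norm_num), ← hτ₆,
        ← τ₆.put_of_ne ((E.dim e.n : ℕ) : ℤ) (show 5 ≠ 7 by norm_num)]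
      rfl
    rw [budgetE, budget, eval, h5, eval, eval, eval, eval, eval, eval_power, eval_power, eval_power,
      eval_power, eval_num hg7.inp_eq, eval_size hg7.inp_eq, eval_den hg7.inp_eq,
      eval_vars hg7.inp_eq]
    rfl)
  have hg8 := hg7.put (a := 8) (by norm_num)
    (z := E.budget (e.l : Instance k e.n) e.γ) (hle _ 4 hE.budget_le le_rfl)
  have h2 : ∀ a, a ≠ 6 → a ≠ 7 → a ≠ 8 →
      τ₇.put 8 (E.budget (e.l : Instance k e.n) e.γ) a = ρ a := by
    intro a ha6 ha7 ha8
    rw [Mem.put_of_ne _ _ ha8, hτ₇, Mem.put_of_ne _ _ ha7, hτ₆, Mem.put_of_ne _ _ ha6]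
  refine ⟨_, Env.reaches_seq e.one_le_unit hτ (Env.reaches_seq e.one_le_unit hρ
    (Env.reaches_seq e.one_le_unit h6 (Env.reaches_seq e.one_le_unit h7 h8))),
    ⟨hg8, ?_, ?_, ?_, ?_, ?_⟩, ?_⟩
  · rw [Mem.put_of_ne _ _ (by norm_num), hτ₇, Mem.put_of_ne _ _ (by norm_num), hτ₆,
      Mem.put_self, Function.update_self]
    rfl
  · rw [Mem.put_of_ne _ _ (by norm_num), hτ₇, Mem.put_self, Function.update_self, pow_zero,
      pow_one]
  · rw [Mem.put_self, Function.update_self, pow_zero, pow_one]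
  · rw [h2 2 (by norm_num) (by norm_num) (by norm_num), pow_zero, pow_one,
      hρf 2 (by norm_num) (by norm_num)]
    exact hτ2
  · rw [h2 2 (by norm_num) (by norm_num) (by norm_num), hρf 2 (by norm_num) (by norm_num)]
    exact fun i hi => (hτe i hi).trans hE.card_le_base
  · rw [h2 1 (by norm_num) (by norm_num) (by norm_num), hρf 1 (by norm_num) (by norm_num),
      hτf 1 (by norm_num) (by norm_num)]

/-- The program that multiplies the flag by the negation of a truth value. -/
def clearIf (f : Expr) : Program := assign 1 (mul (var 1) (sub (lit 1) f))

lemma reaches_clearIf {e : Env k} {σ : Mem} (h : e.Good σ) {f g : Expr} :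
    ∃ τ, Reaches (clearIf (lt f g)) σ τ
      ((2 + (mul (var 1) (sub (lit 1) (lt f g))).weight) * e.unit) ∧ e.Good τ ∧
      (∀ a, a ≠ 1 → τ a = σ a) ∧
      τ 1 0 = σ 1 0 * if f.eval σ < g.eval σ then 0 else 1 := by
  have h0 : (mul (var 1) (sub (lit 1) (lt f g))).eval σ
      = σ 1 0 * if f.eval σ < g.eval σ then 0 else 1 := by
    simp only [eval, Int.toNat_zero]
    split_ifs <;> simp
  refine ⟨_, Env.reaches_assign h 1 _ h0, h.put one_ne_zero ?_, fun a ha => σ.put_of_ne _ ha, ?_⟩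
  · rw [Int.natAbs_mul]
    refine le_trans ?_ (h.bdd 1 0)
    split_ifs <;> simp
  · rw [Mem.put_self, Function.update_self]

/-- The program that computes the sum of the squares of the entries of the matrix. -/
def normProg : Program :=
  .seq (assign 9 (lit 0))
    (accLoop 4 (mul E.dimE E.dimE) 9 (lit 0) (mul (get 2 (var 4)) (get 2 (var 4))))

/-- Renumbering rows and columns is an isomorphism of matrix algebras. -/
lemma corrFin_pow {n : ℕ} (I : Instance k n) (q : ℕ) :
    E.corrFin I ^ q
      = ((E.triples n).corr I ^ q).submatrix (E.rowEquiv n).symm (E.rowEquiv n).symm :=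
  (map_pow (Matrix.reindexAlgEquiv ℤ ℤ (E.rowEquiv n)) ((E.triples n).corr I) q).symm

lemma reaches_normProg : ∃ κ, ∀ (e : Env k) (σ : Mem), e.Ok E → E.Inv e (rounds e.n) σ →
    ∃ τ, Reaches E.normProg σ τ (κ * e.unit) ∧ e.Good τ ∧ (∀ a, a ≠ 9 → a ≠ 4 → τ a = σ a) ∧
      τ 9 0 = ∑ u, ∑ v,
        (((E.triples e.n).corr (e.l : Instance k e.n)) ^ 2 ^ rounds e.n) u v ^ 2 := by
  apply Exists.intro
  intro e σ hE hI
  have hσ := hI.good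
  have h94 : (9 : ℕ) ≠ 4 := by norm_num
  have hd := hE.sq_dim_le
  have hW := hE.W_le
  have hY := hE.two_le
  set N := E.dim e.n with hN
  set q := 2 ^ rounds e.n with hq
  have hq1 : 1 ≤ q := Nat.one_le_two_pow
  have h1 := Env.reaches_assign hσ 9 (lit 0) (z := 0) rfl
  set σ₁ := σ.put 9 0 with hσ₁
  have hG₁ : e.Good σ₁ := hσ.put (by norm_num) (by simp)
  have h90 : σ₁ 9 0 = 0 := by rw [hσ₁, Mem.put_self, Function.update_self]
  have hat0 : ∀ w f, (σ₁.at 4 w 9 f) 0 = inp e.l e.γ := fun w f =>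
    (σ₁.at_of_ne w f (by norm_num) (by norm_num)).trans hG₁.inp_eq
  have hat2 : ∀ w f, (σ₁.at 4 w 9 f) 2 = σ 2 := fun w f =>
    (σ₁.at_of_ne w f (by norm_num) (by norm_num)).trans (σ.put_of_ne _ (by norm_num))
  have hat4 : ∀ w f, (σ₁.at 4 w 9 f) 4 0 = w := fun w f => σ₁.at_counter w f h94
  have hX : ∀ w ≤ N * N, ∀ j, (σ₁ 9 j + ∑ w' ∈ Finset.range w,
      if 0 = j then σ 2 w' * σ 2 w' else 0).natAbs ≤ e.X := by
    intro w hw j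
    rcases eq_or_ne 0 j with rfl | hj
    · rw [h90, zero_add]
      refine (natAbs_sum_ite_le (c := (e.Y ^ (5 * q - 3)) ^ 2) _ fun w' hw' => ?_).trans ?_
      · rw [Int.natAbs_mul, sq]
        have := hI.entry_le w' (hw'.trans_le hw)
        exact Nat.mul_le_mul this this
      -- At most `Y ^ 2` squares of entries are added; the exponent stays below the `12 * 2 ^ rounds
      -- n` of the cell bound.
      · refine Env.le_X hY (q := 2 + 2 * (5 * q - 3)) (j := rounds e.n) ?_ le_rfl ?_
        · omega
        · rw [pow_add, mul_comm 2 (5 * q - 3), pow_mul _ _ 2]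
          refine Nat.mul_le_mul_right _ (hw.trans ?_)
          rw [sq]
          exact Nat.mul_le_mul hE.dim_le_base hE.dim_le_base
    · simp only [if_neg hj, Finset.sum_const_zero, add_zero]
      exact hG₁.bdd 9 j
  have h2 := reaches_accLoop hG₁.bdd (c := 4) (a := 9) (e := mul E.dimE E.dimE) (i := lit 0)
    (v := mul (get 2 (var 4)) (get 2 (var 4)))
    (m := N * N) (I := fun _ => 0) (V := fun w => σ 2 w * σ 2 w) h94 (hd.trans hW)
    (fun w _ f => by
      rw [eval, E.eval_dimE (hat0 w f)]
      push_cast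
      rfl)
    (fun _ _ _ => rfl)
    (fun w _ f => by
      simp only [eval, Int.toNat_zero, hat4, hat2, Int.toNat_natCast])
    hX
  refine ⟨_, Env.reaches_seq e.one_le_unit h1 (h2.mono (e.loop_time_le hd)),
    ⟨hat0 _ _, ?_⟩, fun a ha9 ha4 => ?_, ?_⟩
  · exact (hG₁.bdd.put ((Int.natAbs_natCast _).le.trans (hd.trans hW))).update (hX (N * N) le_rfl)
  · rw [σ₁.at_of_ne _ _ ha9 ha4, hσ₁, σ.put_of_ne _ ha9]
  · rw [Mem.at_self]
    simp only [h90, zero_add, if_true]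
    rw [Finset.sum_range, ← finProdFinEquiv.sum_comp, Fintype.sum_prod_type,
      ← (E.rowEquiv e.n).sum_comp]
    refine Finset.sum_congr rfl fun u _ => ?_
    rw [← (E.rowEquiv e.n).sum_comp]
    refine Finset.sum_congr rfl fun v _ => ?_
    rw [hI.holds, corrFin_pow, Matrix.submatrix_apply, Equiv.symm_apply_apply,
      Equiv.symm_apply_apply, sq]

/-- The program that clears the flag if the test fails. -/
def testProg : Program :=
  .seq E.initProg (.seq (clearIf (lt (var 8) (lit 0))) (.seq E.powProg (.seq E.normProg
    (clearIf (lt (mul (var 8) (var 8)) (mul (mul (var 7) (var 7)) (var 9)))))))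

open scoped Classical in
-- The sign of the budget is checked before the squarings, which would destroy it.
lemma reaches_testProg : ∃ κ, ∀ (e : Env k) (σ : Mem), e.Ok E → e.Good σ →
    ∃ τ, Reaches E.testProg σ τ (κ * ((rounds e.n + 1) * e.unit)) ∧ e.Good τ ∧
      τ 1 0 = σ 1 0 * if E.Passes (e.l : Instance k e.n) e.γ then 1 else 0 := by
  obtain ⟨κ₁, h₁⟩ := E.reaches_initProg
  obtain ⟨κ₂, h₂⟩ := E.reaches_powProg
  obtain ⟨κ₃, h₃⟩ := E.reaches_normProg
  apply Exists.intro
  intro e σ hE hσ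
  have hU : 1 ≤ (rounds e.n + 1) * e.unit := Nat.mul_pos (Nat.succ_pos _) e.one_le_unit
  have hle : ∀ κ, κ * e.unit ≤ κ * ((rounds e.n + 1) * e.unit) := fun κ =>
    Nat.mul_le_mul_left _ (Nat.le_mul_of_pos_left _ (Nat.succ_pos _))
  obtain ⟨σ₁, hσ₁, hI₁, hf₁⟩ := h₁ e σ hE hσ
  obtain ⟨σ₂, hσ₂, hg₂, hf₂, he₂⟩ := reaches_clearIf hI₁.good (f := var 8) (g := lit 0)
  have hI₂ : E.Inv e 0 σ₂ := ⟨hg₂, by rw [hf₂ 6 (by norm_num)]; exact hI₁.z_eq,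
    by rw [hf₂ 7 (by norm_num)]; exact hI₁.dim_eq,
    by rw [hf₂ 8 (by norm_num)]; exact hI₁.budget_eq,
    by rw [hf₂ 2 (by norm_num)]; exact hI₁.holds,
    by rw [hf₂ 2 (by norm_num)]; exact hI₁.entry_le⟩
  obtain ⟨σ₃, hσ₃, hI₃, hf₃⟩ := h₂ e σ₂ hE hI₂
  obtain ⟨σ₄, hσ₄, hg₄, hf₄, he₄⟩ := h₃ e σ₃ hE hI₃
  obtain ⟨σ₅, hσ₅, hg₅, -, he₅⟩ := reaches_clearIf hg₄ (f := mul (var 8) (var 8))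
    (g := mul (mul (var 7) (var 7)) (var 9))
  refine ⟨σ₅, Env.reaches_seq hU (hσ₁.mono (hle _)) (Env.reaches_seq hU (hσ₂.mono (hle _))
    (Env.reaches_seq hU hσ₃ (Env.reaches_seq hU (hσ₄.mono (hle _)) (hσ₅.mono (hle _))))), hg₅, ?_⟩
  have e8 : (var 8).eval σ₁ = E.budget (e.l : Instance k e.n) e.γ := by
    rw [eval, eval, Int.toNat_zero, hI₁.budget_eq, pow_zero, pow_one]
  have e8' : (var 8).eval σ₄ = E.budget (e.l : Instance k e.n) e.γ ^ 2 ^ rounds e.n := by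
    rw [eval, eval, Int.toNat_zero, hf₄ 8 (by norm_num) (by norm_num), hI₃.budget_eq]
  have e7 : (var 7).eval σ₄ = ((e.n : ℤ) ^ E.s * (e.n : ℤ) ^ E.s) ^ 2 ^ rounds e.n := by
    rw [eval, eval, Int.toNat_zero, hf₄ 7 (by norm_num) (by norm_num), hI₃.dim_eq]
    push_cast
    rfl
  have e9 : (var 9).eval σ₄ = _ := he₄
  have e1 : (mul (var 8) (var 8)).eval σ₄
      = (E.budget (e.l : Instance k e.n) e.γ ^ 2 ^ rounds e.n) ^ 2 := by
    rw [sq, ← e8']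
    rfl
  have e2 : (mul (mul (var 7) (var 7)) (var 9)).eval σ₄
      = (((e.n : ℤ) ^ E.s * (e.n : ℤ) ^ E.s) ^ 2 ^ rounds e.n) ^ 2
        * ∑ u, ∑ v, (((E.triples e.n).corr (e.l : Instance k e.n)) ^ 2 ^ rounds e.n) u v ^ 2 := by
    rw [sq (_ ^ _), ← e7, ← e9]
    rfl
  have e0 : (lit 0).eval σ₁ = 0 := rfl
  rw [e1, e2] at he₅
  rw [e8, e0] at he₂
  rw [he₅, hf₄ 1 (by norm_num) (by norm_num), hf₃, he₂, hf₁, mul_assoc]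
  congr 1
  by_cases hb : E.budget (e.l : Instance k e.n) e.γ < 0
  · rw [if_pos hb, zero_mul, if_neg fun h : E.Passes _ _ => absurd h.1 (not_le.2 hb)]
  · rw [if_neg hb, one_mul]
    split_ifs with h h' h'
    · exact absurd h'.2 (not_le.2 h)
    · rfl
    · rfl
    · exact absurd ⟨not_lt.1 hb, not_lt.1 h⟩ h'

end Split

end RandomCSP

/-! ### The whole algorithm and its polynomial running time -/

namespace RandomCSP

open RandomCSP.Expr

/-- The program that runs the tests of all members of `L`. -/
def testAll {k : ℕ} : List (Split k) → Program
  | [] => .skip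
  | E :: L => .seq E.testProg (testAll L)

/-- The program that accepts if all tests are passed or `γ` is at least one. -/
def refuter {k : ℕ} (L : List (Split k)) : Program :=
  .seq (assign 1 (lit 1)) (.seq (testAll L) (assign 1 (add (var 1) (sub (lit 1) (lt num den)))))

open scoped Classical in
lemma reaches_testAll {k : ℕ} (L : List (Split k)) : ∃ κ, ∀ (e : Env k) (σ : Mem),
    (∀ E ∈ L, e.Ok E) → e.Good σ →
    ∃ τ, Reaches (testAll L) σ τ (κ * ((rounds e.n + 1) * e.unit)) ∧ e.Good τ ∧
      τ 1 0 = σ 1 0 * if ∀ E ∈ L, E.Passes (e.l : Instance k e.n) e.γ then 1 else 0 := by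
  induction L with
  | nil =>
    refine ⟨1, fun e σ _ hσ => ⟨σ, ⟨1, Exec.skip σ, ?_⟩, hσ, by simp⟩⟩
    rw [one_mul]
    exact Nat.mul_pos (Nat.succ_pos _) e.one_le_unit
  | cons E L ih =>
    obtain ⟨κ, hκ⟩ := E.reaches_testProg
    obtain ⟨κ', hκ'⟩ := ih
    refine ⟨κ + κ' + 1, fun e σ hL hσ => ?_⟩
    obtain ⟨τ, hτ, hg, h1⟩ := hκ e σ (hL E (by simp)) hσ
    obtain ⟨ρ, hρ, hg', h1'⟩ := hκ' e τ (fun E' h => hL E' (by simp [h])) hg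
    refine ⟨ρ, Env.reaches_seq (Nat.mul_pos (Nat.succ_pos _) e.one_le_unit) hτ hρ, hg', ?_⟩
    rw [h1', h1, mul_assoc]
    congr 1
    simp only [List.mem_cons, forall_eq_or_imp]
    split_ifs <;> simp_all

/-- The final flag is a sum of two truth values, hence nonzero exactly if one of them is true; `1 ≤
γ` is decided by comparing numerator and denominator. -/
lemma reaches_refuter {k : ℕ} (L : List (Split k)) : ∃ κ, ∀ (e : Env k) (σ : Mem),
    2 ≤ e.Y → (∀ E ∈ L, e.Ok E) → e.Good σ →
    ∃ τ, Reaches (refuter L) σ τ (κ * ((rounds e.n + 1) * e.unit)) ∧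
      (τ 1 0 ≠ 0 ↔ (∀ E ∈ L, E.Passes (e.l : Instance k e.n) e.γ) ∨ 1 ≤ e.γ) := by
  classical
  obtain ⟨κ, hκ⟩ := reaches_testAll L
  apply Exists.intro
  intro e σ hY hL hσ
  have hU : 1 ≤ (rounds e.n + 1) * e.unit := Nat.mul_pos (Nat.succ_pos _) e.one_le_unit
  have hle : ∀ κ, κ * e.unit ≤ κ * ((rounds e.n + 1) * e.unit) := fun κ =>
    Nat.mul_le_mul_left _ (Nat.le_mul_of_pos_left _ (Nat.succ_pos _))
  have h1 := Env.reaches_assign hσ 1 (lit 1) (z := 1) rfl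
  have hg1 := hσ.put (a := 1) one_ne_zero (z := 1)
    (Env.le_X hY (q := 1) (j := 0) (by norm_num) (Nat.zero_le _) (by simp; omega))
  obtain ⟨τ, hτ, hg, ht⟩ := hκ e _ hL hg1
  have h2 := Env.reaches_assign hg 1 (add (var 1) (sub (lit 1) (lt num den))) rfl
  refine ⟨_, Env.reaches_seq hU (h1.mono (hle _)) (Env.reaches_seq hU hτ (h2.mono (hle _))), ?_⟩
  rw [Mem.put_self, Function.update_self] at ht ⊢
  have hnum : e.γ.num < e.γ.den ↔ ¬ 1 ≤ e.γ := by
    rw [not_le, Rat.num_lt_denom_iff]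
  have h3 : (add (var 1) (sub (lit 1) (lt num den))).eval τ
      = τ 1 0 + (1 - if e.γ.num < e.γ.den then 1 else 0) := by
    simp only [eval, eval_num hg.inp_eq, eval_den hg.inp_eq, Int.toNat_zero]
  rw [h3, ht, one_mul]
  simp only [hnum]
  split_ifs <;> simp_all

lemma initMem_zero {k n : ℕ} (l : List (Constraint k n)) (γ : ℚ) :
    initMem (encode l γ) 0 = inp l γ := rfl

lemma Split.two_mul_s_le {k : ℕ} (E : Split k) : E.s + E.s ≤ k := by
  have := Fintype.card_le_of_injective _ E.inj
  simp only [Fintype.card_sum, Fintype.card_fin] at this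
  omega

lemma Split.arity_pos {k : ℕ} (E : Split k) : 1 ≤ k := by
  have := Fintype.card_le_of_injective _ E.inj
  simp only [Fintype.card_sum, Fintype.card_fin] at this
  have := E.pos
  omega

lemma Split.natAbs_diag_le {k n : ℕ} (E : Split k) (l : List (Constraint k n)) :
    ((E.triples n).diag (l : Instance k n)).natAbs ≤ l.length * l.length := by
  have h : ∀ (f : Constraint k n → ℤ) (c : ℕ), (∀ C, (f C).natAbs ≤ c) →
      ((l : Instance k n).map f).sum.natAbs ≤ l.length * c := by
    intro f c hf
    rw [Multiset.map_coe, Multiset.sum_coe]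
    induction l with
    | nil => simp
    | cons C l ih =>
      rw [List.map_cons, List.sum_cons, List.length_cons, Nat.succ_mul, Nat.add_comm (_ * _)]
      exact (Int.natAbs_add_le _ _).trans (add_le_add (hf C) ih)
  refine h _ _ fun C => (h _ 1 fun C' => ?_).trans (mul_one _).le
  split_ifs
  · rw [Int.natAbs_mul, E.natAbs_χ, E.natAbs_χ]
  · simp

/-- The bounds that are used for an input. -/
def envOf {k n : ℕ} (l : List (Constraint k n)) (γ : ℚ) : Env k where
  n := n
  l := l
  γ := γ
  Y := (n + l.length + γ.num.natAbs + γ.den + 2) ^ (k + 4)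
  W := (n + l.length + 1) ^ (3 * k)

section EnvOf

variable {k n : ℕ} (l : List (Constraint k n)) (γ : ℚ)

lemma two_le_base : 2 ≤ (envOf l γ).Y := by
  refine le_trans ?_ (Nat.le_self_pow (by omega : k + 4 ≠ 0) _)
  omega

/-- The dimension is at most `n ^ k`, so its cube accounts for the exponent `3 * k` of `W`. The
numbers of `γ` enter `Y` but not `W`: they may be exponential in the input size, which is harmless
for cells and would be fatal for iteration counts. -/
lemma Split.ok_envOf (E : Split k) : (envOf l γ).Ok E := by
  set Z := n + l.length + γ.num.natAbs + γ.den + 2 with hZ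
  have hZ1 : 1 ≤ Z := by omega
  have hY : (envOf l γ).Y = Z ^ (k + 4) := rfl
  have hs := E.two_mul_s_le
  have hk := E.arity_pos
  have hdim : n ^ E.s * n ^ E.s ≤ (n + l.length + 1) ^ k := by
    rw [← pow_add]
    exact (Nat.pow_le_pow_left (by omega) _).trans (Nat.pow_le_pow_right (by omega) hs)
  have hmm : l.length * l.length ≤ (n + l.length + 1) ^ 2 := by
    rw [sq]
    exact Nat.mul_le_mul (by omega) (by omega)
  have hmZ : l.length * l.length ≤ Z ^ 2 := hmm.trans (Nat.pow_le_pow_left (by omega) _)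
  refine ⟨hmm.trans (Nat.pow_le_pow_right (by omega) (by omega)), ?_, ?_, two_le_base l γ,
    ?_, ?_, ?_⟩
  · refine (Nat.mul_le_mul (Nat.mul_le_mul hdim hdim) hdim).trans (le_of_eq ?_)
    rw [← pow_add, ← pow_add]
    simp only [envOf]
    congr 1
    omega
  · refine Env.le_X (two_le_base l γ) (q := 12) (j := 0) (by norm_num) (Nat.zero_le _) ?_
    rw [hY, ← pow_mul]
    exact (Nat.pow_le_pow_left (by omega) _).trans (Nat.pow_le_pow_right hZ1 (by omega))
  · refine hdim.trans ?_
    rw [hY]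
    exact (Nat.pow_le_pow_left (by omega) _).trans (Nat.pow_le_pow_right hZ1 (by omega))
  · refine hmZ.trans ?_
    rw [hY, ← pow_mul]
    exact Nat.pow_le_pow_right hZ1 (by omega)
  · have h1 : (E.budget (l : Instance k n) γ).natAbs ≤ Z ^ 4 + Z ^ 4 := by
      rw [Split.budget]
      refine (Int.natAbs_sub_le _ _).trans (add_le_add ?_ ?_)
      · refine (Int.natAbs_ediv_le_natAbs _ _).trans ?_
        rw [Int.natAbs_mul, Int.natAbs_pow, Int.natAbs_pow, Multiset.coe_card, Int.natAbs_natCast,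
          show 4 = 2 + 2 from rfl, pow_add Z]
        exact Nat.mul_le_mul (Nat.pow_le_pow_left (by omega) _) (Nat.pow_le_pow_left (by omega) _)
      · exact ((E.natAbs_diag_le l).trans hmZ).trans (Nat.pow_le_pow_right hZ1 (by omega))
    refine h1.trans ?_
    rw [← two_mul, hY, ← pow_mul]
    refine (Nat.mul_le_mul_right _ (show 2 ≤ Z by omega)).trans ?_
    rw [← pow_succ']
    exact Nat.pow_le_pow_right hZ1 (by omega)

lemma good_initMem : (envOf l γ).Good (initMem (encode l γ)) := by
  refine ⟨initMem_zero l γ, fun a i => ?_⟩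
  rw [initMem]
  split_ifs
  · refine (natAbs_inp_le l γ i).trans
      (Env.le_X (two_le_base l γ) (q := 1) (j := 0) (by norm_num) (Nat.zero_le _) ?_)
    rw [pow_one]
    exact le_trans (by omega) (Nat.le_self_pow (by omega : k + 4 ≠ 0) _)
  · exact Nat.zero_le _

lemma two_pow_rounds_le (n : ℕ) : 2 ^ rounds n ≤ 2 * n + 2 := by
  have h1 : Nat.clog 2 n ≤ n := Nat.clog_le_of_le_pow Nat.lt_two_pow_self.le
  rw [rounds]
  rcases Nat.lt_or_ge 1 (Nat.clog 2 n) with h | h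
  · have h2 := Nat.pow_pred_clog_lt_self one_lt_two h
    have h3 := Nat.clog_pos one_lt_two h
    obtain ⟨q, hq⟩ : ∃ q, Nat.clog 2 (Nat.clog 2 n) = q + 1 := ⟨_, (Nat.succ_pred h3.ne').symm⟩
    rw [hq, Nat.pred_succ] at h2
    rw [hq, pow_succ]
    omega
  · rw [Nat.clog_of_right_le_one h]
    omega

/-- The bit length of `X` is that of `Y` times `12 * 2 ^ rounds n`. The first is linear in the input
size and the second has a crude linear bound. -/
lemma size_X_le :
    Nat.size (envOf l γ).X
      ≤ (inputSize l γ + 3) * ((k + 4) * (12 * (2 * inputSize l γ + 2))) := by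
  set N := inputSize l γ with hN
  have hNdef : N = n + l.length + bits γ.num + bits γ.den := rfl
  have hnN : n ≤ N := by omega
  refine le_trans (b := (N + 3) * ((k + 4) * (12 * 2 ^ rounds n))) ?_ ?_
  · rw [Nat.size_le, Env.X]
    have hpos : 0 < (k + 4) * (12 * 2 ^ rounds n) := by positivity
    change ((n + l.length + γ.num.natAbs + γ.den + 2) ^ (k + 4)) ^ (12 * 2 ^ rounds n) < _
    rw [← pow_mul, pow_mul 2]
    refine Nat.pow_lt_pow_left ?_ hpos.ne'
    have h1 : n + l.length < 2 ^ (n + l.length) := Nat.lt_two_pow_self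
    have h2 : 2 ^ (n + l.length) ≤ 2 ^ N := Nat.pow_le_pow_right two_pos (by omega)
    have h3 := natAbs_lt_two_pow_bits γ.num
    have h4 : 2 ^ bits γ.num ≤ 2 ^ N := Nat.pow_le_pow_right two_pos (by omega)
    have h5 := natAbs_lt_two_pow_bits (γ.den : ℤ)
    have h6 : 2 ^ bits γ.den ≤ 2 ^ N := Nat.pow_le_pow_right two_pos (by omega)
    have h7 : 1 ≤ 2 ^ N := Nat.one_le_two_pow
    rw [Int.natAbs_natCast] at h5
    rw [pow_add]
    omega
  · have := two_pow_rounds_le n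
    exact Nat.mul_le_mul_left _ (Nat.mul_le_mul_left _ (Nat.mul_le_mul_left _ (by omega)))

lemma unit_envOf_le : (rounds n + 1) * (envOf l γ).unit
    ≤ (2 * inputSize l γ + 3) * (((inputSize l γ + 1) ^ (3 * k) + 1)
      * ((inputSize l γ + 3) * ((k + 4) * (12 * (2 * inputSize l γ + 2))) + 1)) := by
  have hnN : n + l.length ≤ inputSize l γ := by rw [inputSize]; omega
  have h1 := two_pow_rounds_le n
  have h2 : rounds n < 2 ^ rounds n := Nat.lt_two_pow_self
  refine Nat.mul_le_mul (by omega) (Nat.mul_le_mul ?_ (Nat.succ_le_succ (size_X_le l γ)))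
  exact Nat.succ_le_succ (Nat.pow_le_pow_left (by omega) _)

end EnvOf

lemma exists_reaches_refuter {k : ℕ} (L : List (Split k)) :
    ∃ q : Polynomial ℕ, ∀ (n : ℕ) (l : List (Constraint k n)) (γ : ℚ),
      ∃ τ, Reaches (refuter L) (initMem (encode l γ)) τ (q.eval (inputSize l γ)) ∧
        (τ 1 0 ≠ 0 ↔ (∀ E ∈ L, E.Passes (l : Instance k n) γ) ∨ 1 ≤ γ) := by
  obtain ⟨κ, hκ⟩ := reaches_refuter L
  refine ⟨.C κ * ((2 * .X + 3) * (((.X + 1) ^ (3 * k) + 1)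
    * ((.X + 3) * (.C (k + 4) * (12 * (2 * .X + 2))) + 1))), fun n l γ => ?_⟩
  obtain ⟨τ, hτ, h⟩ := hκ (envOf l γ) _ (two_le_base l γ) (fun E _ => E.ok_envOf l γ)
    (good_initMem l γ)
  refine ⟨τ, hτ.mono ((Nat.mul_le_mul_left _ (unit_envOf_le l γ)).trans (le_of_eq ?_)), h⟩
  simp

lemma polyTime_refuter {k : ℕ} (L : List (Split k)) : PolyTime k (refuter L) := by
  obtain ⟨q, hq⟩ := exists_reaches_refuter L
  refine ⟨q, fun n l γ _ => ?_⟩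
  obtain ⟨τ, ⟨s, hs, hle⟩, -⟩ := hq n l γ
  exact ⟨τ, s, hs, hle⟩

/-- Acceptance asks for some halting run; by determinism it is the run constructed above. -/
lemma certifies_refuter {k n : ℕ} (L : List (Split k)) (l : List (Constraint k n)) (γ : ℚ) :
    Certifies (refuter L) l γ ↔ (∀ E ∈ L, E.Passes (l : Instance k n) γ) ∨ 1 ≤ γ := by
  obtain ⟨q, hq⟩ := exists_reaches_refuter L
  obtain ⟨τ, ⟨s, hs, -⟩, h⟩ := hq n l γ
  rw [← h]
  constructor
  · rintro ⟨τ', s', hs', h'⟩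
    rwa [(hs.unique hs').1] at h'
  · exact fun h => ⟨τ, s, hs, h⟩

end RandomCSP

/-! ### Soundness and success probability of the algorithm -/

namespace RandomCSP

lemma exists_splits (k : ℕ) : ∃ L : List (Split k), L.length ≤ 2 ^ k ∧
    ∀ T : Finset (Fin k), T.Nonempty → ∃ E ∈ L, Finset.univ.image E.f = T := by
  classical
  choose g hg using fun T : {T : Finset (Fin k) // T.Nonempty} => Split.exists_image_eq T.2
  refine ⟨Finset.univ.toList.map g, ?_, fun T hT => ⟨g ⟨T, hT⟩, ?_, hg ⟨T, hT⟩⟩⟩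
  · rw [List.length_map, Finset.length_toList, Finset.card_univ]
    refine (Fintype.card_subtype_le _).trans ?_
    rw [Fintype.card_finset, Fintype.card_fin]
  · exact List.mem_map_of_mem (Finset.mem_toList.2 (Finset.mem_univ _))

lemma val_le_one {k n : ℕ} (P : (Fin k → ℤˣ) → Bool) (I : Instance k n) (x : Fin n → ℤˣ) :
    val P I x ≤ 1 :=
  div_le_one_of_le₀ (by exact_mod_cast Multiset.countP_le_card _ _) (by positivity)

lemma neverErrs_refuter {k : ℕ} (P : (Fin k → ℤˣ) → Bool) {L : List (Split k)}
    (hL : ∀ T : Finset (Fin k), T.Nonempty → ∃ E ∈ L, Finset.univ.image E.f = T) :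
    NeverErrs P (refuter L) := by
  intro n l γ hγ h
  rcases (certifies_refuter L l γ).1 h with h | h
  · refine opt_le_of_passes hγ fun T hT => ?_
    obtain ⟨E, hE, hT⟩ := hL T hT
    exact ⟨E, hT, h E hE⟩
  · have hmean : 0 ≤ mean P := by rw [mean]; positivity
    have hγ' : (1 : ℝ) ≤ γ := by exact_mod_cast h
    refine (ciSup_le fun x => val_le_one P _ x).trans ?_
    linarith

open scoped Classical in
-- A union bound in which the failure of the common event `A` is paid for only once, since each test
-- is only required to succeed given `A`.
lemma bexp_forall_le {Ω S : Type*} [Fintype Ω] {p : ℝ} (hp : p ∈ Set.Icc (0 : ℝ) 1)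
    {A : Finset Ω → Prop} {Q : S → Finset Ω → Prop} {a b : ℝ} (L : List S)
    (hA : bexp p (fun I => if A I then 0 else 1) ≤ a)
    (hQ : ∀ E ∈ L, bexp p (fun I => if A I → Q E I then 0 else 1) ≤ b) :
    bexp p (fun I => if A I ∧ ∀ E ∈ L, Q E I then 0 else 1) ≤ a + L.length * b := by
  induction L with
  | nil => simpa using hA
  | cons E L ih =>
    have h1 := ih fun E' h => hQ E' (by simp [h])
    have h2 := hQ E (by simp)
    have h3 : bexp p (fun I => if A I ∧ ∀ E' ∈ E :: L, Q E' I then 0 else 1)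
        ≤ bexp p (fun I => if A I ∧ ∀ E ∈ L, Q E I then 0 else 1)
          + bexp p (fun I => if A I → Q E I then 0 else 1) := by
      rw [← bexp_add]
      refine bexp_mono hp fun I => ?_
      simp only [List.mem_cons, forall_eq_or_imp]
      split_ifs <;> first | tauto | norm_num
    rw [List.length_cons]
    push_cast
    linarith

/-- A bound on the probability of failure. -/
noncomputable def failure (k n : ℕ) : ℝ :=
  if n ≤ 2 then 1 else 4 / n + 2 ^ k * (1 / n + 1 / Real.log n)

lemma failure_nonneg (k n : ℕ) : 0 ≤ failure k n := by
  rw [failure]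
  split_ifs with h
  · exact zero_le_one
  · have := one_le_log_of_three_le (n := n) (by omega)
    positivity

lemma tendsto_failure (k : ℕ) : Tendsto (failure k) atTop (𝓝 0) := by
  have h1 : Tendsto (fun n : ℕ => (n : ℝ)) atTop atTop := tendsto_natCast_atTop_atTop
  have h2 : Tendsto (fun n : ℕ => 4 / (n : ℝ) + 2 ^ k * (1 / (n : ℝ) + 1 / Real.log n)) atTop
      (𝓝 (0 + 2 ^ k * (0 + 0))) :=
    (h1.const_div_atTop 4).add (((h1.const_div_atTop 1).add
      ((Real.tendsto_log_atTop.comp h1).const_div_atTop 1)).const_mul _)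
  rw [add_zero, mul_zero, add_zero] at h2
  refine h2.congr' ?_
  filter_upwards [eventually_gt_atTop 2] with n hn
  rw [failure, if_neg (by omega)]

lemma certifiedEvent_refuter_eq_univ {k n : ℕ} (L : List (Split k)) {γ : ℚ} (hγ : 1 ≤ γ) :
    certifiedEvent (refuter L) k n γ = Set.univ :=
  Set.eq_univ_of_forall fun _ l _ _ => (certifies_refuter L l γ).2 (.inr hγ)

lemma one_sub_failure_le {k n : ℕ} (hk : 2 ≤ k) {L : List (Split k)} (hL : L.length ≤ 2 ^ k)
    (p : unitInterval) {γ : ℚ} (hγ : 0 < γ)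
    (hM : 2 ^ (20 * k) * (n : ℝ) ^ ((k : ℝ) / 2) * Real.log n ^ 5 / (γ : ℝ) ^ 2
      ≤ 2 ^ k * (n : ℝ) ^ k * p) :
    1 - failure k n ≤ (randomInstance k n p).real (certifiedEvent (refuter L) k n γ) := by
  classical
  by_cases hn : n ≤ 2
  · rw [failure, if_pos hn, sub_self]
    exact measureReal_nonneg
  rcases le_or_gt 1 γ with hγ1 | hγ1
  · rw [certifiedEvent_refuter_eq_univ L hγ1, randomInstance, probReal_univ]
    linarith [failure_nonneg k n]
  have hn3 : 3 ≤ n := by omega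
  have hlog := one_le_log_of_three_le hn3
  have hn1 : (1 : ℝ) ≤ n := by exact_mod_cast (by omega : 1 ≤ n)
  have hcard : (p : ℝ) * Fintype.card (Constraint k n) = 2 ^ k * (n : ℝ) ^ k * p := by
    simp [Fintype.card_prod, mul_comm]
  -- Here `k ≥ 2` enters: the expected number of constraints is at least `n`, so Chebyshev's bound
  -- tends to zero.
  have hnM : (n : ℝ) ≤ 2 ^ k * (n : ℝ) ^ k * p := by
    refine le_trans ?_ (Split.rpow_half_le hn3 hγ hγ1 hM)
    have hk' : (1 : ℝ) ≤ (k : ℝ) / 2 := by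
      have : (2 : ℝ) ≤ k := by exact_mod_cast hk
      linarith
    simpa using Real.rpow_le_rpow_of_exponent_le hn1 hk'
  have h1 : bexp (p : ℝ) (fun I : Finset (Constraint k n) =>
      if 2 ^ k * (n : ℝ) ^ k * p / 2 ≤ I.card then 0 else 1) ≤ 4 / n := by
    have := bexp_card_lt_le (Ω := Constraint k n) p.2 (by rw [hcard]; linarith)
    rw [hcard] at this
    exact this.trans (div_le_div_of_nonneg_left (by norm_num) (by linarith) hnM)
  have h2 := bexp_forall_le p.2 L h1 fun E _ => E.bexp_not_passes_le hk hn3 hγ hγ1 p.2 hM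
  have h3 : (L.length : ℝ) * (1 / n + 1 / Real.log n) ≤ 2 ^ k * (1 / n + 1 / Real.log n) :=
    mul_le_mul_of_nonneg_right (by exact_mod_cast hL) (by positivity)
  rw [failure, if_neg hn]
  refine le_trans (sub_le_sub_left (h2.trans (add_le_add_right h3 _)) 1) ?_
  refine le_trans (le_of_eq ?_) (one_sub_bexp_le_setBernoulli (Ω := Constraint k n) p
    (G := fun I => 2 ^ k * (n : ℝ) ^ k * p / 2 ≤ I.card ∧ ∀ E ∈ L, E.Passes I.val γ)
    (E := certifiedEvent (refuter L) k n γ) ?_)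
  · congr!
  intro I hI l hl hlI
  -- The test sees only the multiset of constraints, so the order of the list is irrelevant.
  have hlI' : (l : Instance k n) = I.val :=
    Multiset.Nodup.ext (Multiset.coe_nodup.2 hl) I.nodup |>.2 fun C => by simpa using hlI C
  rw [certifies_refuter, hlI']
  exact .inl hI.2

end RandomCSP

theorem mainTheorem3 :
    ∃ c : ℕ, ∀ k : ℕ, 2 ≤ k → ∀ P : (Fin k → ℤˣ) → Bool,
      ∃ A : RandomCSP.Program,
        RandomCSP.PolyTime k A ∧
        RandomCSP.NeverErrs P A ∧
        ∃ ε : ℕ → ℝ, Tendsto ε atTop (𝓝 0) ∧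
          ∀ (n : ℕ) (p : unitInterval) (γ : ℚ), 0 < γ →
            2 ^ (c * k) * (n : ℝ) ^ ((k : ℝ) / 2) * Real.log n ^ 5 / (γ : ℝ) ^ 2
                ≤ 2 ^ k * (n : ℝ) ^ k * (p : ℝ) →
            1 - ε n ≤ (RandomCSP.randomInstance k n p).real
              (RandomCSP.certifiedEvent A k n γ) := by
  -- Two of the twenty factors `2 ^ k` pay for the `4 ^ k` in the budget; the others dominate the
  -- numerical constants in `Split.slack_le` with much to spare.
  refine ⟨20, fun k hk P => ?_⟩
  obtain ⟨L, hlen, hL⟩ := RandomCSP.exists_splits k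
  exact ⟨RandomCSP.refuter L, RandomCSP.polyTime_refuter L, RandomCSP.neverErrs_refuter P hL,
    RandomCSP.failure k, RandomCSP.tendsto_failure k,
    fun n p γ hγ hM => RandomCSP.one_sub_failure_le hk hlen p hγ hM⟩
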